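/- **Conventions.** Standard Borel probability spaces are non-atomic, except that quotient spaces may have atoms. A p.m.p. action of a countable group $G$ on a standard Borel probability space $(X,\mu)$ is an action by Borel maps preserving $\mu$. It is *a.e. free* if for every $g\neq 1$ we have $g\cdot x\ne x$ for almost all $x$, and *weakly mixing* if the diagonal action on $(X\times X,\mu\times\mu)$ is ergodic. Two p.m.p. actions $G\curvearrowright(X,\mu)$ and $G\curvearrowright(X',\mu')$ are *conjugate* if there is an isomorphism of measure spaces (modulo null sets) $T:X\to X'$ with $T(g\cdot x)=g\cdot T(x)$ for all $g\in G$ and almost all $x$. Let $\sigma:G\curvearrowright(X,\mu)$ be p.m.p. with quotient $\rho:G\curvearrowright(Y,\nu)$ under $p:X\to Y$ (measure preserving, and equivariant a.e.), let $\mu=\int\mu_y\,d\nu(y)$ be the disintegration with respect to $p$, and put $\mu\times_p\mu=\int\mu_y\times\mu_y\,d\nu(y)$, a measure on $X\times_pX=\{(x_1,x_2):p(x_1)=p(x_2)\}$. - $\sigma$ is *weakly mixing relative to* $(p,\rho)$ if the diagonal action of $G$ on $(X\times_pX,\mu\times_p\mu)$ is ergodic. - $\sigma$ is *malleable relative to*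 $(p,\rho)$ if the flip $(x_1,x_2)\mapsto(x_2,x_1)$ lies in the connected component of the identity, for the weak topology, in the group of those automorphisms of $(X\times_pX,\mu\times_p\mu)$ that commute with the diagonal action of $G$. - $\sigma$ is *$\{\mathbb T\}$-cocycle superrigid relative to* $(p,\rho)$ if for every measurable cocycle $\alpha:G\times X\to\mathbb T=\{z\in\mathbb C:|z|=1\}$ there are a measurable $f:X\to\mathbb T$ and a measurable cocycle $\vartheta:G\times Y\to\mathbb T$ of $\rho$ such that $\vartheta(g,p(x))=f(g\cdot x)\,\alpha(g,x)\,f(x)^{-1}$ for all $g\in G$ and almost all $x$. The group $G$ *has strongly $\{\mathbb T\}$-cocycle superrigid weakly mixing malleable actions* if every p.m.p. action $\sigma$ of $G$ is $\{\mathbb T\}$-cocycle superrigid relative to every quotient $(p,\rho)$ relative to which it is weakly mixing and malleable. For a countable discrete abelian group $A$, let $\hat A$ be its compact group of characters with normalized Haar measure. Given an action $\sigma_0:\Gamma\curvearrowright\mathbb N$ of a group $\Gamma$, the generalized Bernoulli shift $(\gamma\cdot x)(i)=x(\sigma_0(\gamma)^{-1}(i))$ of $\Gamma$ on $\hat A^{\mathbb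 N}$ with the product measure commutes with the rotation action $(a\cdot x)(i)=a\,x(i)$ of $\hat A$. Let $\sigma_{\hat A}$ be the induced action of $\Gamma$ on the orbit space $\hat A^{\mathbb N}/\hat A$ with the quotient Borel structure and the push-forward measure. **Corollary 4.11.** Let $\Gamma$ be a countable discrete group and $\Delta\lhd\Lambda\le\Gamma$ subgroups such that $\Lambda/\Delta$ has strongly $\{\mathbb T\}$-cocycle superrigid weakly mixing malleable actions. Let $\sigma_0:\Gamma\curvearrowright\mathbb N$ be an action such that all orbits of $\sigma_0\upharpoonright\Lambda$ are infinite and $\sigma_0\upharpoonright\Delta$ has a finite orbit. Let $\rho:\Gamma\curvearrowright(Y,\nu)$ be an a.e. free weakly mixing p.m.p. action such that $\rho\upharpoonright\Delta$ is ergodic. Then for every countable discrete torsion-free abelian group $A$ the diagonal product $\sigma_{\hat A}\times\rho$ is an a.e. free, ergodic p.m.p. action of $\Gamma$ on a standard Borel probability space, and for all countable torsion-free abelian groups $A_0$ and $A_1$, $$A_0\cong A_1\iff\sigma_{\hat A_0}\times\rho\ \text{ and }\ \sigma_{\hat A_1}\times\rho\ \text{ are conjugate.}$$ -/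

import Mathlib

open MeasureTheory ProbabilityTheory

namespace PMP

/-! ### Measure space isomorphisms and the weak topology -/

section Isomorphisms

variable {X X' : Type*} [MeasurableSpace X] [MeasurableSpace X']

/-- `T` is an isomorphism of the measure spaces `(X, μ)` and `(X', μ')` modulo null sets: it is
measure preserving and has a measure preserving inverse almost everywhere. -/
structure IsIsoModNull (μ : Measure X) (μ' : Measure X') (T : X → X') : Prop where
  measurePreserving : MeasurePreserving T μ μ'
  exists_inverse : ∃ S : X' → X, MeasurePreserving S μ' μ ∧
    (∀ᵐ x ∂μ, S (T x) = x) ∧ (∀ᵐ x' ∂μ', T (S x') = x')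

/-- The weak topology, the initial topology for the maps `T ↦ μ (T⁻¹ A ∆ B)` with `A`, `B`
measurable. It is used on the set of automorphisms of `(X, μ)` only. Since inversion is a
homeomorphism of the automorphism group, preimages and images give the same topology there.
Maps that agree almost everywhere are topologically indistinguishable, so it is harmless not to
identify them. -/
@[reducible]
def weakTopology (μ : Measure X) : TopologicalSpace (X → X) :=
  ⨅ (A : {A : Set X // MeasurableSet A}) (B : {B : Set X // MeasurableSet B}),
    TopologicalSpace.induced (fun T : X → X => μ (symmDiff (T ⁻¹' A.1) B.1)) inferInstance

/-- The automorphisms of `(X, μ)` that commute with the action of `G` almost everywhere. -/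
def equivariantAut (G : Type*) [SMul G X] (μ : Measure X) : Set (X → X) :=
  {T | IsIsoModNull μ μ T ∧ ∀ g : G, ∀ᵐ x ∂μ, T (g • x) = g • T x}

/-- Conjugacy of two measure preserving actions of `G`. -/
def Conjugate (G : Type*) [SMul G X] [SMul G X'] (μ : Measure X) (μ' : Measure X') : Prop :=
  ∃ T : X → X', IsIsoModNull μ μ' T ∧ ∀ g : G, ∀ᵐ x ∂μ, T (g • x) = g • T x

/-- The action of `G` on `(X, μ)` is free almost everywhere. -/
def IsAEFree (G : Type*) [Group G] [SMul G X] (μ : Measure X) : Prop :=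
  ∀ g : G, g ≠ 1 → ∀ᵐ x ∂μ, g • x ≠ x

/-- The action of `G` on `(X, μ)` is weakly mixing: the diagonal action on the square is
ergodic. -/
def IsWeaklyMixing (G : Type*) [SMul G X] (μ : Measure X) : Prop :=
  ErgodicSMul G (X × X) (μ.prod μ)

end Isomorphisms

/-! ### Quotients, relative weak mixing, relative malleability, cocycles -/

section Relative

variable (G : Type*) [Group G]
  {X Y : Type*} [MeasurableSpace X] [MeasurableSpace Y] [MulAction G X] [MulAction G Y]

/-- `p` exhibits the action of `G` on `(Y, ν)` as a quotient of the action on `(X, μ)`. -/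
structure IsFactorMap (μ : Measure X) (ν : Measure Y) (p : X → Y) : Prop where
  measurePreserving : MeasurePreserving p μ ν
  equivariant : ∀ g : G, ∀ᵐ x ∂μ, p (g • x) = g • p x

/-- The measure `∫ μ_y × μ_y dν(y)`, where `y ↦ μ_y` is the disintegration of `μ` with respect to
`p : X → Y`, as a measure on `X × X`. It is concentrated on the fibred product
`{(x₁, x₂) | p x₁ = p x₂}`. -/
noncomputable def fibredSquare [StandardBorelSpace X] [Nonempty X]
    (μ : Measure X) [IsFiniteMeasure μ] (ν : Measure Y) (p : X → Y) : Measure (X × X) :=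
  ν.bind ((condDistrib id p μ) ×ₖ (condDistrib id p μ))

/-- The action on `(X, μ)` is weakly mixing relative to its quotient `p`. -/
def IsWeaklyMixingRel [StandardBorelSpace X] [Nonempty X]
    (μ : Measure X) [IsFiniteMeasure μ] (ν : Measure Y) (p : X → Y) : Prop :=
  ErgodicSMul G (X × X) (fibredSquare μ ν p)

/-- The action on `(X, μ)` is malleable relative to its quotient `p`: the flip lies in the connected
component of the identity in the group of automorphisms of the fibred square that commute with the
diagonal action. -/
def IsMalleableRel [StandardBorelSpace X] [Nonempty X]
    (μ : Measure X) [IsFiniteMeasure μ] (ν : Measure Y) (p : X → Y) : Prop :=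
  (Prod.swap : X × X → X × X) ∈
    @connectedComponentIn (X × X → X × X) (weakTopology (fibredSquare μ ν p))
      (equivariantAut G (fibredSquare μ ν p)) id

/-- A measurable cocycle, with values in the group `T`, of the action of `G` on `(X, μ)`. -/
structure IsCocycle {T : Type*} [Group T] [MeasurableSpace T]
    (μ : Measure X) (α : G → X → T) : Prop where
  measurable : ∀ g, Measurable (α g)
  map_mul : ∀ g h, ∀ᵐ x ∂μ, α (g * h) x = α g (h • x) * α h x

/-- Every measurable `T`-valued cocycle of the action on `(X, μ)` is cohomologous to a cocycle of
the quotient action on `(Y, ν)`. -/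
def IsCocycleSuperrigidRel (T : Type*) [Group T] [MeasurableSpace T]
    (μ : Measure X) (ν : Measure Y) (p : X → Y) : Prop :=
  ∀ α : G → X → T, IsCocycle G μ α →
    ∃ (f : X → T) (θ : G → Y → T), Measurable f ∧ IsCocycle G ν θ ∧
      ∀ g, ∀ᵐ x ∂μ, θ g (p x) = f (g • x) * α g x * (f x)⁻¹

end Relative

/-- The group `G` has strongly `{T}`-cocycle superrigid weakly mixing malleable actions: every
probability measure preserving action on a non-atomic standard Borel space is `{T}`-cocycle
superrigid relative to every quotient relative to which it is weakly mixing and malleable.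
The quotient may have atoms, as the one-point quotient does. Every standard Borel space is
isomorphic to one in `Type`. -/
def HasSuperrigidMalleableActions (G : Type*) [Group G]
    (T : Type*) [Group T] [MeasurableSpace T] : Prop :=
  ∀ (X Y : Type) [MeasurableSpace X] [StandardBorelSpace X] [Nonempty X]
    [MeasurableSpace Y] [StandardBorelSpace Y]
    [MulAction G X] [MeasurableConstSMul G X] [MulAction G Y] [MeasurableConstSMul G Y]
    (μ : Measure X) [IsProbabilityMeasure μ] [NullSingletonClass μ] [SMulInvariantMeasure G X μ]
    (ν : Measure Y) [IsProbabilityMeasure ν] [SMulInvariantMeasure G Y ν]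
    (p : X → Y), IsFactorMap G μ ν p → IsWeaklyMixingRel G μ ν p → IsMalleableRel G μ ν p →
      IsCocycleSuperrigidRel G T μ ν p

/-- An action of `L` on `ℕ` is `D`-suitable, for a subgroup `D` of `L`, if all of its orbits are
infinite and its restriction to `D` has a finite orbit. -/
def IsSuitable {L : Type*} [Group L] (D : Subgroup L) (σ₀ : L →* Equiv.Perm ℕ) : Prop :=
  (∀ n, (Set.range fun g : L => σ₀ g n).Infinite) ∧
    ∃ n, (Set.range fun d : D => σ₀ (d : L) n).Finite

/-! ### Quotients of generalized Bernoulli shifts -/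

section Bernoulli

/-- The space of orbits of `K ^ ℕ` under the rotation action `(a • x) i = a * x i` of `K`. The
permutation action `σ₀` is recorded because it determines the action on this space. -/
def BernoulliQuotient {Γ : Type*} [Group Γ] (_σ₀ : Γ →* Equiv.Perm ℕ)
    (K : Type*) [CommGroup K] : Type _ :=
  MulAction.orbitRel.Quotient K (ℕ → K)

variable {Γ : Type*} [Group Γ] (σ₀ : Γ →* Equiv.Perm ℕ) (K : Type*) [CommGroup K]

/-- The quotient map from `K ^ ℕ` to the space of rotation orbits. -/
def BernoulliQuotient.mk (x : ℕ → K) : BernoulliQuotient σ₀ K :=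
  Quotient.mk (MulAction.orbitRel K (ℕ → K)) x

/-- The generalized Bernoulli shift, `(γ • x) i = x (γ⁻¹ • i)`, on the space of rotation orbits. -/
instance : MulAction Γ (BernoulliQuotient σ₀ K) where
  smul γ := Quotient.map (fun (x : ℕ → K) i => x ((σ₀ γ)⁻¹ i)) (by
    rintro _ y ⟨a, rfl⟩
    exact ⟨a, rfl⟩)
  one_smul := by
    rintro ⟨x⟩
    refine congrArg (BernoulliQuotient.mk σ₀ K) (funext fun i => ?_)
    simp
  mul_smul γ γ' := by
    rintro ⟨x⟩
    refine congrArg (BernoulliQuotient.mk σ₀ K) (funext fun i => ?_)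
    simp

/-- The quotient σ-algebra. -/
instance [MeasurableSpace K] : MeasurableSpace (BernoulliQuotient σ₀ K) :=
  MeasurableSpace.map (BernoulliQuotient.mk σ₀ K) inferInstance

/-- The image of the product of the normalized Haar measures. -/
noncomputable def BernoulliQuotient.measure [TopologicalSpace K] [IsTopologicalGroup K]
    [CompactSpace K] [MeasurableSpace K] [BorelSpace K] : Measure (BernoulliQuotient σ₀ K) :=
  (Measure.infinitePi fun _ : ℕ =>
    (Measure.haarMeasure (⊤ : TopologicalSpace.PositiveCompacts K))).map
      (BernoulliQuotient.mk σ₀ K)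

end Bernoulli

/-! ### Borel structures -/

/-- The Borel σ-algebra on the circle group. -/
noncomputable instance : MeasurableSpace Circle := borel _

instance : BorelSpace Circle := ⟨rfl⟩


section Dual

variable (A : Type*) [CommGroup A] [TopologicalSpace A]

/-- The Borel σ-algebra on the character group. -/
noncomputable instance : MeasurableSpace (PontryaginDual A) := borel _

instance : BorelSpace (PontryaginDual A) := ⟨rfl⟩

end Dual

end PMP

namespace PMP

/-! ### Generalized Bernoulli shifts -/

section Shift

open Filter Set
open scoped symmDiff ENNReal Pointwise

/-! The group `A` is recovered from the action of `Λ` on `σ_Â × ρ` as a quotient of a group of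
circle-valued cocycles. Write `K` for the dual of `A` and `D` for `Δ`, and consider the cocycles `c`
of `Λ` that are trivial on `D`. Pulled back to `K ^ ℕ × Y`, such a cocycle is `D`-invariant, so it
depends only on `Y` and on the coordinates with finite `D`-orbit
(`exists_eq_restrictFin_of_invariant`). There it is cohomologous, through some `f`, to a function of
`Y` and the group element (`exists_untwisting`). As `c` comes from the quotient by rotations, `f`
and its rotation by `k` differ by a constant factor. This factor is a measurable character of `K`,
that is, an element `a` of `A` (`exists_eq_eval_of_measurable`), called here the twist of `c`
(`exists_isTwist`).

Twists multiply as cocycles do, and every `a` occurs: the sum of `x i a` over a finite `D`-orbit of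
indices `i` is `D`-invariant and is multiplied by `k a` under rotation, so the coboundary of its
phase descends to the quotient and has twist `a` (`exists_cocycle_isTwist`). The twist is trivial
exactly when some power of `c` is, up to a coboundary, constant on the space for each group element.
One direction rests on ergodicity of `D` on `Y` (`IsTwist.isPowerTrivial`), the other on
torsion-freeness of `A` (`IsTwist.eq_one_of_isPowerTrivial`). Since this condition does not mention
`K`, conjugacies preserve it, and `A` is the group of cocycles trivial on `D` modulo those
satisfying it (`nonempty_mulEquiv_of_conjugate`).

Untwisting has to reduce to actions of `Λ ⧸ D`, although `D` acts on `Y` and permutes the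
coordinates. The space `Y` is replaced by a factor that codes the sections of the cocycle and on
which `D` acts trivially (`exists_untwisting_real`). The coordinates are relabelled by means of an
independent second copy of the shift: its values rank the points of every finite `D`-orbit, and the
labels (orbit, rank) are fixed by `D` (`exists_untwisting_doubled`). A cross-ratio argument then
removes the second copy. The relative weak mixing needed for superrigidity follows from ergodicity
of products with infinite-orbit shifts (`ergodicSMul_shift_prod`). Relative malleability follows
from the path that at time `t` exchanges two coordinates when both lie below `t`
(`isMalleableRel_shift_prod`). -/

/-- A group acting on an infinite-orbit set moves any finite set off itself. -/
theorem exists_forall_notMem_of_infinite_orbits {G I : Type*} [Group G] (σ : G →* Equiv.Perm I)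
    (hσ : ∀ i, (Set.range fun g => σ g i).Infinite) (J : Finset I) :
    ∃ g : G, ∀ i ∈ J, σ g i ∉ J := by
  classical
  let _ : MulAction G I := MulAction.compHom I σ
  have hsm : ∀ (g : G) (i : I), g • i = σ g i := fun _ _ => rfl
  -- Neumann's lemma: otherwise `G` is a union of finitely many cosets of stabilizers, so some
  -- stabilizer has finite index and its orbit is finite.
  by_contra! hcon
  let P : Finset (I × I) := (J ×ˢ J).filter fun p => ∃ g : G, σ g p.1 = p.2
  let c : I × I → G := fun p => if h : ∃ g : G, σ g p.1 = p.2 then h.choose else 1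
  have hc : ∀ p ∈ P, σ (c p) p.1 = p.2 := by
    intro p hp
    have h := (Finset.mem_filter.1 hp).2
    simp only [c, dif_pos h]
    exact h.choose_spec
  have hcov : ⋃ p ∈ P, c p • (MulAction.stabilizer G p.1 : Set G) = Set.univ := by
    refine Set.eq_univ_of_forall fun g => ?_
    obtain ⟨i, hi, hgi⟩ := hcon g
    have hp : (i, σ g i) ∈ P :=
      Finset.mem_filter.2 ⟨Finset.mem_product.2 ⟨hi, hgi⟩, g, rfl⟩
    refine Set.mem_iUnion₂.2 ⟨_, hp, ?_⟩
    rw [mem_leftCoset_iff]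
    change (c (i, σ g i))⁻¹ * g ∈ MulAction.stabilizer G i
    rw [MulAction.mem_stabilizer_iff, mul_smul, hsm g i, inv_smul_eq_iff]
    exact (hc _ hp).symm
  obtain ⟨p, -, hp⟩ := Subgroup.exists_finiteIndex_of_leftCoset_cover hcov
  have : Finite (MulAction.orbit G p.1) := by
    have := Subgroup.finite_quotient_of_finiteIndex (H := MulAction.stabilizer G p.1)
    exact Finite.of_equiv _ (MulAction.orbitEquivQuotientStabilizer G p.1).symm
  exact hσ p.1 (Set.toFinite (MulAction.orbit G p.1))

/-- Functions on `I`, with `G` acting by permuting coordinates via `σ`. -/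
def Shift {G I : Type*} [Group G] (_σ : G →* Equiv.Perm I) (B : Type*) : Type _ := I → B

variable {G I : Type*} [Group G] (σ : G →* Equiv.Perm I) {B : Type*}

instance : MulAction G (Shift σ B) where
  smul g x := fun i => x ((σ g)⁻¹ i)
  one_smul x := funext fun i => by change x _ = x i; simp
  mul_smul g h x := funext fun i => by change x _ = x _; simp

theorem Shift.smul_apply (g : G) (x : Shift σ B) (i : I) :
    (g • x : Shift σ B) i = x ((σ g)⁻¹ i) := rfl

variable [MeasurableSpace B]

instance : MeasurableSpace (Shift σ B) := inferInstanceAs (MeasurableSpace (I → B))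

instance [Countable I] [StandardBorelSpace B] : StandardBorelSpace (Shift σ B) :=
  inferInstanceAs (StandardBorelSpace (I → B))

instance [Nonempty B] : Nonempty (Shift σ B) := inferInstanceAs (Nonempty (I → B))

/-- The product measure on the space of a generalized Bernoulli shift. -/
noncomputable def Shift.measure (β : Measure B) : Measure (Shift σ B) :=
  Measure.infinitePi fun _ : I => β

instance (β : Measure B) [IsProbabilityMeasure β] : IsProbabilityMeasure (Shift.measure σ β) :=
  inferInstanceAs (IsProbabilityMeasure (Measure.infinitePi fun _ : I => β))

theorem Shift.measurable_apply (i : I) : Measurable fun x : Shift σ B => x i :=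
  measurable_pi_apply i

theorem Shift.measurable_of_apply {Z : Type*} [MeasurableSpace Z] {f : Z → Shift σ B}
    (h : ∀ i, Measurable fun z => f z i) : Measurable f :=
  measurable_pi_lambda _ h

instance : MeasurableConstSMul G (Shift σ B) where
  measurable_const_smul _ := Shift.measurable_of_apply σ fun _ => Shift.measurable_apply σ _

instance (β : Measure B) [IsProbabilityMeasure β] :
    SMulInvariantMeasure G (Shift σ B) (Shift.measure σ β) where
  measure_preimage_smul g s hs := by
    have h := Measure.map_infinitePi_infinitePi_of_inj (P := fun _ : I => β)
      (f := fun i => (σ g)⁻¹ i) ((σ g)⁻¹).injective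
    have h2 : Measure.map (fun x : Shift σ B => g • x) (Shift.measure σ β) =
      Shift.measure σ β := h
    conv_rhs => rw [← h2]
    rw [Measure.map_apply (measurable_const_smul g) hs]

end Shift

/-! ### Diagonal actions on products. -/

section ProdAction

variable {G X Y : Type*} [MeasurableSpace X] [MeasurableSpace Y]

instance [SMul G X] [SMul G Y] [MeasurableConstSMul G X] [MeasurableConstSMul G Y] :
    MeasurableConstSMul G (X × Y) where
  measurable_const_smul g :=
    ((measurable_const_smul g).comp measurable_fst).prodMk
      ((measurable_const_smul g).comp measurable_snd)

instance [SMul G X] [SMul G Y] [MeasurableConstSMul G X] [MeasurableConstSMul G Y]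
    (μ : Measure X) (ν : Measure Y) [SFinite μ] [SFinite ν]
    [SMulInvariantMeasure G X μ] [SMulInvariantMeasure G Y ν] :
    SMulInvariantMeasure G (X × Y) (μ.prod ν) where
  measure_preimage_smul g _ hs :=
    ((measurePreserving_smul g μ).prod (measurePreserving_smul g ν)).measure_preimage
      hs.nullMeasurableSet

end ProdAction

/-! ### Sets depending on finitely many coordinates: independence and density. -/

section DependsOn

open Filter Set
open scoped symmDiff ENNReal Pointwise

variable {I B M : Type*} [MeasurableSpace B] [MeasurableSpace M]

theorem infinitePi_inter_of_disjoint (β : Measure B) [IsProbabilityMeasure β] {J J' : Finset I}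
    (hJ : Disjoint J J') {C D : Set (I → B)} (hC : MeasurableSet C) (hD : MeasurableSet D)
    (hCJ : ∀ x x' : I → B, (∀ i ∈ J, x i = x' i) → x ∈ C → x' ∈ C)
    (hDJ : ∀ x x' : I → B, (∀ i ∈ J', x i = x' i) → x ∈ D → x' ∈ D) :
    Measure.infinitePi (fun _ : I => β) (C ∩ D) =
      Measure.infinitePi (fun _ : I => β) C * Measure.infinitePi (fun _ : I => β) D := by
  classical
  have hB : Nonempty B := nonempty_of_isProbabilityMeasure β
  let b : B := hB.some
  have key : ∀ (J : Finset I) (C : Set (I → B)), MeasurableSet C →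
      (∀ x x' : I → B, (∀ i ∈ J, x i = x' i) → x ∈ C → x' ∈ C) →
      ∃ C' : Set (J → B), MeasurableSet C' ∧ C = (fun (x : I → B) (i : J) => x i) ⁻¹' C' := by
    intro J C hC hCJ
    refine ⟨(fun (z : J → B) (i : I) => if h : i ∈ J then z ⟨i, h⟩ else b) ⁻¹' C, ?_, ?_⟩
    · refine measurableSet_preimage (measurable_pi_lambda _ fun i => ?_) hC
      by_cases h : i ∈ J
      · simp only [h, dif_pos]; exact measurable_pi_apply _
      · simp only [h, dif_neg, not_false_eq_true]; exact measurable_const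
    · ext x
      constructor
      · exact fun hx => hCJ _ _ (fun i hi => by simp [hi]) hx
      · exact fun hx => hCJ _ _ (fun i hi => by simp [hi]) hx
  obtain ⟨C', hC', rfl⟩ := key J C hC hCJ
  obtain ⟨D', hD', rfl⟩ := key J' D hD hDJ
  have hind := (iIndepFun_infinitePi (P := fun _ : I => β) (X := fun _ (ω : B) => ω)
    (fun _ => measurable_id)).indepFun_finset J J' hJ (fun i => measurable_pi_apply i)
  exact hind.measure_inter_preimage_eq_mul _ _ hC' hD'

/-- Sets that depend on finitely many coordinates of the first factor approximate all sets. -/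
theorem exists_symmDiff_lt_dependsOn (μ : Measure ((I → B) × M)) [IsFiniteMeasure μ]
    {S : Set ((I → B) × M)} (hS : MeasurableSet S) {ε : ℝ≥0∞} (hε : 0 < ε) :
    ∃ (J : Finset I) (C : Set ((I → B) × M)), MeasurableSet C ∧
      (∀ x x' m, (∀ i ∈ J, x i = x' i) → (x, m) ∈ C → (x', m) ∈ C) ∧ μ (C ∆ S) < ε := by
  classical
  let R : Set (Set ((I → B) × M)) := {C | MeasurableSet C ∧ ∃ J : Finset I,
    ∀ x x' m, (∀ i ∈ J, x i = x' i) → (x, m) ∈ C → (x', m) ∈ C}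
  have hR : IsSetRing R := by
    refine ⟨⟨MeasurableSet.empty, ∅, by simp⟩, ?_, ?_⟩
    · rintro s t ⟨hs, J, hJ⟩ ⟨ht, J', hJ'⟩
      refine ⟨hs.union ht, J ∪ J', fun x x' m h hx => ?_⟩
      rcases hx with hx | hx
      · exact Or.inl (hJ x x' m (fun i hi => h i (Finset.mem_union_left _ hi)) hx)
      · exact Or.inr (hJ' x x' m (fun i hi => h i (Finset.mem_union_right _ hi)) hx)
    · rintro s t ⟨hs, J, hJ⟩ ⟨ht, J', hJ'⟩
      refine ⟨hs.diff ht, J ∪ J', fun x x' m h hx => ⟨?_, fun hx' => hx.2 ?_⟩⟩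
      · exact hJ x x' m (fun i hi => h i (Finset.mem_union_left _ hi)) hx.1
      · exact hJ' x' x m (fun i hi => (h i (Finset.mem_union_right _ hi)).symm) hx'
  have huniv : Set.univ ∈ R := ⟨MeasurableSet.univ, ∅, by simp⟩
  have hgen : (inferInstance : MeasurableSpace ((I → B) × M)) = MeasurableSpace.generateFrom R := by
    apply le_antisymm
    · refine sup_le ?_ ?_
      · rw [MeasurableSpace.comap_le_iff_le_map]
        refine iSup_le fun i => ?_
        rintro _ ⟨s, hs, rfl⟩
        refine MeasurableSpace.measurableSet_generateFrom
          ⟨measurable_fst (measurable_pi_apply i hs), {i}, fun x x' m h hx => ?_⟩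
        have := h i (by simp)
        simp only [mem_preimage] at hx ⊢
        rwa [← this]
      · rintro _ ⟨s, hs, rfl⟩
        exact MeasurableSpace.measurableSet_generateFrom
          ⟨measurable_snd hs, ∅, fun x x' m h hx => hx⟩
    · exact MeasurableSpace.generateFrom_le fun s hs => hs.1
  obtain ⟨C, ⟨hC, J, hJ⟩, hlt⟩ := exists_measure_symmDiff_lt_of_generateFrom_isSetRing (μ := μ) hR
    ⟨{Set.univ}, Set.countable_singleton _, by simpa using huniv, by simp⟩ hgen hS hε
  exact ⟨J, C, hC, hJ, hlt⟩

theorem Shift.exists_symmDiff_lt {G : Type*} [Group G] (σ : G →* Equiv.Perm I)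
    (μ : Measure (Shift σ B × M)) [hμ : IsFiniteMeasure μ]
    {S : Set (Shift σ B × M)} (hS : MeasurableSet S) {ε : ℝ≥0∞} (hε : 0 < ε) :
    ∃ (J : Finset I) (C : Set (Shift σ B × M)), MeasurableSet C ∧
      (∀ x x' m, (∀ i ∈ J, x i = x' i) → (x, m) ∈ C → (x', m) ∈ C) ∧ μ (C ∆ S) < ε :=
  @exists_symmDiff_lt_dependsOn I B M _ _ μ hμ S hS ε hε

theorem Shift.measure_inter_of_disjoint {G : Type*} [Group G] (σ : G →* Equiv.Perm I)
    (β : Measure B) [IsProbabilityMeasure β] {J J' : Finset I}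
    (hJ : Disjoint J J') {C D : Set (Shift σ B)} (hC : MeasurableSet C) (hD : MeasurableSet D)
    (hCJ : ∀ x x' : Shift σ B, (∀ i ∈ J, x i = x' i) → x ∈ C → x' ∈ C)
    (hDJ : ∀ x x' : Shift σ B, (∀ i ∈ J', x i = x' i) → x ∈ D → x' ∈ D) :
    Shift.measure σ β (C ∩ D) = Shift.measure σ β C * Shift.measure σ β D :=
  infinitePi_inter_of_disjoint β hJ hC hD hCJ hDJ

end DependsOn

/-! ### Invariant functions and ergodicity for products with generalized Bernoulli shifts. -/

section InvariantFunctions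

open Filter Set
open scoped symmDiff ENNReal

variable {G I B M : Type*} [Group G] [MeasurableSpace B] [MeasurableSpace M] [MulAction G M]
  [MeasurableConstSMul G M]

/-- A mixing argument. Approximate `S` by a set `C` depending on finitely many coordinates of the
shift and move these coordinates off themselves. On each section, `C` and its translate are
independent, while both stay close to `S` by invariance. Hence the measure `s(y)` of the section of
`S` satisfies `∫ s = ∫ s²`, which forces `s` to take the values `0` and `1` only. -/
theorem ae_section_const_of_invariant_set (σ : G →* Equiv.Perm I)
    (hσ : ∀ i, (Set.range fun g => σ g i).Infinite) (β : Measure B) [IsProbabilityMeasure β]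
    (m : Measure M) [IsProbabilityMeasure m] [SMulInvariantMeasure G M m]
    {S : Set (Shift σ B × M)} (hS : MeasurableSet S)
    (hinv : ∀ g : G, ((g • ·) ⁻¹' S : Set (Shift σ B × M)) =ᵐ[(Shift.measure σ β).prod m] S) :
    ∀ᵐ y ∂m, (∀ᵐ x ∂Shift.measure σ β, (x, y) ∈ S) ∨ (∀ᵐ x ∂Shift.measure σ β, (x, y) ∉ S) := by
  classical
  set P := Shift.measure σ β with hP
  have hPp : IsProbabilityMeasure P := inferInstanceAs (IsProbabilityMeasure (Shift.measure σ β))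
  set μ := P.prod m with hμ
  have hμp : IsProbabilityMeasure μ := inferInstanceAs (IsProbabilityMeasure (P.prod m))
  have hslice : ∀ T : Set (Shift σ B × M), MeasurableSet T → ∀ y,
      MeasurableSet ((fun x : Shift σ B => (x, y)) ⁻¹' T) := fun T hT y =>
    (measurable_id.prodMk measurable_const) hT
  let sec : Set (Shift σ B × M) → M → ℝ := fun T y => P.real ((fun x => (x, y)) ⁻¹' T)
  have hsec_meas : ∀ T, MeasurableSet T → Measurable (sec T) := fun T hT =>
    (measurable_measure_prodMk_right hT).ennreal_toReal
  have hsec_nn : ∀ T y, 0 ≤ sec T y := fun T y => measureReal_nonneg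
  have hsec_le : ∀ T y, sec T y ≤ 1 := fun T y => measureReal_le_one
  have hsec_int : ∀ T, MeasurableSet T → Integrable (sec T) m := fun T hT =>
    Integrable.of_bound (hsec_meas T hT).aestronglyMeasurable 1
      (ae_of_all _ fun y => by rw [Real.norm_eq_abs, abs_of_nonneg (hsec_nn T y)]; exact hsec_le T y)
  have hreal : ∀ T, MeasurableSet T → μ.real T = ∫ y, sec T y ∂m := by
    intro T hT
    rw [Measure.real, hμ, Measure.prod_apply_symm hT, ← integral_toReal]
    · rfl
    · exact (measurable_measure_prodMk_right hT).aemeasurable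
    · exact ae_of_all _ fun y => measure_lt_top _ _
  have hmul_int : ∀ T U, MeasurableSet T → MeasurableSet U →
      Integrable (fun y => sec T y * sec U y) m := fun T U hT hU =>
    Integrable.of_bound ((hsec_meas T hT).mul (hsec_meas U hU)).aestronglyMeasurable 1
      (ae_of_all _ fun y => by
        rw [Real.norm_eq_abs, abs_of_nonneg (mul_nonneg (hsec_nn T y) (hsec_nn U y))]
        exact mul_le_one₀ (hsec_le T y) (hsec_nn U y) (hsec_le U y))
  have hclose : ∀ T U, MeasurableSet T → MeasurableSet U →
      ∫ y, |sec T y - sec U y| ∂m ≤ μ.real (T ∆ U) := by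
    intro T U hT hU
    rw [hreal _ (hT.symmDiff hU)]
    refine integral_mono ((hsec_int T hT).sub (hsec_int U hU)).abs
      (hsec_int _ (hT.symmDiff hU)) fun y => ?_
    exact abs_measureReal_sub_le_measureReal_symmDiff (hslice T hT y).nullMeasurableSet
      (hslice U hU y).nullMeasurableSet
  have hmain : μ.real S = ∫ y, sec S y * sec S y ∂m := by
    refine eq_of_forall_dist_le fun ε hε => ?_
    -- Four errors of `ε / 4` add up: `C` and its translate `U` each replace `S` once in the
    -- intersection and once in the product of section measures.
    obtain ⟨J, C, hC, hJ, hlt⟩ := Shift.exists_symmDiff_lt σ μ hS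
      (ε := ENNReal.ofReal (ε / 4)) (by simpa using hε)
    have hCS : μ.real (C ∆ S) ≤ ε / 4 := by
      rw [Measure.real]
      exact ENNReal.toReal_le_of_le_ofReal (by linarith) hlt.le
    obtain ⟨g, hg⟩ := exists_forall_notMem_of_infinite_orbits σ hσ J
    let U : Set (Shift σ B × M) := (fun z => g⁻¹ • z) ⁻¹' C
    have hU : MeasurableSet U := measurable_const_smul g⁻¹ hC
    have hUS : μ.real (U ∆ S) ≤ ε / 4 := by
      have h1 : μ (U ∆ S) = μ (U ∆ ((fun z => g⁻¹ • z) ⁻¹' S)) :=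
        measure_congr ((ae_eq_refl U).symmDiff (hinv g⁻¹).symm)
      have h2 : U ∆ ((fun z => g⁻¹ • z) ⁻¹' S) = (fun z => g⁻¹ • z) ⁻¹' (C ∆ S) := rfl
      rw [Measure.real, h1, h2, (measurePreserving_smul g⁻¹ μ).measure_preimage
        (hC.symmDiff hS).nullMeasurableSet]
      exact hCS
    have hprod : μ.real (C ∩ U) = ∫ y, sec C y * sec U y ∂m := by
      rw [hreal _ (hC.inter hU)]
      refine integral_congr_ae (ae_of_all _ fun y => ?_)
      have hdis : Disjoint J (J.image (σ g)) := by
        rw [Finset.disjoint_left]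
        intro i hi hi'
        obtain ⟨j, hj, rfl⟩ := Finset.mem_image.1 hi'
        exact hg j hj hi
      have := Shift.measure_inter_of_disjoint σ β hdis (C := ((fun x => (x, y)) ⁻¹' C))
        (D := ((fun x => (x, y)) ⁻¹' U)) (hslice C hC y) (hslice U hU y)
        (fun x x' h hx => hJ x x' y h hx)
        (fun x x' h hx => hJ _ _ _ (fun i hi => by
          rw [Shift.smul_apply, Shift.smul_apply]
          exact h _ (Finset.mem_image.2 ⟨i, hi, by simp⟩)) hx)
      change (P ((fun x => (x, y)) ⁻¹' (C ∩ U))).toReal = _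
      rw [preimage_inter]
      rw [this, ENNReal.toReal_mul]
      rfl
    have h1 : |μ.real (C ∩ U) - μ.real S| ≤ ε / 4 + ε / 4 := by
      refine (abs_measureReal_sub_le_measureReal_symmDiff (hC.inter hU).nullMeasurableSet
        hS.nullMeasurableSet).trans ?_
      refine (measureReal_mono (s₂ := C ∆ S ∪ U ∆ S) ?_).trans
        ((measureReal_union_le _ _).trans (add_le_add hCS hUS))
      intro z hz
      simp only [mem_symmDiff, mem_inter_iff, mem_union] at hz ⊢
      tauto
    have h2 : |(∫ y, sec C y * sec U y ∂m) - ∫ y, sec S y * sec S y ∂m| ≤ ε / 4 + ε / 4 := by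
      rw [← integral_sub (hmul_int C U hC hU) (hmul_int S S hS hS)]
      refine (abs_integral_le_integral_abs).trans ?_
      have hi1 := ((hsec_int C hC).sub (hsec_int S hS)).abs
      have hi2 := ((hsec_int U hU).sub (hsec_int S hS)).abs
      calc ∫ y, |sec C y * sec U y - sec S y * sec S y| ∂m
          ≤ ∫ y, (|sec C y - sec S y| + |sec U y - sec S y|) ∂m := by
            refine integral_mono ((hmul_int C U hC hU).sub (hmul_int S S hS hS)).abs
              (hi1.add hi2) fun y => ?_
            have e : sec C y * sec U y - sec S y * sec S y =
              (sec C y - sec S y) * sec U y + sec S y * (sec U y - sec S y) := by ring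
            simp only [e]
            refine (abs_add_le _ _).trans ?_
            rw [abs_mul, abs_mul, abs_of_nonneg (hsec_nn U y), abs_of_nonneg (hsec_nn S y)]
            exact add_le_add (mul_le_of_le_one_right (abs_nonneg _) (hsec_le U y))
              (mul_le_of_le_one_left (abs_nonneg _) (hsec_le S y))
        _ = (∫ y, |sec C y - sec S y| ∂m) + ∫ y, |sec U y - sec S y| ∂m :=
            integral_add hi1 hi2
        _ ≤ ε / 4 + ε / 4 :=
            add_le_add ((hclose C S hC hS).trans hCS) ((hclose U S hU hS).trans hUS)
    rw [hprod] at h1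
    rw [Real.dist_eq]
    rw [abs_le] at h1 h2 ⊢
    constructor <;> linarith [h1.1, h1.2, h2.1, h2.2]
  have hzero : ∫ y, (sec S y - sec S y * sec S y) ∂m = 0 := by
    rw [integral_sub (hsec_int S hS) (hmul_int S S hS hS), ← hreal S hS, hmain, sub_self]
  have hzero' := (integral_eq_zero_iff_of_nonneg (f := fun y => sec S y - sec S y * sec S y)
    (fun y => by
      have := hsec_nn S y; have := hsec_le S y; simp only [Pi.zero_apply]; nlinarith)
    ((hsec_int S hS).sub (hmul_int S S hS hS))).1 hzero
  filter_upwards [hzero'] with y hy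
  have hy' : sec S y * (1 - sec S y) = 0 := by
    simp only [Pi.zero_apply] at hy
    linarith
  have hmS := hslice S hS y
  rcases mul_eq_zero.1 hy' with h | h
  · right
    have : P ((fun x => (x, y)) ⁻¹' S) = 0 := (measureReal_eq_zero_iff).1 h
    exact measure_eq_zero_iff_ae_notMem.1 this
  · left
    have h1 : P.real ((fun x => (x, y)) ⁻¹' S) = 1 := by
      change sec S y = 1
      linarith
    have : P ((fun x => (x, y)) ⁻¹' S)ᶜ = 0 := by
      rw [prob_compl_eq_zero_iff hmS, ← ENNReal.toReal_eq_one_iff]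
      exact h1
    exact mem_ae_iff.2 this

/-- An invariant function on the product of a generalized Bernoulli shift all of whose orbits are
infinite with another action is a function of the second variable. -/
theorem ae_eq_section_of_invariant (σ : G →* Equiv.Perm I)
    (hσ : ∀ i, (Set.range fun g => σ g i).Infinite) (β : Measure B) [IsProbabilityMeasure β]
    (m : Measure M) [IsProbabilityMeasure m] [SMulInvariantMeasure G M m]
    {D : Type*} [MeasurableSpace D] [StandardBorelSpace D] {φ : Shift σ B × M → D}
    (hφ : Measurable φ)
    (hinv : ∀ g : G, ∀ᵐ z ∂(Shift.measure σ β).prod m, φ (g • z) = φ z) :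
    ∀ᵐ x' ∂Shift.measure σ β, ∀ᵐ z ∂(Shift.measure σ β).prod m, φ z = φ (x', z.2) := by
  -- Binary digits reduce the claim to countably many invariant sets; Fubini then turns "constant on
  -- almost every section" into agreement with the section at a generic `x'`.
  obtain ⟨e, he, hinj⟩ := MeasurableSpace.measurable_injection_nat_bool_of_countablySeparated D
  have h1 : ∀ᵐ y ∂m, ∀ n : ℕ, (∀ᵐ x ∂Shift.measure σ β, e (φ (x, y)) n = true) ∨
      (∀ᵐ x ∂Shift.measure σ β, ¬ e (φ (x, y)) n = true) := by
    refine ae_all_iff.2 fun n => ?_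
    refine ae_section_const_of_invariant_set σ hσ β m (S := {z | e (φ z) n = true})
      (measurableSet_eq_fun (((measurable_pi_apply n).comp he).comp hφ) measurable_const)
      fun g => ?_
    filter_upwards [hinv g] with z hz
    apply propext
    change e (φ (g • z)) n = true ↔ e (φ z) n = true
    rw [hz]
  have h2 : ∀ᵐ y ∂m, ∀ᵐ x' ∂Shift.measure σ β, ∀ᵐ x ∂Shift.measure σ β,
      φ (x, y) = φ (x', y) := by
    filter_upwards [h1] with y hy
    have h3 : ∀ᵐ x' ∂Shift.measure σ β, ∀ n, ∀ᵐ x ∂Shift.measure σ β,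
        e (φ (x, y)) n = e (φ (x', y)) n := by
      refine ae_all_iff.2 fun n => ?_
      rcases hy n with h | h
      · filter_upwards [h] with x' hx'
        filter_upwards [h] with x hx
        rw [hx, hx']
      · filter_upwards [h] with x' hx'
        filter_upwards [h] with x hx
        rw [Bool.eq_iff_iff]
        exact iff_of_false hx hx'
    filter_upwards [h3] with x' hx'
    filter_upwards [ae_all_iff.2 hx'] with x hx
    exact hinj (funext hx)
  have hmeas : MeasurableSet {q : Shift σ B × (M × Shift σ B) |
      φ (q.2.2, q.2.1) = φ (q.1, q.2.1)} := measurableSet_eq_fun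
    (hφ.comp (measurable_snd.snd.prodMk measurable_snd.fst))
    (hφ.comp (measurable_fst.prodMk measurable_snd.fst))
  have h3 : ∀ᵐ y ∂m, ∀ᵐ q ∂(Shift.measure σ β).prod (Shift.measure σ β),
      φ (q.2, y) = φ (q.1, y) := by
    filter_upwards [h2] with y hy
    exact (Measure.ae_prod_iff_ae_ae (measurableSet_eq_fun
      (hφ.comp (measurable_snd.prodMk measurable_const))
      (hφ.comp (measurable_fst.prodMk measurable_const)))).2 hy
  have h4 : ∀ᵐ q ∂(Shift.measure σ β).prod (Shift.measure σ β), ∀ᵐ y ∂m,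
      φ (q.2, y) = φ (q.1, y) := by
    refine (Measure.ae_ae_comm ?_).1 h3
    exact measurableSet_eq_fun
      (hφ.comp (measurable_snd.snd.prodMk measurable_fst))
      (hφ.comp (measurable_snd.fst.prodMk measurable_fst))
  filter_upwards [Measure.ae_ae_of_ae_prod h4] with x' hx'
  exact (Measure.ae_prod_iff_ae_ae (measurableSet_eq_fun hφ
    (hφ.comp (measurable_const.prodMk measurable_snd)))).2 hx'

/-- An invariant function for an ergodic action is constant. -/
theorem exists_ae_eq_const_of_invariant (G : Type*) {X D : Type*} [SMul G X] [MeasurableSpace X]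
    (μ : Measure X) [NeZero μ] [ErgodicSMul G X μ] [MeasurableSpace D] [StandardBorelSpace D]
    {φ : X → D} (hφ : Measurable φ) (hinv : ∀ g : G, ∀ᵐ z ∂μ, φ (g • z) = φ z) :
    ∃ d, ∀ᵐ z ∂μ, φ z = d := by
  obtain ⟨e, he, hinj⟩ := MeasurableSpace.measurable_injection_nat_bool_of_countablySeparated D
  have h : ∀ n, ∃ b : Bool, ∀ᵐ z ∂μ, e (φ z) n = b := by
    intro n
    have := aeconst_of_forall_preimage_smul_ae_eq G (μ := μ) (s := {z | e (φ z) n = true})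
      (measurableSet_eq_fun (((measurable_pi_apply n).comp he).comp hφ)
        measurable_const).nullMeasurableSet fun g => by
        filter_upwards [hinv g] with z hz
        apply propext
        change e (φ (g • z)) n = true ↔ e (φ z) n = true
        rw [hz]
    rcases eventuallyConst_set.1 this with h | h
    · exact ⟨true, h⟩
    · refine ⟨false, ?_⟩
      filter_upwards [h] with z hz
      simpa using hz
  choose b hb using h
  have h2 : ∀ᵐ z ∂μ, e (φ z) = b := by
    filter_upwards [ae_all_iff.2 hb] with z hz
    exact funext hz
  obtain ⟨z₀, hz₀⟩ := h2.exists
  refine ⟨φ z₀, ?_⟩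
  filter_upwards [h2] with z hz
  exact hinj (hz.trans hz₀.symm)

/-- The product of a generalized Bernoulli shift, all of whose orbits are infinite, with an ergodic
action is ergodic. -/
theorem ergodicSMul_shift_prod (σ : G →* Equiv.Perm I)
    (hσ : ∀ i, (Set.range fun g => σ g i).Infinite) (β : Measure B) [IsProbabilityMeasure β]
    (m : Measure M) [IsProbabilityMeasure m] [ErgodicSMul G M m] :
    ErgodicSMul G (Shift σ B × M) ((Shift.measure σ β).prod m) where
  aeconst_of_forall_preimage_smul_ae_eq {s} hs hinv := by
    classical
    have h1 := ae_section_const_of_invariant_set σ hσ β m hs hinv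
    have hφ : Measurable fun z => (decide (z ∈ s) : Bool) :=
      measurable_to_bool (by simpa [preimage] using hs)
    have hinv' : ∀ g : G, ∀ᵐ z ∂(Shift.measure σ β).prod m,
        (decide (g • z ∈ s) : Bool) = decide (z ∈ s) := by
      intro g
      filter_upwards [hinv g] with z hz
      have hz' : (g • z ∈ s) = (z ∈ s) := hz
      simp only [hz']
    obtain ⟨x', hx'⟩ := (ae_eq_section_of_invariant σ hσ β m hφ hinv').exists
    have hφ' : Measurable fun y => (decide ((x', y) ∈ s) : Bool) :=
      hφ.comp (measurable_const.prodMk measurable_id)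
    -- The indicator of `s` agrees almost everywhere with its section at `x'`, so that section
    -- inherits invariance on `M`.
    obtain ⟨d, hd⟩ := exists_ae_eq_const_of_invariant G m hφ' fun g => by
      have hz1 : ∀ᵐ z ∂(Shift.measure σ β).prod m,
          (decide ((x', g • z.2) ∈ s) : Bool) = decide ((x', z.2) ∈ s) := by
        filter_upwards [hx', hinv' g, tendsto_smul_ae _ g hx'] with z h1 h2 h3
        rw [← h1, ← h2]
        exact h3.symm
      have h2 := Measure.ae_ae_of_ae_prod hz1
      obtain ⟨x, hx⟩ := h2.exists
      exact hx
    have hd' : ∀ᵐ z ∂(Shift.measure σ β).prod m, (decide ((x', z.2) ∈ s) : Bool) = d :=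
      Measure.quasiMeasurePreserving_snd.ae hd
    rw [eventuallyConst_set]
    rcases d with _ | _
    · right
      filter_upwards [hx', hd'] with z h1 h2
      have := h1.trans h2
      simpa using this
    · left
      filter_upwards [hx', hd'] with z h1 h2
      have := h1.trans h2
      simpa using this

/-- A factor of an ergodic action is ergodic. -/
theorem ErgodicSMul.of_factor_hom {G H X Y : Type*} [SMul G X] [SMul H Y] [MeasurableSpace X]
    [MeasurableSpace Y] [MeasurableConstSMul H Y] {μ : Measure X} {ν : Measure Y}
    [ErgodicSMul G X μ] {π : X → Y} (hπ : MeasurePreserving π μ ν) {q : G → H}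
    (hq : Function.Surjective q) (heq : ∀ g : G, ∀ᵐ x ∂μ, π (g • x) = q g • π x) :
    ErgodicSMul H Y ν where
  measure_preimage_smul h s hs := by
    obtain ⟨g, rfl⟩ := hq h
    rw [← hπ.measure_preimage (measurable_const_smul (q g) hs).nullMeasurableSet,
      ← hπ.measure_preimage hs.nullMeasurableSet,
      ← SMulInvariantMeasure.measure_preimage_smul g (hπ.measurable hs)]
    refine measure_congr ?_
    filter_upwards [heq g] with x hx
    apply propext
    change q g • π x ∈ s ↔ π (g • x) ∈ s
    rw [hx]
  aeconst_of_forall_preimage_smul_ae_eq {s} hs hinv := by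
    have h := aeconst_of_forall_preimage_smul_ae_eq G (μ := μ) (s := π ⁻¹' s)
      (hπ.measurable hs).nullMeasurableSet fun g => by
        filter_upwards [heq g, hπ.quasiMeasurePreserving.ae (hinv (q g))] with x hx hx'
        apply propext
        change π (g • x) ∈ s ↔ π x ∈ s
        rw [hx]
        exact iff_of_eq hx'
    rw [eventuallyConst_set] at h ⊢
    refine h.imp (fun h => ?_) fun h => ?_
    · rw [← hπ.map_eq]; exact (ae_map_iff hπ.aemeasurable hs).2 h
    · rw [← hπ.map_eq]; exact (ae_map_iff hπ.aemeasurable hs.compl).2 h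

theorem ErgodicSMul.of_factor {G X Y : Type*} [SMul G X] [SMul G Y] [MeasurableSpace X]
    [MeasurableSpace Y] [MeasurableConstSMul G Y] {μ : Measure X} {ν : Measure Y}
    [ErgodicSMul G X μ] {π : X → Y} (hπ : MeasurePreserving π μ ν)
    (heq : ∀ g : G, ∀ᵐ x ∂μ, π (g • x) = g • π x) : ErgodicSMul G Y ν :=
  ErgodicSMul.of_factor_hom hπ Function.surjective_id heq

end InvariantFunctions

/-! ### Partial coordinate exchanges and continuity in the weak topology. -/

section FibredSquare

open Filter Set
open scoped symmDiff ENNReal Topology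

/-- Both sides are images of the product measure over `I × Fin 2`, curried in the two possible
orders. -/
theorem infinitePi_map_unzip {I : Type*} (β : Measure ℝ) [IsProbabilityMeasure β] :
    (Measure.infinitePi fun _ : I => β.prod β).map
      (fun x => ((fun i => (x i).1 : I → ℝ), (fun i => (x i).2 : I → ℝ))) =
      (Measure.infinitePi fun _ : I => β).prod (Measure.infinitePi fun _ : I => β) := by
  let Q : Measure (I × Fin 2 → ℝ) := Measure.infinitePi fun _ => β
  have h1 : Q.map (fun q i => (q (i, 0), q (i, 1))) = Measure.infinitePi fun _ : I => β.prod β := by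
    have hc := Measure.infinitePi_map_curry (fun (_ : I) (_ : Fin 2) => β)
    have hp := Measure.infinitePi_map_pi (μ := fun _ : I => Measure.infinitePi fun _ : Fin 2 => β)
      (f := fun _ => MeasurableEquiv.piFinTwo fun _ => ℝ) (fun _ => MeasurableEquiv.measurable _)
    have hb : (Measure.infinitePi fun _ : Fin 2 => β).map (MeasurableEquiv.piFinTwo fun _ => ℝ) =
        β.prod β := by
      rw [Measure.infinitePi_eq_pi]
      exact (measurePreserving_piFinTwo fun _ : Fin 2 => β).map_eq
    have hm : Measurable fun (x : I → Fin 2 → ℝ) i => (MeasurableEquiv.piFinTwo fun _ => ℝ) (x i) :=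
      measurable_pi_lambda _ fun i => (MeasurableEquiv.measurable _).comp (measurable_pi_apply i)
    rw [hb, ← hc, Measure.map_map hm (MeasurableEquiv.measurable _)] at hp
    exact hp
  have h2 : Q.map (fun q => ((fun i => q (i, 0) : I → ℝ), (fun i => q (i, 1) : I → ℝ))) =
      (Measure.infinitePi fun _ : I => β).prod (Measure.infinitePi fun _ : I => β) := by
    have hc := Measure.infinitePi_map_curry (fun (_ : Fin 2) (_ : I) => β)
    have hsw := Measure.map_infinitePi_infinitePi_of_inj (P := fun _ : I × Fin 2 => β)
      (f := fun p : Fin 2 × I => (p.2, p.1)) (Prod.swap_injective)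
    have hb := (measurePreserving_piFinTwo fun _ : Fin 2 => Measure.infinitePi fun _ : I => β).map_eq
    have hm : Measurable fun (ω : I × Fin 2 → ℝ) (p : Fin 2 × I) => ω (p.2, p.1) := by fun_prop
    rw [← Measure.infinitePi_eq_pi, ← hc, ← hsw, Measure.map_map (MeasurableEquiv.measurable _) hm,
      Measure.map_map (MeasurableEquiv.measurable _)
        ((MeasurableEquiv.measurable _).comp hm)] at hb
    exact hb
  rw [← h1, Measure.map_map (by fun_prop) (by fun_prop), ← h2]
  rfl

open Classical in
/-- The involution of the plane that exchanges the coordinates on the quadrant below `(t, t)`. -/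
noncomputable def pairSwap (t : EReal) (q : ℝ × ℝ) : ℝ × ℝ :=
  if (q.1 : EReal) < t ∧ (q.2 : EReal) < t then (q.2, q.1) else q

theorem measurable_pairSwap (t : EReal) : Measurable (pairSwap t) := by
  refine Measurable.ite ?_ (measurable_snd.prodMk measurable_fst) measurable_id
  exact (measurableSet_lt (measurable_coe_real_ereal.comp measurable_fst) measurable_const).inter
    (measurableSet_lt (measurable_coe_real_ereal.comp measurable_snd) measurable_const)

theorem pairSwap_pairSwap (t : EReal) (q : ℝ × ℝ) : pairSwap t (pairSwap t q) = q := by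
  by_cases h : (q.1 : EReal) < t ∧ (q.2 : EReal) < t
  · simp [pairSwap, h]
  · simp only [pairSwap, h, if_false]

/-- The map is the coordinate flip on a flip-invariant set and the identity off it, and `β × β` is
flip-invariant. -/
theorem measurePreserving_pairSwap (t : EReal) (β : Measure ℝ) [IsProbabilityMeasure β] :
    MeasurePreserving (pairSwap t) (β.prod β) (β.prod β) := by
  refine ⟨measurable_pairSwap t, Measure.ext fun S hS => ?_⟩
  let E : Set (ℝ × ℝ) := {q | (q.1 : EReal) < t ∧ (q.2 : EReal) < t}
  have hE : MeasurableSet E :=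
    (measurableSet_lt (measurable_coe_real_ereal.comp measurable_fst) measurable_const).inter
      (measurableSet_lt (measurable_coe_real_ereal.comp measurable_snd) measurable_const)
  rw [Measure.map_apply (measurable_pairSwap t) hS, ← measure_inter_add_sdiff _ hE,
    ← measure_inter_add_sdiff S hE]
  congr 1
  · have h1 : pairSwap t ⁻¹' S ∩ E = Prod.swap ⁻¹' (S ∩ E) := by
      ext ⟨a, b⟩
      simp only [mem_inter_iff, mem_preimage, E, mem_ofPred_eq, pairSwap, Prod.swap_prod_mk]
      constructor
      · rintro ⟨h, h'⟩
        rw [if_pos h'] at h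
        exact ⟨h, h'.2, h'.1⟩
      · rintro ⟨h, h'⟩
        rw [if_pos h'.symm]
        exact ⟨h, h'.2, h'.1⟩
    rw [h1, (Measure.measurePreserving_swap (μ := β) (ν := β)).measure_preimage
      (hS.inter hE).nullMeasurableSet]
  · congr 1
    ext q
    simp only [Set.mem_sdiff, mem_preimage, E, mem_ofPred_eq, pairSwap]
    constructor
    · rintro ⟨h, h'⟩
      rw [if_neg h'] at h
      exact ⟨h, h'⟩
    · rintro ⟨h, h'⟩
      rw [if_neg h']
      exact ⟨h, h'⟩

/-- If almost every orbit is eventually constant with respect to every set of a generating family,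
then a family of measure preserving maps is continuous in measure. -/
theorem tendsto_measure_symmDiff_preimage {Ω P : Type*} [TopologicalSpace P]
    [FirstCountableTopology P] {C : Set (Set Ω)} [mΩ : MeasurableSpace Ω]
    (hgen : mΩ = MeasurableSpace.generateFrom C) (μ : Measure Ω) [IsFiniteMeasure μ]
    (A : P → Ω → Ω) (hA : ∀ t, MeasurePreserving (A t) μ μ) (s : P)
    (hC : ∀ S ∈ C, ∀ᵐ z ∂μ, ∀ᶠ t in 𝓝 s, (A t z ∈ S ↔ A s z ∈ S)) {S : Set Ω}
    (hS : MeasurableSet S) :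
    Tendsto (fun t => μ ((A t ⁻¹' S) ∆ (A s ⁻¹' S))) (𝓝 s) (𝓝 0) := by
  classical
  induction S, (hgen ▸ hS : MeasurableSet[MeasurableSpace.generateFrom C] S)
    using MeasurableSpace.generateFrom_induction with
  | hC S hSC _ =>
    have hm : MeasurableSet S := by
      rw [hgen]; exact MeasurableSpace.measurableSet_generateFrom hSC
    have hD : ∀ t, MeasurableSet ((A t ⁻¹' S) ∆ (A s ⁻¹' S)) := fun t =>
      ((hA t).measurable hm).symmDiff ((hA s).measurable hm)
    have h1 : ∀ t, μ ((A t ⁻¹' S) ∆ (A s ⁻¹' S)) =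
        ∫⁻ z, ((A t ⁻¹' S) ∆ (A s ⁻¹' S)).indicator 1 z ∂μ := fun t => by
      rw [lintegral_indicator_one (hD t)]
    simp_rw [h1]
    have h2 := tendsto_lintegral_filter_of_dominated_convergence (μ := μ) (l := 𝓝 s)
      (F := fun t z => ((A t ⁻¹' S) ∆ (A s ⁻¹' S)).indicator (1 : Ω → ℝ≥0∞) z)
      (f := fun _ => 0) (fun _ => 1)
      (Eventually.of_forall fun t => measurable_one.indicator (hD t))
      (Eventually.of_forall fun t => ae_of_all _ fun z => indicator_le_self' (by simp) z)
      (by simp) ?_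
    · simpa using h2
    · filter_upwards [hC S hSC] with z hz
      refine tendsto_const_nhds.congr' ?_
      filter_upwards [hz] with t ht
      rw [indicator_of_notMem]
      rw [mem_symmDiff, mem_preimage, mem_preimage, ht]
      tauto
  | empty => simp
  | compl S hS' ih =>
    have : ∀ t, (A t ⁻¹' Sᶜ) ∆ (A s ⁻¹' Sᶜ) = (A t ⁻¹' S) ∆ (A s ⁻¹' S) := fun t => by
      rw [preimage_compl, preimage_compl, compl_symmDiff_compl]
    simp_rw [this]
    exact ih (by rw [hgen]; exact hS')
  | iUnion f hf ih =>
    have hfm : ∀ n, MeasurableSet (f n) := fun n => by rw [hgen]; exact hf n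
    have ih' := fun n => ih n (hfm n)
    have hfacc : ∀ n, MeasurableSet (Set.accumulate f n) := fun n =>
      MeasurableSet.biUnion (Set.to_countable _) fun i _ => hfm i
    rw [ENNReal.tendsto_nhds_zero]
    intro ε hε
    -- The part of the union missed by finitely many sets is small, and its preimages are equally
    -- small for every `t` because `A t` preserves `μ`.
    have hacc : Tendsto (fun n => μ ((⋃ i, f i) \ Set.accumulate f n)) atTop (𝓝 0) := by
      have : ⋂ n, ((⋃ i, f i) \ Set.accumulate f n) = ∅ := by
        rw [← sdiff_iUnion, iUnion_accumulate, sdiff_self]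
      rw [← measure_empty (μ := μ), ← this]
      refine tendsto_measure_iInter_atTop (fun n => ?_) (fun a b hab => ?_) ⟨0, measure_ne_top _ _⟩
      · exact ((MeasurableSet.iUnion hfm).diff
          (hfacc n)).nullMeasurableSet
      · exact sdiff_subset_sdiff_right (monotone_accumulate hab)
    have hε3 : 0 < ε / 3 := ENNReal.div_pos hε.ne' (by simp)
    obtain ⟨N, hN⟩ := ((tendsto_order.1 hacc).2 _ hε3).exists
    have hsum : Tendsto (fun t => ∑ n ∈ Finset.range (N + 1), μ ((A t ⁻¹' f n) ∆ (A s ⁻¹' f n)))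
        (𝓝 s) (𝓝 0) := by
      simpa using tendsto_finsetSum (Finset.range (N + 1)) fun n _ => ih' n
    have hR : MeasurableSet ((⋃ i, f i) \ Set.accumulate f N) :=
      (MeasurableSet.iUnion hfm).diff (hfacc N)
    filter_upwards [(tendsto_order.1 hsum).2 _ hε3] with t ht
    calc μ ((A t ⁻¹' ⋃ i, f i) ∆ (A s ⁻¹' ⋃ i, f i))
        ≤ μ ((⋃ n ∈ Finset.range (N + 1), (A t ⁻¹' f n) ∆ (A s ⁻¹' f n)) ∪
            (A t ⁻¹' ((⋃ i, f i) \ Set.accumulate f N) ∪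
              A s ⁻¹' ((⋃ i, f i) \ Set.accumulate f N))) := by
          refine measure_mono fun z hz => ?_
          simp only [mem_symmDiff, mem_preimage, mem_iUnion, mem_union, Set.mem_sdiff, mem_accumulate,
            Finset.mem_range, exists_prop, not_exists, not_and] at hz ⊢
          by_contra! hcon
          rcases hz with ⟨⟨n, hn⟩, h⟩ | ⟨⟨n, hn⟩, h⟩
          · obtain ⟨k, hk, hk'⟩ := hcon.2.1 ⟨n, hn⟩
            exact h k (((hcon.1 k (by omega)).1 hk'))
          · obtain ⟨k, hk, hk'⟩ := hcon.2.2 ⟨n, hn⟩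
            exact h k (((hcon.1 k (by omega)).2 hk'))
      _ ≤ (∑ n ∈ Finset.range (N + 1), μ ((A t ⁻¹' f n) ∆ (A s ⁻¹' f n))) +
            (μ (A t ⁻¹' ((⋃ i, f i) \ Set.accumulate f N)) +
              μ (A s ⁻¹' ((⋃ i, f i) \ Set.accumulate f N))) := by
          refine (measure_union_le _ _).trans (add_le_add (measure_biUnion_finset_le _ _)
            (measure_union_le _ _))
      _ ≤ ε / 3 + (ε / 3 + ε / 3) := by
          rw [(hA t).measure_preimage hR.nullMeasurableSet,
            (hA s).measure_preimage hR.nullMeasurableSet]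
          gcongr
      _ = ε := by rw [← add_assoc, ENNReal.add_thirds]

/-- A family of maps as in `tendsto_measure_symmDiff_preimage` is continuous for the weak
topology. -/
theorem continuous_weakTopology_of_ae_eventually {Ω P : Type*} [TopologicalSpace P]
    [FirstCountableTopology P] {C : Set (Set Ω)} [mΩ : MeasurableSpace Ω]
    (hgen : mΩ = MeasurableSpace.generateFrom C) (μ : Measure Ω) [IsFiniteMeasure μ]
    (A : P → Ω → Ω) (hA : ∀ t, MeasurePreserving (A t) μ μ)
    (hC : ∀ s, ∀ S ∈ C, ∀ᵐ z ∂μ, ∀ᶠ t in 𝓝 s, (A t z ∈ S ↔ A s z ∈ S)) :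
    @Continuous _ _ _ (weakTopology μ) A := by
  refine continuous_iInf_rng.2 fun S => continuous_iInf_rng.2 fun T => continuous_induced_rng.2 ?_
  let F : P → MeasuredSets μ := fun t =>
    ⟨(A t ⁻¹' S.1) ∆ T.1, ((hA t).measurable S.2).symmDiff T.2⟩
  have h : Continuous F := by
    refine continuous_iff_continuousAt.2 fun s => ?_
    rw [ContinuousAt, EMetric.tendsto_nhds]
    intro ε hε
    have := tendsto_measure_symmDiff_preimage hgen μ A hA s (hC s) S.2
    filter_upwards [(tendsto_order.1 this).2 _ hε] with t ht
    rw [MeasuredSets.edist_def]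
    refine lt_of_eq_of_lt ?_ ht
    congr 1
    change ((A t ⁻¹' S.1) ∆ T.1) ∆ ((A s ⁻¹' S.1) ∆ T.1) = _
    rw [symmDiff_symmDiff_symmDiff_comm, symmDiff_self, symmDiff_bot]
  exact MeasuredSets.continuous_measure.comp h

end FibredSquare

/-! ### Relative weak mixing and malleability of Bernoulli shifts with base `ℝ`. -/

section RelativelyMalleable

open Filter Set
open scoped symmDiff ENNReal Topology

variable {H I V : Type*} [Group H] (τ : H →* Equiv.Perm I) [MeasurableSpace V]
  (β : Measure ℝ) [IsProbabilityMeasure β] (ν : Measure V) [IsProbabilityMeasure ν]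

/-- The map `(x, x', v) ↦ ((x, v), (x', v))`. -/
def fibredPair (q : Shift τ ℝ × (Shift τ ℝ × V)) : (Shift τ ℝ × V) × (Shift τ ℝ × V) :=
  ((q.1, q.2.2), (q.2.1, q.2.2))

theorem measurable_fibredPair : Measurable (fibredPair (V := V) τ) :=
  (measurable_fst.prodMk measurable_snd.snd).prodMk
    (measurable_snd.fst.prodMk measurable_snd.snd)

/-- The fibre measure over `v` is `P × δ_v`, so a point of the fibred square consists of two
independent points of the shift and one common point of `V`. -/
theorem fibredSquare_shift_prod [Countable I] [StandardBorelSpace V] [Nonempty V] :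
    fibredSquare ((Shift.measure τ β).prod ν) ν Prod.snd =
      ((Shift.measure τ β).prod ((Shift.measure τ β).prod ν)).map (fibredPair τ) := by
  set P := Shift.measure τ β with hP
  let κ : Kernel V (Shift τ ℝ × V) := (Kernel.const V P) ×ₖ Kernel.id
  have hκ : ∀ v, κ v = P.map fun x => (x, v) := fun v => by
    rw [Kernel.prod_apply, Kernel.const_apply, Kernel.id_apply, Measure.prod_dirac]
  have hcond : condDistrib id Prod.snd (P.prod ν) =ᵐ[ν] κ := by
    have hsnd : (P.prod ν).map Prod.snd = ν := measurePreserving_snd.map_eq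
    have := condDistrib_ae_eq_of_measure_eq_compProd (μ := P.prod ν) (Y := id) Prod.snd
      aemeasurable_id (κ := κ) ?_
    · rwa [hsnd] at this
    · rw [hsnd]
      refine Measure.ext fun S hS => ?_
      rw [Measure.map_apply (measurable_snd.prodMk measurable_id) hS,
        Measure.prod_apply_symm ((measurable_snd.prodMk measurable_id) hS),
        Measure.compProd_apply hS]
      refine lintegral_congr fun v => ?_
      have hm : Measurable fun x : Shift τ ℝ => (x, v) := measurable_id.prodMk measurable_const
      rw [hκ, Measure.map_apply hm (measurable_prodMk_left hS)]
      rfl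
  have h1 : fibredSquare (P.prod ν) ν Prod.snd = ν.bind (κ ×ₖ κ) := by
    refine Measure.bind_congr_right ?_
    filter_upwards [hcond] with v hv
    rw [Kernel.prod_apply, Kernel.prod_apply, hv]
  rw [h1]
  refine Measure.ext fun S hS => ?_
  rw [Measure.bind_apply hS (Kernel.aemeasurable _),
    ← (measurePreserving_prodAssoc P P ν).map_eq,
    Measure.map_map (measurable_fibredPair τ) (MeasurableEquiv.measurable _),
    Measure.map_apply ((measurable_fibredPair τ).comp (MeasurableEquiv.measurable _)) hS,
    Measure.prod_apply_symm (((measurable_fibredPair τ).comp (MeasurableEquiv.measurable _)) hS)]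
  refine lintegral_congr fun v => ?_
  have hm : Measurable fun x : Shift τ ℝ => (x, v) := measurable_id.prodMk measurable_const
  rw [Kernel.prod_apply, hκ, Measure.map_prod_map _ _ hm hm,
    Measure.map_apply (hm.prodMap hm) hS]
  rfl

/-- Through `fibredPair` the fibred square is the product of two infinite-orbit shifts with an
ergodic action, and `ergodicSMul_shift_prod` applies twice. -/
theorem isWeaklyMixingRel_shift_prod [Countable I] [StandardBorelSpace V] [Nonempty V]
    [MulAction H V] [MeasurableConstSMul H V] (hτ : ∀ i, (Set.range fun g => τ g i).Infinite) [ErgodicSMul H V ν] :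
    IsWeaklyMixingRel H ((Shift.measure τ β).prod ν) ν Prod.snd := by
  have h1 := ergodicSMul_shift_prod τ hτ β ν
  have h2 := ergodicSMul_shift_prod τ hτ β ((Shift.measure τ β).prod ν)
  refine ErgodicSMul.of_factor (π := fibredPair τ)
    (μ := (Shift.measure τ β).prod ((Shift.measure τ β).prod ν)) ?_ ?_
  · exact ⟨measurable_fibredPair τ, (fibredSquare_shift_prod τ β ν).symm⟩
  · exact fun g => ae_of_all _ fun q => rfl

/-- The coordinatewise application of `pairSwap` to the fibred square. -/
noncomputable def fibredSwap {V : Type*} (t : EReal) (z : (Shift τ ℝ × V) × (Shift τ ℝ × V)) :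
    (Shift τ ℝ × V) × (Shift τ ℝ × V) :=
  (((fun i => (pairSwap t (z.1.1 i, z.2.1 i)).1), z.1.2),
    ((fun i => (pairSwap t (z.1.1 i, z.2.1 i)).2), z.2.2))

theorem measurable_fibredSwap (t : EReal) : Measurable (fibredSwap (V := V) τ t) := by
  have h : ∀ i, Measurable fun z : (Shift τ ℝ × V) × (Shift τ ℝ × V) =>
      pairSwap t (z.1.1 i, z.2.1 i) := fun i => (measurable_pairSwap t).comp
    (((Shift.measurable_apply τ i).comp measurable_fst.fst).prodMk
      ((Shift.measurable_apply τ i).comp measurable_snd.fst))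
  exact ((Shift.measurable_of_apply τ fun i => (h i).fst).prodMk measurable_fst.snd).prodMk
    ((Shift.measurable_of_apply τ fun i => (h i).snd).prodMk measurable_snd.snd)

theorem fibredSwap_fibredSwap {V : Type*} (t : EReal)
    (z : (Shift τ ℝ × V) × (Shift τ ℝ × V)) :
    fibredSwap τ t (fibredSwap τ t z) = z := by
  have h : ∀ i, pairSwap t (pairSwap t (z.1.1 i, z.2.1 i)) = (z.1.1 i, z.2.1 i) :=
    fun i => pairSwap_pairSwap t _
  refine Prod.ext (Prod.ext (funext fun i => ?_) rfl) (Prod.ext (funext fun i => ?_) rfl)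
  · exact congrArg Prod.fst (h i)
  · exact congrArg Prod.snd (h i)

/-- Once two real sequences are regrouped as one sequence of pairs, the map is `pairSwap t` in every
coordinate of a product measure. -/
theorem measurePreserving_fibredSwap [Countable I] [StandardBorelSpace V] [Nonempty V]
    (t : EReal) : MeasurePreserving (fibredSwap τ t)
      (fibredSquare ((Shift.measure τ β).prod ν) ν Prod.snd)
      (fibredSquare ((Shift.measure τ β).prod ν) ν Prod.snd) := by
  set P := Shift.measure τ β with hP
  let u : Shift τ (ℝ × ℝ) × V → (Shift τ ℝ × V) × (Shift τ ℝ × V) := fun q =>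
    (((fun i => (q.1 i).1), q.2), ((fun i => (q.1 i).2), q.2))
  let unz : Shift τ (ℝ × ℝ) → Shift τ ℝ × Shift τ ℝ :=
    fun x => ((fun i => (x i).1), (fun i => (x i).2))
  have hunz : MeasurePreserving unz (Shift.measure τ (β.prod β)) (P.prod P) :=
    ⟨(Shift.measurable_of_apply τ fun i => (Shift.measurable_apply τ i).fst).prodMk
      (Shift.measurable_of_apply τ fun i => (Shift.measurable_apply τ i).snd),
      infinitePi_map_unzip β⟩
  have hu : MeasurePreserving u ((Shift.measure τ (β.prod β)).prod ν)
      (fibredSquare (P.prod ν) ν Prod.snd) := by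
    have h1 := (measurePreserving_prodAssoc P P ν).comp
      (hunz.prod (MeasurePreserving.id ν))
    have h2 : MeasurePreserving (fibredPair (V := V) τ) (P.prod (P.prod ν))
      (fibredSquare (P.prod ν) ν Prod.snd) :=
      ⟨measurable_fibredPair τ, (fibredSquare_shift_prod τ β ν).symm⟩
    exact h2.comp h1
  let sw : Shift τ (ℝ × ℝ) → Shift τ (ℝ × ℝ) := fun x i => pairSwap t (x i)
  have hsw : MeasurePreserving sw (Shift.measure τ (β.prod β)) (Shift.measure τ (β.prod β)) := by
    refine ⟨Shift.measurable_of_apply τ fun i =>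
      (measurable_pairSwap t).comp (Shift.measurable_apply τ i), ?_⟩
    have := Measure.infinitePi_map_pi (μ := fun _ : I => β.prod β)
      (f := fun _ => pairSwap t) (fun _ => measurable_pairSwap t)
    rw [(measurePreserving_pairSwap t β).map_eq] at this
    exact this
  have hsw' := hsw.prod (MeasurePreserving.id ν)
  refine ⟨measurable_fibredSwap τ t, ?_⟩
  conv_lhs => rw [← hu.map_eq]
  rw [Measure.map_map (measurable_fibredSwap τ t) hu.measurable]
  exact (hu.comp hsw').map_eq

/-- The maps `fibredSwap τ t` act in the same way on every coordinate, so they commute with the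
group; they lead from the identity at `t = ⊥` to the flip at `t = ⊤`. Since `β` has no atoms, a
given coordinate almost surely differs from a given `s`, so the exchanged pair is constant for `t`
near `s`. This makes the path weakly continuous, and `EReal` is connected. -/
theorem isMalleableRel_shift_prod [Countable I] [StandardBorelSpace V] [Nonempty V]
    [MulAction H V] [NullSingletonClass β] :
    IsMalleableRel H ((Shift.measure τ β).prod ν) ν Prod.snd := by
  classical
  set P := Shift.measure τ β with hP
  set m := fibredSquare (P.prod ν) ν (Prod.snd : Shift τ ℝ × V → V) with hm
  have hpair : MeasurePreserving (fibredPair τ) (P.prod (P.prod ν)) m :=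
    ⟨measurable_fibredPair τ, (fibredSquare_shift_prod τ β ν).symm⟩
  have hmp : IsProbabilityMeasure m := by
    rw [← hpair.map_eq]
    exact Measure.isProbabilityMeasure_map hpair.aemeasurable
  have heval : ∀ i, MeasurePreserving (fun x : Shift τ ℝ => x i) P β := fun i =>
    measurePreserving_eval_infinitePi (fun _ : I => β) i
  have hfib : ∀ᵐ z ∂m, z.1.2 = z.2.2 := by
    rw [← hpair.map_eq, ae_map_iff hpair.aemeasurable
      (measurableSet_eq_fun measurable_fst.snd measurable_snd.snd)]
    exact ae_of_all _ fun q => rfl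
  have hne1 : ∀ (i : I) (s : EReal), ∀ᵐ z ∂m, (z.1.1 i : EReal) ≠ s := by
    intro i s
    have hmeas : MeasurableSet {r : ℝ | (r : EReal) ≠ s} :=
      (measurable_coe_real_ereal (measurableSet_singleton s)).compl
    have hr : ∀ᵐ r ∂β, ((r : ℝ) : EReal) ≠ s := by
      induction s with
      | bot => exact ae_of_all _ fun r => EReal.coe_ne_bot r
      | top => exact ae_of_all _ fun r => EReal.coe_ne_top r
      | coe a =>
        have : ∀ᵐ r ∂β, r ≠ a := measure_eq_zero_iff_ae_notMem.1 (measure_singleton a)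
        filter_upwards [this] with r hr h
        exact hr (EReal.coe_injective h)
    rw [← hpair.map_eq]
    refine (ae_map_iff (p := fun z => ((z.1.1 i : ℝ) : EReal) ≠ s) hpair.aemeasurable
      (((Shift.measurable_apply τ i).comp measurable_fst.fst) hmeas)).2 ?_
    exact (Measure.quasiMeasurePreserving_fst).ae ((heval i).quasiMeasurePreserving.ae hr)
  have hswap_ae : ∀ᵐ z ∂m, fibredSwap τ ⊤ z = Prod.swap z := by
    filter_upwards [hfib]
    rintro ⟨⟨x, v⟩, ⟨x', v'⟩⟩ hz
    obtain rfl : v = v' := hz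
    refine Prod.ext (Prod.ext (funext fun i => ?_) rfl) (Prod.ext (funext fun i => ?_) rfl)
    · simp [fibredSwap, pairSwap, EReal.coe_lt_top]
    · simp [fibredSwap, pairSwap, EReal.coe_lt_top]
  have hmswap : MeasurePreserving (Prod.swap : _ → (Shift τ ℝ × V) × (Shift τ ℝ × V)) m m :=
    (measurePreserving_fibredSwap τ β ν ⊤).congr measurable_swap hswap_ae
  have hne2 : ∀ (i : I) (s : EReal), ∀ᵐ z ∂m, (z.2.1 i : EReal) ≠ s := fun i s =>
    hmswap.quasiMeasurePreserving.ae (hne1 i s)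
  -- `fibredSwap τ ⊤` leaves the points of `V` in place, so it is the flip only where these agree,
  -- which is almost everywhere. The endpoint is therefore replaced by the exact flip.
  let γ : EReal → (Shift τ ℝ × V) × (Shift τ ℝ × V) → (Shift τ ℝ × V) × (Shift τ ℝ × V) :=
    fun t => if t = ⊤ then Prod.swap else fibredSwap τ t
  have hγ : ∀ t, ∀ᵐ z ∂m, γ t z = fibredSwap τ t z := by
    intro t
    by_cases h : t = ⊤
    · subst h
      filter_upwards [hswap_ae] with z hz
      simp [γ, hz]
    · exact ae_of_all _ fun z => by simp [γ, h]
  have hγmp : ∀ t, MeasurePreserving (γ t) m m := by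
    intro t
    by_cases h : t = ⊤
    · simpa [γ, h] using hmswap
    · simpa [γ, h] using measurePreserving_fibredSwap τ β ν t
  have hγγ : ∀ t z, γ t (γ t z) = z := by
    intro t z
    by_cases h : t = ⊤
    · simp [γ, h]
    · simpa [γ, h] using fibredSwap_fibredSwap τ t z
  let C : Set (Set ((Shift τ ℝ × V) × (Shift τ ℝ × V))) :=
    {S | (∃ i, ∃ B : Set ℝ, MeasurableSet B ∧ S = {z | z.1.1 i ∈ B}) ∨
      (∃ i, ∃ B : Set ℝ, MeasurableSet B ∧ S = {z | z.2.1 i ∈ B}) ∨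
      (∃ B : Set V, MeasurableSet B ∧ S = {z | z.1.2 ∈ B}) ∨
      (∃ B : Set V, MeasurableSet B ∧ S = {z | z.2.2 ∈ B})}
  have hgen : (inferInstance : MeasurableSpace ((Shift τ ℝ × V) × (Shift τ ℝ × V))) =
      MeasurableSpace.generateFrom C := by
    apply le_antisymm
    · have hbase : ∀ S ∈ C, MeasurableSet[MeasurableSpace.generateFrom C] S := fun S hS =>
        MeasurableSpace.measurableSet_generateFrom hS
      have h1 : @Measurable _ _ (MeasurableSpace.generateFrom C) _
          (fun z : (Shift τ ℝ × V) × (Shift τ ℝ × V) => ((z.1.1, z.1.2), (z.2.1, z.2.2))) := by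
        refine Measurable.prodMk (m := MeasurableSpace.generateFrom C)
          (Measurable.prodMk (m := MeasurableSpace.generateFrom C) ?_ ?_)
          (Measurable.prodMk (m := MeasurableSpace.generateFrom C) ?_ ?_)
        · refine (@measurable_pi_iff _ _ _ (MeasurableSpace.generateFrom C) _ _).2 fun i B hB => ?_
          exact hbase _ (Or.inl ⟨i, B, hB, rfl⟩)
        · exact fun B hB => hbase _ (Or.inr (Or.inr (Or.inl ⟨B, hB, rfl⟩)))
        · refine (@measurable_pi_iff _ _ _ (MeasurableSpace.generateFrom C) _ _).2 fun i B hB => ?_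
          exact hbase _ (Or.inr (Or.inl ⟨i, B, hB, rfl⟩))
        · exact fun B hB => hbase _ (Or.inr (Or.inr (Or.inr ⟨B, hB, rfl⟩)))
      exact fun S hS => h1 hS
    · refine MeasurableSpace.generateFrom_le ?_
      rintro S (⟨i, B, hB, rfl⟩ | ⟨i, B, hB, rfl⟩ | ⟨B, hB, rfl⟩ | ⟨B, hB, rfl⟩)
      · exact ((Shift.measurable_apply τ i).comp measurable_fst.fst) hB
      · exact ((Shift.measurable_apply τ i).comp measurable_snd.fst) hB
      · exact measurable_fst.snd hB
      · exact measurable_snd.snd hB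
  have hev : ∀ (a s : EReal), a ≠ s → ∀ᶠ t in 𝓝 s, (a < t ↔ a < s) := by
    intro a s has
    rcases lt_or_gt_of_ne has with h | h
    · filter_upwards [lt_mem_nhds h] with t ht using iff_of_true ht h
    · filter_upwards [gt_mem_nhds h] with t ht using iff_of_false ht.not_gt h.not_gt
  have hevp : ∀ (i : I) (s : EReal), ∀ᵐ z ∂m, ∀ᶠ t in 𝓝 s,
      pairSwap t (z.1.1 i, z.2.1 i) = pairSwap s (z.1.1 i, z.2.1 i) := by
    intro i s
    filter_upwards [hne1 i s, hne2 i s] with z h1 h2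
    filter_upwards [hev _ _ h1, hev _ _ h2] with t ht1 ht2
    simp only [pairSwap, ht1, ht2]
  have hcont : @Continuous _ _ _ (weakTopology m) (fun t => fibredSwap (V := V) τ t) := by
    refine continuous_weakTopology_of_ae_eventually hgen m _
      (measurePreserving_fibredSwap τ β ν) fun s S hS => ?_
    rcases hS with ⟨i, B, hB, rfl⟩ | ⟨i, B, hB, rfl⟩ | ⟨B, hB, rfl⟩ | ⟨B, hB, rfl⟩
    · filter_upwards [hevp i s] with z hz
      filter_upwards [hz] with t ht
      simp only [fibredSwap, ht]
    · filter_upwards [hevp i s] with z hz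
      filter_upwards [hz] with t ht
      simp only [fibredSwap, ht]
    · exact ae_of_all _ fun z => Eventually.of_forall fun t => Iff.rfl
    · exact ae_of_all _ fun z => Eventually.of_forall fun t => Iff.rfl
  have hcontγ : @Continuous _ _ _ (weakTopology m) γ := by
    refine continuous_iInf_rng.2 fun S => continuous_iInf_rng.2 fun T =>
      continuous_induced_rng.2 ?_
    have h := continuous_induced_rng.1 (continuous_iInf_rng.1 (continuous_iInf_rng.1 hcont S) T)
    have heq : ((fun T' => m (symmDiff (T' ⁻¹' S.1) T.1)) ∘ γ) =
        (fun T' => m (symmDiff (T' ⁻¹' S.1) T.1)) ∘ fun t => fibredSwap τ t := by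
      funext t
      refine measure_congr (EventuallyEq.symmDiff ?_ (ae_eq_refl _))
      filter_upwards [hγ t] with z hz
      apply propext
      change γ t z ∈ S.1 ↔ fibredSwap τ t z ∈ S.1
      rw [hz]
    rw [heq]
    exact h
  let _ := weakTopology m
  have hpre : IsPreconnected (Set.range γ) := isPreconnected_range hcontγ
  have hbot : γ ⊥ = id := by
    funext z
    simp [γ, fibredSwap, pairSwap]
  have htop : γ ⊤ = Prod.swap := by simp [γ]
  have hsub : Set.range γ ⊆ equivariantAut H m := by
    rintro _ ⟨t, rfl⟩
    refine ⟨⟨hγmp t, γ t, hγmp t, ae_of_all _ (hγγ t), ae_of_all _ (hγγ t)⟩, fun g => ?_⟩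
    refine ae_of_all _ fun z => ?_
    by_cases h : t = ⊤
    · simp only [γ, h, if_true]; rfl
    · simp only [γ, h, if_false]; rfl
  have := hpre.subset_connectedComponentIn (x := id) ⟨⊥, hbot⟩ hsub
  exact this ⟨⊤, htop⟩

end RelativelyMalleable

/-! ### Coding measurable families of functions by points of a standard Borel space. -/

section Realization

open Filter Set
open scoped ENNReal

/-- The standard Borel spaces have countable generating π-systems containing the whole space. -/
theorem exists_seq_piSystem (W : Type*) [mW : MeasurableSpace W]
    [MeasurableSpace.CountablyGenerated W] :
    ∃ C : ℕ → Set W, mW = MeasurableSpace.generateFrom (Set.range C) ∧ IsPiSystem (Set.range C) ∧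
      Set.univ ∈ Set.range C := by
  let 𝒜 := generateSetAlgebra (MeasurableSpace.countableGeneratingSet W)
  have hc : 𝒜.Countable :=
    countable_generateSetAlgebra (MeasurableSpace.countable_countableGeneratingSet)
  have halg : IsSetAlgebra 𝒜 := isSetAlgebra_generateSetAlgebra
  obtain ⟨C, hC⟩ := hc.exists_eq_range ⟨_, halg.univ_mem⟩
  refine ⟨C, ?_, ?_, ?_⟩
  · rw [← hC, generateFrom_generateSetAlgebra_eq, MeasurableSpace.generateFrom_countableGeneratingSet]
  · rw [← hC]
    exact halg.isSetRing.isSetSemiring.isPiSystem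
  · rw [← hC]
    exact halg.univ_mem

/-- The Radon–Nikodym derivative of kernels gives a jointly measurable version of the densities. The
point is that `ψ` itself need not be jointly measurable for the σ-algebra on `M`, which below is a
coarser one than the given one. -/
theorem exists_measurable_density {M W : Type*} [MeasurableSpace M] [MeasurableSpace W]
    [MeasurableSpace.CountablyGenerated W] (ω : Measure W) [IsFiniteMeasure ω] (κ : Kernel M W)
    [IsFiniteKernel κ] (ψ : M → W → ℝ≥0∞) (hψ : ∀ m, Measurable (ψ m))
    (hκ : ∀ m, κ m = ω.withDensity (ψ m)) :
    ∃ ρ : M × W → ℝ≥0∞, Measurable ρ ∧ ∀ m, ∀ᵐ w ∂ω, ρ (m, w) = ψ m w := by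
  refine ⟨fun p => Kernel.rnDeriv κ (Kernel.const M ω) p.1 p.2,
    Kernel.measurable_rnDeriv κ (Kernel.const M ω), fun m => ?_⟩
  have h1 := Kernel.rnDeriv_eq_rnDeriv_measure (κ := κ) (η := Kernel.const M ω) (a := m)
  rw [Kernel.const_apply, hκ] at h1
  filter_upwards [h1, Measure.rnDeriv_withDensity ω (hψ m)] with w h2 h3
  rw [h2, h3]

/-- The code `v m` lists the values of the measure with density `ψ m` on a countable generating
π-system. This measure depends measurably on its code, so a jointly measurable density can be chosen
to factor through the code. -/
theorem exists_section_realization_ennreal {M W : Type*} [MeasurableSpace M] [MeasurableSpace W]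
    [MeasurableSpace.CountablyGenerated W] (ω : Measure W) [IsProbabilityMeasure ω]
    {ψ : M → W → ℝ≥0∞} (hψ : Measurable (Function.uncurry ψ)) (hψ4 : ∀ m w, ψ m w ≤ 4) :
    ∃ (v : M → ℕ → ℝ≥0∞) (ρ : (ℕ → ℝ≥0∞) × W → ℝ≥0∞), Measurable v ∧ Measurable ρ ∧
      (∀ m, ∀ᵐ w ∂ω, ρ (v m, w) = ψ m w) ∧ ∀ m m', ψ m =ᵐ[ω] ψ m' → v m = v m' := by
  have hψm : ∀ m, Measurable (ψ m) := fun m => hψ.comp (measurable_const.prodMk measurable_id)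
  let κ₀ : M → Measure W := fun m => ω.withDensity (ψ m)
  have hfin : ∀ m, κ₀ m Set.univ ≤ 4 := fun m => by
    rw [withDensity_apply _ MeasurableSet.univ, Measure.restrict_univ]
    calc ∫⁻ w, ψ m w ∂ω ≤ ∫⁻ _, 4 ∂ω := lintegral_mono fun w => hψ4 m w
      _ = 4 := by simp
  have hfin' : ∀ m, IsFiniteMeasure (κ₀ m) := fun m =>
    ⟨(hfin m).trans_lt (by simp)⟩
  have hκ₀ : Measurable κ₀ := by
    refine Measure.measurable_of_measurable_coe _ fun S hS => ?_
    have : ∀ m, κ₀ m S = ∫⁻ w in S, ψ m w ∂ω := fun m => withDensity_apply _ hS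
    simp_rw [this]
    exact hψ.lintegral_prod_right'
  obtain ⟨C, hgen, hpis, huniv⟩ := exists_seq_piSystem W
  have hCm : ∀ n, MeasurableSet (C n) := fun n => by
    rw [hgen]; exact MeasurableSpace.measurableSet_generateFrom ⟨n, rfl⟩
  let v : M → ℕ → ℝ≥0∞ := fun m n => κ₀ m (C n)
  have hv : Measurable v := measurable_pi_lambda _ fun n =>
    (Measure.measurable_coe (hCm n)).comp hκ₀
  have hvn : ∀ n, Measurable[MeasurableSpace.comap v inferInstance] fun m => κ₀ m (C n) := fun n =>
    (measurable_pi_apply n).comp (comap_measurable v)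
  have hκv : Measurable[MeasurableSpace.comap v inferInstance] κ₀ := by
    let _ : MeasurableSpace M := MeasurableSpace.comap v inferInstance
    refine Measurable.measure_of_isPiSystem hgen hpis ?_ ?_
    · rintro _ ⟨n, rfl⟩
      exact hvn n
    · obtain ⟨n, hn⟩ := huniv
      rw [← hn]
      exact hvn n
  obtain ⟨ρ, hρ, hρψ⟩ : ∃ ρ : M × W → ℝ≥0∞,
      Measurable[(MeasurableSpace.comap v inferInstance).prod inferInstance] ρ ∧
      ∀ m, ∀ᵐ w ∂ω, ρ (m, w) = ψ m w := by
    let _ : MeasurableSpace M := MeasurableSpace.comap v inferInstance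
    let κ : Kernel M W := ⟨κ₀, hκv⟩
    have : IsFiniteKernel κ := ⟨⟨4, by simp, hfin⟩⟩
    exact exists_measurable_density ω κ ψ hψm fun m => rfl
  have hcomap : (MeasurableSpace.comap v inferInstance).prod (inferInstance : MeasurableSpace W) =
      MeasurableSpace.comap (Prod.map v (id : W → W)) inferInstance := by
    change _ ⊔ _ = MeasurableSpace.comap _ (_ ⊔ _)
    rw [MeasurableSpace.comap_sup, MeasurableSpace.comap_comp, MeasurableSpace.comap_comp,
      MeasurableSpace.comap_comp]
    rfl
  rw [hcomap] at hρ
  obtain ⟨ρ', hρ', hρρ'⟩ := hρ.exists_eq_measurable_comp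
  refine ⟨v, ρ', hv, hρ', fun m => ?_, fun m m' h => ?_⟩
  · filter_upwards [hρψ m] with w hw
    rw [hρρ'] at hw
    exact hw
  · funext n
    have : κ₀ m = κ₀ m' := withDensity_congr_ae h
    simp only [v, this]

theorem exists_measurableEmbedding_ennreal (D : Type*) [MeasurableSpace D]
    [StandardBorelSpace D] :
    ∃ E : D → ℝ≥0∞, MeasurableEmbedding E ∧ ∀ d, E d ≤ 4 := by
  obtain ⟨e, he⟩ := exists_measurableEmbedding_real D
  -- This places `arctan + 2` between `0` and `4`; the bound keeps the measures with such densities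
  -- finite.
  have hpi : Real.pi / 2 < 2 := by have := Real.pi_lt_four; linarith
  have hEm : Measurable fun d => ENNReal.ofReal (Real.arctan (e d) + 2) := by
    have := he.measurable
    fun_prop
  refine ⟨fun d => ENNReal.ofReal (Real.arctan (e d) + 2), hEm.measurableEmbedding ?_, fun d => ?_⟩
  · intro a b hab
    have ha : 0 ≤ Real.arctan (e a) + 2 := by
      have := Real.neg_pi_div_two_lt_arctan (e a); linarith
    have hb : 0 ≤ Real.arctan (e b) + 2 := by
      have := Real.neg_pi_div_two_lt_arctan (e b); linarith
    have := (ENNReal.ofReal_eq_ofReal_iff ha hb).1 hab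
    exact he.injective (Real.arctan_injective (by linarith))
  · refine (ENNReal.ofReal_le_ofReal (q := 4) ?_).trans (by simp)
    have := Real.arctan_lt_pi_div_two (e d); linarith

/-- A measurable family of functions on `W`, parametrized by `M`, is parametrized by a standard
Borel space. -/
theorem exists_section_realization {M W D : Type*} [MeasurableSpace M] [MeasurableSpace W]
    [MeasurableSpace.CountablyGenerated W] [MeasurableSpace D] [StandardBorelSpace D] [Nonempty D]
    (ω : Measure W) [IsProbabilityMeasure ω] {φ : W × M → D} (hφ : Measurable φ) :
    ∃ (v : M → ℕ → ℝ≥0∞) (φ' : W × (ℕ → ℝ≥0∞) → D), Measurable v ∧ Measurable φ' ∧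
      (∀ m, ∀ᵐ w ∂ω, φ (w, m) = φ' (w, v m)) ∧
      ∀ m m', (∀ᵐ w ∂ω, φ (w, m) = φ (w, m')) → v m = v m' := by
  obtain ⟨E, hE, hE4⟩ := exists_measurableEmbedding_ennreal D
  obtain ⟨v, ρ, hv, hρ, h1, h2⟩ := exists_section_realization_ennreal (M := M) ω
    (ψ := fun m w => E (φ (w, m))) (hE.measurable.comp (hφ.comp measurable_swap))
    (fun m w => hE4 _)
  refine ⟨v, fun q => hE.invFun (ρ (q.2, q.1)), hv,
    hE.measurable_invFun.comp (hρ.comp measurable_swap), fun m => ?_, fun m m' h => h2 m m' ?_⟩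
  · filter_upwards [h1 m] with w hw
    rw [hw, hE.leftInverse_invFun]
  · filter_upwards [h] with w hw
    rw [hw]

end Realization

/-! ### Untwisting when the Bernoulli factor is an action of the quotient group. -/

section Cocycles

open Filter Set

/-- A cocycle that is trivial on a normal subgroup is invariant under the subgroup. -/
theorem IsCocycle.of_trivial_on_normal {G Z T : Type*} [Group G] [MulAction G Z]
    [MeasurableSpace Z] [MeasurableConstSMul G Z] [Group T] [MeasurableSpace T] {μ : Measure Z}
    [SMulInvariantMeasure G Z μ] {c : G → Z → T} (hc : IsCocycle G μ c) {D : Subgroup G}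
    [hD : D.Normal] (htriv : ∀ d ∈ D, ∀ᵐ z ∂μ, c d z = 1) (g : G) {d : G} (hd : d ∈ D) :
    (∀ᵐ z ∂μ, c g (d • z) = c g z) ∧ ∀ᵐ z ∂μ, c (g * d) z = c g z := by
  have h1 : ∀ᵐ z ∂μ, c (g * d) z = c g (d • z) := by
    filter_upwards [hc.map_mul g d, htriv d hd] with z h1 h2
    rw [h1, h2, mul_one]
  have h2 : ∀ᵐ z ∂μ, c (g * d) z = c g z := by
    -- The element `g * d = (g * d * g⁻¹) * g` is expanded in two ways, once with the element of `D`
    -- on the right and once on the left.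
    have hd' : g * d * g⁻¹ ∈ D := hD.conj_mem d hd g
    filter_upwards [hc.map_mul (g * d * g⁻¹) g,
      (measurePreserving_smul g μ).quasiMeasurePreserving.ae (htriv _ hd')] with z h1 h2
    rw [h2, one_mul, inv_mul_cancel_right] at h1
    exact h1
  refine ⟨?_, h2⟩
  filter_upwards [h1, h2] with z h1 h2
  rw [← h1, h2]

theorem ae_ae_of_ae_prod_swap {X Y : Type*} [MeasurableSpace X] [MeasurableSpace Y]
    {μ : Measure X} {ν : Measure Y} [SFinite μ] [SFinite ν] {p : X × Y → Prop}
    (h : ∀ᵐ z ∂μ.prod ν, p z) : ∀ᵐ y ∂ν, ∀ᵐ x ∂μ, p (x, y) :=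
  Measure.ae_ae_of_ae_prod (p := fun z => p z.swap)
    (Measure.measurePreserving_swap.quasiMeasurePreserving.ae h)

/-- Right translation, as an action on a copy of a countable group in the lowest universe. -/
noncomputable def rightPerm (H : Type*) [Group H] [Countable H] :
    H →* Equiv.Perm (Shrink.{0} H) where
  toFun h := (equivShrink.{0} H).permCongr (Equiv.mulRight h⁻¹)
  map_one' := by ext x; simp
  map_mul' a b := by ext x; simp [mul_assoc]

theorem rightPerm_inv_apply {H : Type*} [Group H] [Countable H] (h : H) (s : Shrink.{0} H) :
    (rightPerm H h)⁻¹ s = equivShrink.{0} H ((equivShrink.{0} H).symm s * h) := by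
  rw [← map_inv]
  simp [rightPerm]

instance {G I B : Type*} [Group G] (σ : G →* Equiv.Perm I) [Nonempty I] [MeasurableSpace B]
    [MeasurableSingletonClass B] (β : Measure B) [IsProbabilityMeasure β] [NullSingletonClass β] :
    NullSingletonClass (Shift.measure σ β) where
  measure_singleton x := by
    obtain ⟨i⟩ := ‹Nonempty I›
    have h : MeasurePreserving (fun y : Shift σ B => y i) (Shift.measure σ β) β :=
      measurePreserving_eval_infinitePi (fun _ : I => β) i
    refine measure_mono_null (t := (fun y : Shift σ B => y i) ⁻¹' {x i}) ?_ ?_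
    · rintro _ rfl
      rfl
    · rw [h.measure_preimage (measurableSet_singleton _).nullMeasurableSet]
      exact measure_singleton _

/-- Cocycles of the product of a Bernoulli action of `G ⧸ D` and an ergodic action of `G`, trivial
on `D`, are cohomologous to functions of the second variable. -/
theorem exists_untwisting_real {G : Type*} [Group G] [Countable G] (D : Subgroup G) [D.Normal]
    (hrigid : HasSuperrigidMalleableActions (G ⧸ D) Circle)
    {I : Type} [Countable I] [Nonempty I] (τ : G ⧸ D →* Equiv.Perm I)
    (hτ : ∀ i, (Set.range fun g => τ g i).Infinite)
    (σ : G →* Equiv.Perm I) (hσ : ∀ g : G, σ g = τ (g : G ⧸ D))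
    (β : Measure ℝ) [IsProbabilityMeasure β] [NullSingletonClass β]
    {M : Type*} [MeasurableSpace M] [MulAction G M] [MeasurableConstSMul G M] (m : Measure M)
    [IsProbabilityMeasure m] [ErgodicSMul G M m]
    {c : G → Shift σ ℝ × M → Circle}
    (hc : IsCocycle G ((Shift.measure σ β).prod m) c)
    (htriv : ∀ d ∈ D, ∀ᵐ z ∂(Shift.measure σ β).prod m, c d z = 1) :
    ∃ (f : Shift σ ℝ × M → Circle) (θ : G → M → Circle),
      Measurable f ∧ (∀ g, Measurable (θ g)) ∧
      ∀ g, ∀ᵐ z ∂(Shift.measure σ β).prod m,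
        θ g z.2 = f (g • z) * c g z * (f z)⁻¹ := by
  have hcount : Countable (G ⧸ D) := Quotient.countable
  let P := Shift.measure σ β
  let e := equivShrink.{0} (G ⧸ D)
  have hcs : Countable (Shrink.{0} (G ⧸ D)) := e.symm.injective.countable
  let lift : Shrink.{0} (G ⧸ D) → G := fun s => Quotient.out (e.symm s)
  have hlift : ∀ s, (lift s : G ⧸ D) = e.symm s := fun s => QuotientGroup.out_eq' _
  -- A cocycle trivial on `D` depends only on the coset of the group element, so countably many
  -- representatives record all of it.
  let Φ : Shift σ ℝ × M → (Shrink.{0} (G ⧸ D) → Circle) := fun z s => c (lift s) z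
  have hΦ : Measurable Φ := measurable_pi_lambda Φ fun s => hc.measurable (lift s)
  -- The code `v y` of the section of `Φ` over `y` will be `D`-invariant, because `Φ` is
  -- `D`-invariant and `D` acts trivially on the shift.
  obtain ⟨v, Φ', hv, hΦ', hΦΦ', hvΦ⟩ := exists_section_realization (M := M) P hΦ
  have hvd : ∀ d ∈ D, ∀ᵐ y ∂m, v (d • y) = v y := by
    intro d hd
    have h1 : ∀ᵐ z ∂P.prod m, ∀ s, c (lift s) (d • z) = c (lift s) z :=
      ae_all_iff.2 fun s => (hc.of_trivial_on_normal htriv (lift s) hd).1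
    filter_upwards [ae_ae_of_ae_prod_swap h1] with y hy
    refine hvΦ _ _ ?_
    filter_upwards [hy] with x hx
    funext s
    have hdx : d • (x, y) = (x, d • y) := by
      refine Prod.ext (funext fun i => ?_) rfl
      change x ((σ d)⁻¹ i) = x i
      rw [hσ d, (QuotientGroup.eq_one_iff d).2 hd, map_one, inv_one, Equiv.Perm.one_apply]
    rw [← hdx]
    exact hx s
  -- The factor of `M` generated by the translates of `v`: as `v` is `D`-invariant, they are indexed
  -- by `G ⧸ D`, which acts on `V` by right translation of indices.
  let V := Shift (rightPerm (G ⧸ D)) (ℕ → ENNReal)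
  let w : M → V := fun y s => v (lift s • y)
  have hw : Measurable w := Shift.measurable_of_apply _ fun s =>
    hv.comp (measurable_const_smul (lift s))
  have hweq : ∀ g : G, ∀ᵐ y ∂m, w (g • y) = (g : G ⧸ D) • w y := by
    intro g
    have h1 : ∀ᵐ y ∂m, ∀ s, v (lift s • g • y) = v (lift (e (e.symm s * g)) • y) := by
      refine ae_all_iff.2 fun s => ?_
      have hmem : lift (e (e.symm s * (g : G ⧸ D))) * (lift s * g)⁻¹ ∈ D := by
        rw [← QuotientGroup.eq_one_iff, QuotientGroup.mk_mul, QuotientGroup.mk_inv,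
          QuotientGroup.mk_mul, hlift, hlift, Equiv.symm_apply_apply, mul_inv_cancel]
      have := (measurePreserving_smul (lift s * g) m).quasiMeasurePreserving.ae (hvd _ hmem)
      filter_upwards [this] with y hy
      rw [smul_smul, ← hy, smul_smul, inv_mul_cancel_right]
    filter_upwards [h1] with y hy
    funext s
    rw [Shift.smul_apply, rightPerm_inv_apply]
    exact hy s
  let ν : Measure V := m.map w
  have hwmp : MeasurePreserving w m ν := ⟨hw, rfl⟩
  have hνp : IsProbabilityMeasure ν := Measure.isProbabilityMeasure_map hw.aemeasurable
  let P' : Measure (Shift τ ℝ) := Shift.measure τ β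
  let j : Shift σ ℝ × M → Shift τ ℝ × V := fun z => (z.1, w z.2)
  have hj : MeasurePreserving j (P.prod m) (P'.prod ν) := (MeasurePreserving.id P').prod hwmp
  have hjeq : ∀ g : G, ∀ᵐ z ∂P.prod m, j (g • z) = (g : G ⧸ D) • j z := by
    intro g
    filter_upwards [Measure.quasiMeasurePreserving_snd.ae (hweq g)] with z hz
    refine Prod.ext (funext fun i => ?_) hz
    change z.1 ((σ g)⁻¹ i) = z.1 ((τ (g : G ⧸ D))⁻¹ i)
    rw [hσ g]
  have herg : ErgodicSMul (G ⧸ D) V ν :=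
    ErgodicSMul.of_factor_hom hwmp (q := fun g : G => (g : G ⧸ D)) Quotient.mk_surjective hweq
  let c' : G ⧸ D → Shift τ ℝ × V → Circle := fun h z => Φ' (z.1, z.2 (e 1)) (e h)
  have hc'm : ∀ h, Measurable (c' h) := fun h => (measurable_pi_apply (e h)).comp
    (hΦ'.comp (measurable_fst.prodMk ((Shift.measurable_apply _ _).comp measurable_snd)))
  have hc'c : ∀ g : G, ∀ᵐ z ∂P.prod m, c' (g : G ⧸ D) (j z) = c g z := by
    intro g
    have hm1 : lift (e 1) ∈ D := by
      rw [← QuotientGroup.eq_one_iff, hlift, Equiv.symm_apply_apply]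
    have hm2 : (lift (e g))⁻¹ * g ∈ D := by
      rw [← QuotientGroup.eq_one_iff, QuotientGroup.mk_mul, QuotientGroup.mk_inv, hlift,
        Equiv.symm_apply_apply, inv_mul_cancel]
    have h1 : ∀ᵐ z ∂P.prod m, v (lift (e 1) • z.2) = v z.2 :=
      Measure.quasiMeasurePreserving_snd.ae (hvd _ hm1)
    have h2 : ∀ᵐ z ∂P.prod m, Φ z = Φ' (z.1, v z.2) := by
      have hms : MeasurableSet {z : Shift σ ℝ × M | Φ z = Φ' (z.1, v z.2)} :=
        measurableSet_eq_fun hΦ (hΦ'.comp (measurable_fst.prodMk (hv.comp measurable_snd)))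
      have h3 : ∀ᵐ z ∂m.prod P, Φ z.swap = Φ' (z.swap.1, v z.swap.2) :=
        (Measure.ae_prod_iff_ae_ae (measurable_swap hms)).2 (ae_of_all _ hΦΦ')
      exact Measure.measurePreserving_swap.quasiMeasurePreserving.ae h3
    filter_upwards [h1, h2, (hc.of_trivial_on_normal htriv (lift (e g)) hm2).2] with z h1 h2 h3
    rw [mul_inv_cancel_left] at h3
    rw [h3]
    change Φ' (z.1, v (lift (e 1) • z.2)) (e g) = Φ z (e g)
    rw [h1, h2]
  have hc' : IsCocycle (G ⧸ D) (P'.prod ν) c' := by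
    refine ⟨hc'm, fun a b => ?_⟩
    obtain ⟨a, rfl⟩ := QuotientGroup.mk_surjective a
    obtain ⟨b, rfl⟩ := QuotientGroup.mk_surjective b
    rw [← hj.map_eq]
    refine (ae_map_iff (p := fun x => c' (↑a * ↑b) x = c' ↑a ((b : G ⧸ D) • x) * c' ↑b x)
      hj.aemeasurable (measurableSet_eq_fun (hc'm _)
      (((hc'm _).comp (measurable_const_smul _)).mul (hc'm _)))).2 ?_
    filter_upwards [hc'c (a * b), hc'c b, (measurePreserving_smul b
      (P.prod m)).quasiMeasurePreserving.ae (hc'c a), hjeq b, hc.map_mul a b] with z h1 h2 h3 h4 h5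
    rw [← h4, ← QuotientGroup.mk_mul, h1, h2, h3, h5]
  obtain ⟨f, θ, hf, hθ, hfθ⟩ := hrigid (Shift τ ℝ × V) V (P'.prod ν) ν Prod.snd
    ⟨measurePreserving_snd, fun g => ae_of_all _ fun z => rfl⟩
    (isWeaklyMixingRel_shift_prod τ β ν hτ) (isMalleableRel_shift_prod τ β ν) c' hc'
  refine ⟨fun z => f (j z), fun g y => θ g (w y), hf.comp hj.measurable,
    fun g => (hθ.measurable _).comp hw, fun g => ?_⟩
  filter_upwards [hj.quasiMeasurePreserving.ae (hfθ g), hc'c g, hjeq g] with z h1 h2 h3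
  rw [h3, ← h2]
  exact h1

end Cocycles

/-! ### Labelling the points of finite orbits by their rank. -/

section Ranking

open Filter Set

variable {G I : Type*} [Group G] (D : Subgroup G) (σ : G →* Equiv.Perm I)

/-- The orbit of `i` under the subgroup `D`. -/
def orbitSet (i : I) : Set I := Set.range fun d : D => σ (d : G) i

theorem mem_orbitSet_self (i : I) : i ∈ orbitSet D σ i := ⟨1, by simp⟩

variable {D σ}

theorem orbitSet_eq_of_mem {i j : I} (h : j ∈ orbitSet D σ i) :
    orbitSet D σ j = orbitSet D σ i := by
  obtain ⟨d, rfl⟩ := h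
  ext k
  constructor
  · rintro ⟨d', rfl⟩
    exact ⟨d' * d, by simp⟩
  · rintro ⟨d', rfl⟩
    exact ⟨d' * d⁻¹, by simp⟩

theorem orbitSet_smul [hD : D.Normal] (g : G) (i : I) :
    orbitSet D σ (σ g i) = σ g '' orbitSet D σ i := by
  ext k
  constructor
  · rintro ⟨d, rfl⟩
    refine ⟨_, ⟨⟨g⁻¹ * d * g, by simpa using hD.conj_mem d d.2 g⁻¹⟩, rfl⟩, ?_⟩
    simp [← Equiv.Perm.mul_apply, ← map_mul, mul_assoc]
  · rintro ⟨_, ⟨d, rfl⟩, rfl⟩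
    refine ⟨⟨g * d * g⁻¹, hD.conj_mem d d.2 g⟩, ?_⟩
    simp [← Equiv.Perm.mul_apply, ← map_mul, mul_assoc]

variable (D σ)

/-- The number of points of the `D`-orbit of `i` that precede `i` in the order given by `e`, with
ties broken by the order of `I`. -/
noncomputable def orbitRank [LinearOrder I] (e : I → ℝ) (i : I) : ℕ :=
  {j | j ∈ orbitSet D σ i ∧ (e j < e i ∨ (e j = e i ∧ j < i))}.ncard

/-- Pairs of a `D`-orbit and a natural number below its cardinality. -/
def RankIndex : Type _ :=
  {q : Set I × ℕ // (∃ i, q.1 = orbitSet D σ i) ∧ q.2 < q.1.ncard}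

variable {D σ}

instance [Countable I] : Countable (RankIndex D σ) := by
  have : Countable (Set.range (orbitSet D σ)) := (countable_range _).to_subtype
  refine (show Function.Injective fun q : RankIndex D σ =>
    ((⟨q.1.1, q.2.1.elim fun i hi => ⟨i, hi.symm⟩⟩, q.1.2) :
      Set.range (orbitSet D σ) × ℕ) from ?_).countable
  rintro ⟨⟨S, j⟩, h⟩ ⟨⟨S', j'⟩, h'⟩ heq
  simp only [Prod.mk.injEq, Subtype.mk.injEq] at heq
  exact Subtype.ext (Prod.ext heq.1 heq.2)

theorem RankIndex.exists_eq (q : RankIndex D σ) :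
    ∃ (i : I) (j : ℕ) (hj : j < (orbitSet D σ i).ncard),
      q = ⟨(orbitSet D σ i, j), ⟨i, rfl⟩, hj⟩ := by
  obtain ⟨⟨S, j⟩, ⟨i, hi⟩, hj⟩ := q
  change S = _ at hi
  subst hi
  exact ⟨i, j, hj, rfl⟩

variable (D σ)

/-- The action on `RankIndex` moving orbits. -/
noncomputable def rankPerm [hD : D.Normal] : G →* Equiv.Perm (RankIndex D σ) :=
  MonoidHom.toHomPerm
    { toFun := fun g q => ⟨(σ g '' q.1.1, q.1.2), by
        obtain ⟨i, j, hj, rfl⟩ := q.exists_eq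
        exact ⟨⟨σ g i, (orbitSet_smul g i).symm⟩, by
          rwa [ncard_image_of_injective _ (σ g).injective]⟩⟩
      map_one' := by
        funext q
        refine Subtype.ext (Prod.ext ?_ rfl)
        change σ 1 '' q.1.1 = q.1.1
        simp
      map_mul' := fun a b => by
        funext q
        refine Subtype.ext (Prod.ext ?_ rfl)
        change σ (a * b) '' q.1.1 = σ a '' (σ b '' q.1.1)
        simp [image_image] }

/-- The action of the quotient group on `RankIndex`. -/
noncomputable def rankPermQuotient [D.Normal] : G ⧸ D →* Equiv.Perm (RankIndex D σ) :=
  QuotientGroup.lift D (rankPerm D σ) fun d hd => by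
    ext q
    refine Subtype.ext (Prod.ext ?_ rfl)
    obtain ⟨i, j, hj, rfl⟩ := q.exists_eq
    change σ d '' orbitSet D σ i = orbitSet D σ i
    rw [← orbitSet_smul]
    exact orbitSet_eq_of_mem ⟨⟨d, hd⟩, rfl⟩

theorem rankPermQuotient_mk [D.Normal] (g : G) :
    rankPerm D σ g = rankPermQuotient D σ (g : G ⧸ D) := rfl

variable {D σ}

/-- Finitely many finite `D`-orbits cannot cover an infinite orbit of `G`. -/
theorem infinite_range_rankPermQuotient [D.Normal] (hσ : ∀ i, (range fun g => σ g i).Infinite)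
    (hfin : ∀ i, (orbitSet D σ i).Finite) (q : RankIndex D σ) :
    (range fun h => rankPermQuotient D σ h q).Infinite := by
  obtain ⟨i, j, hj, rfl⟩ := q.exists_eq
  intro hf
  refine hσ i ?_
  have h1 : ((fun p : RankIndex D σ => p.1.1) '' (range fun h => rankPermQuotient D σ h
      ⟨(orbitSet D σ i, j), ⟨i, rfl⟩, hj⟩)).Finite := hf.image _
  refine (h1.biUnion (t := fun S => S) ?_).subset ?_
  · rintro _ ⟨p, -, rfl⟩
    obtain ⟨k, hk⟩ := p.2.1
    exact (congrArg Set.Finite hk).mpr (hfin k)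
  · rintro _ ⟨g, rfl⟩
    refine mem_biUnion (x := σ g '' orbitSet D σ i) ?_ ⟨i, mem_orbitSet_self _ _ _, rfl⟩
    exact ⟨_, ⟨(g : G ⧸ D), rfl⟩, rfl⟩

variable [LinearOrder I]

theorem orbitRank_lt_ncard (hfin : ∀ i, (orbitSet D σ i).Finite)
    (e : I → ℝ) (i : I) :
    orbitRank D σ e i < (orbitSet D σ i).ncard := by
  refine ncard_lt_ncard ⟨fun j hj => hj.1, fun h => ?_⟩ (hfin i)
  have := (h (mem_orbitSet_self D σ i)).2
  simp at this

theorem orbitRank_lt_of_prec (hfin : ∀ i, (orbitSet D σ i).Finite)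
    (e : I → ℝ) {i j : I} (hj : j ∈ orbitSet D σ i)
    (h : e j < e i ∨ (e j = e i ∧ j < i)) : orbitRank D σ e j < orbitRank D σ e i := by
  refine ncard_lt_ncard ⟨fun k hk => ?_, fun h' => ?_⟩ ((hfin i).subset fun j hj => hj.1)
  · refine ⟨orbitSet_eq_of_mem hj ▸ hk.1, ?_⟩
    rcases hk.2 with h1 | ⟨h1, h2⟩ <;> rcases h with h3 | ⟨h3, h4⟩
    · exact Or.inl (h1.trans h3)
    · exact Or.inl (h1.trans_eq h3)
    · exact Or.inl (h1.trans_lt h3)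
    · exact Or.inr ⟨h1.trans h3, h2.trans h4⟩
  · have := (h' ⟨hj, h⟩).2
    simp at this

theorem injOn_orbitRank (hfin : ∀ i, (orbitSet D σ i).Finite)
    (e : I → ℝ) (i : I) : InjOn (orbitRank D σ e) (orbitSet D σ i) := by
  have key : ∀ j ∈ orbitSet D σ i, ∀ k ∈ orbitSet D σ i, j < k →
      orbitRank D σ e j ≠ orbitRank D σ e k := by
    intro j hj k hk hlt
    rcases lt_trichotomy (e j) (e k) with h | h | h
    · exact (orbitRank_lt_of_prec hfin e (orbitSet_eq_of_mem hk ▸ hj) (Or.inl h)).ne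
    · exact (orbitRank_lt_of_prec hfin e (orbitSet_eq_of_mem hk ▸ hj) (Or.inr ⟨h, hlt⟩)).ne
    · exact (orbitRank_lt_of_prec hfin e (orbitSet_eq_of_mem hj ▸ hk) (Or.inl h)).ne'
  intro j hj k hk h
  rcases lt_trichotomy j k with hlt | hlt | hlt
  · exact absurd h (key j hj k hk hlt)
  · exact hlt
  · exact absurd h.symm (key k hk j hj hlt)

/-- The pair of the orbit of `i` and of its rank. -/
noncomputable def rankIndex (hfin : ∀ i, (orbitSet D σ i).Finite)
    (e : I → ℝ) (i : I) : RankIndex D σ :=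
  ⟨(orbitSet D σ i, orbitRank D σ e i), ⟨i, rfl⟩, orbitRank_lt_ncard hfin e i⟩

/-- Inside a finite orbit the ranks are distinct and below the cardinality, so they exhaust all
smaller numbers. -/
theorem rankIndex_bijective (hfin : ∀ i, (orbitSet D σ i).Finite)
    (e : I → ℝ) : Function.Bijective (rankIndex hfin e) := by
  constructor
  · intro i j h
    have h' := congrArg Subtype.val h
    have h1 : orbitSet D σ i = orbitSet D σ j := congrArg Prod.fst h'
    exact injOn_orbitRank hfin e j (h1 ▸ mem_orbitSet_self D σ i) (mem_orbitSet_self D σ j)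
      (congrArg Prod.snd h')
  · intro q
    obtain ⟨i, r, hr, rfl⟩ := q.exists_eq
    have himg : orbitRank D σ e '' orbitSet D σ i = Iio (orbitSet D σ i).ncard := by
      refine eq_of_subset_of_ncard_le ?_ ?_ (finite_Iio _)
      · rintro _ ⟨j, hj, rfl⟩
        exact (orbitRank_lt_ncard hfin e j).trans_eq (by rw [orbitSet_eq_of_mem hj])
      · rw [(injOn_orbitRank hfin e i).ncard_image, ncard_eq_toFinset_card']
        simp
    obtain ⟨j, hj, hjr⟩ := himg.symm.subset (show r ∈ Iio _ from hr)
    exact ⟨j, Subtype.ext (Prod.ext (orbitSet_eq_of_mem hj) hjr)⟩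

/-- The permutation carries the order given by `e` to the one given by `e'`. Injectivity of `e`
excludes ties, which are broken by the order of `I`, and the action need not respect that order. -/
theorem rankPerm_rankIndex [D.Normal] (hfin : ∀ i, (orbitSet D σ i).Finite)
    {e e' : I → ℝ} (he : Function.Injective e) (g : G)
    (hee' : ∀ i, e' (σ g i) = e i) (i : I) :
    rankPerm D σ g (rankIndex hfin e i) = rankIndex hfin e' (σ g i) := by
  refine Subtype.ext (Prod.ext (orbitSet_smul g i).symm ?_)
  change orbitRank D σ e i = orbitRank D σ e' (σ g i)
  unfold orbitRank
  rw [← ncard_image_of_injective _ (σ g).injective]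
  congr 1
  ext k
  obtain ⟨k, rfl⟩ := (σ g).surjective k
  simp only [mem_image, EmbeddingLike.apply_eq_iff_eq, exists_eq_right, mem_ofPred_eq, hee',
    orbitSet_smul, he.eq_iff]
  constructor
  · rintro ⟨h1, h2 | ⟨rfl, h2⟩⟩
    · exact ⟨h1, Or.inl h2⟩
    · exact absurd h2 (lt_irrefl _)
  · rintro ⟨h1, h2 | ⟨rfl, h2⟩⟩
    · exact ⟨h1, Or.inl h2⟩
    · exact absurd h2 (lt_irrefl _)

theorem measurable_orbitRank (hfin : ∀ i, (orbitSet D σ i).Finite)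
    {Z : Type*} [MeasurableSpace Z] {e : Z → I → ℝ}
    (he : ∀ i, Measurable fun z => e z i) (i : I) :
    Measurable fun z => orbitRank D σ (e z) i := by
  classical
  have h : (fun z => orbitRank D σ (e z) i) = fun z => ∑ j ∈ (hfin i).toFinset,
      if e z j < e z i ∨ (e z j = e z i ∧ j < i) then 1 else 0 := by
    funext z
    rw [← Finset.card_filter, ← ncard_coe_finset]
    unfold orbitRank
    congr 1
    ext j
    simp
  rw [h]
  refine Finset.measurable_sum _ fun j _ => Measurable.ite ?_ measurable_const measurable_const
  exact (measurableSet_lt (he j) (he i)).union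
    ((measurableSet_eq_fun (he j) (he i)).inter (MeasurableSet.const _))

theorem measurable_apply_rankIndex (hfin : ∀ i, (orbitSet D σ i).Finite)
    {Z B : Type*} [MeasurableSpace Z] [MeasurableSpace B]
    {e : Z → I → ℝ} (he : ∀ i, Measurable fun z => e z i)
    {w : Z → RankIndex D σ → B} (hw : ∀ q, Measurable fun z => w z q) (i : I) :
    Measurable fun z => w z (rankIndex hfin (e z) i) := by
  intro s hs
  have : (fun z => w z (rankIndex hfin (e z) i)) ⁻¹' s = ⋃ r : ℕ, ⋃ hr : r < (orbitSet D σ i).ncard,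
      {z | orbitRank D σ (e z) i = r} ∩ (fun z => w z ⟨(orbitSet D σ i, r), ⟨i, rfl⟩, hr⟩) ⁻¹' s := by
    ext z
    simp only [mem_preimage, mem_iUnion, mem_inter_iff, mem_ofPred_eq]
    constructor
    · intro h
      exact ⟨_, orbitRank_lt_ncard hfin _ _, rfl, h⟩
    · rintro ⟨r, hr, rfl, h⟩
      exact h
  rw [this]
  exact .iUnion fun r => .iUnion fun hr =>
    ((measurable_orbitRank hfin he i) (measurableSet_singleton r)).inter (hw _ hs)

end Ranking

theorem infinitePi_map_comp_of_bijective {I J B : Type*} [MeasurableSpace B] (β : Measure B)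
    [IsProbabilityMeasure β] {φ : I → J} (hφ : Function.Bijective φ) :
    (Measure.infinitePi fun _ : J => β).map (fun w i => w (φ i)) =
      Measure.infinitePi fun _ : I => β := by
  have h := Measure.infinitePi_map_piCongrLeft (μ := fun _ : I => β) (Equiv.ofBijective φ hφ).symm
  rw [← h]
  congr 1
  funext w i
  conv_rhs => rw [← (Equiv.ofBijective φ hφ).symm_apply_apply i]
  exact (Equiv.piCongrLeft_apply_apply (fun _ => B) (Equiv.ofBijective φ hφ).symm w _).symm

/-! ### Untwisting with an auxiliary copy of the shift. -/

section Untwisting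

open Filter Set

/-- Two coordinates are independent with a law that has no atoms, so they almost never agree, and
there are countably many pairs. This discharges the injectivity that `rankPerm_rankIndex` needs. -/
theorem infinitePi_ae_injective {I B : Type*} [Countable I] [MeasurableSpace B]
    [StandardBorelSpace B] (β : Measure B) [IsProbabilityMeasure β] [NullSingletonClass β] :
    ∀ᵐ x ∂Measure.infinitePi fun _ : I => β, Function.Injective x := by
  have h : ∀ i j : I, i ≠ j → ∀ᵐ x ∂Measure.infinitePi fun _ : I => β, x i ≠ x j := by
    intro i j hij
    have hind := (iIndepFun_infinitePi (P := fun _ : I => β) (X := fun _ b => b)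
      fun _ => measurable_id).indepFun hij
    have hmap : (Measure.infinitePi fun _ : I => β).map (fun x => (x i, x j)) = β.prod β := by
      rw [(indepFun_iff_map_prod_eq_prod_map_map
        (measurable_pi_apply i).aemeasurable (measurable_pi_apply j).aemeasurable).1 hind,
        Measure.infinitePi_map_eval, Measure.infinitePi_map_eval]
    have hdiag : ∀ᵐ q ∂β.prod β, q.1 ≠ q.2 := by
      refine (Measure.ae_prod_iff_ae_ae
        (measurableSet_eq_fun measurable_fst measurable_snd).compl).2 (ae_of_all _ fun b => ?_)
      have := measure_singleton (μ := β) b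
      rw [ae_iff]
      convert this using 2
      ext b'
      simp [eq_comm]
    rw [← hmap] at hdiag
    have hm : Measurable fun x : I → B => (x i, x j) := by fun_prop
    exact ae_of_ae_map hm.aemeasurable hdiag
  have h' : ∀ᵐ x ∂Measure.infinitePi fun _ : I => β, ∀ i j : I, i ≠ j → x i ≠ x j := by
    refine ae_all_iff.2 fun i => ae_all_iff.2 fun j => ?_
    by_cases hij : i = j
    · exact ae_of_all _ fun x hx => absurd hij hx
    · filter_upwards [h i j hij] with x hx _ using hx
  filter_upwards [h'] with x hx i j hij
  by_contra hne
  exact hx i j hne hij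

/-- Cocycles of the product of a generalized Bernoulli action with finite `D`-orbits and an ergodic
action, trivial on `D`, untwist after adding another copy of the Bernoulli action. -/
theorem exists_untwisting_doubled {G : Type*} [Group G] [Countable G] (D : Subgroup G) [D.Normal]
    (hrigid : HasSuperrigidMalleableActions (G ⧸ D) Circle)
    {I : Type} [LinearOrder I] [Countable I] [Nonempty I] (σ : G →* Equiv.Perm I)
    (hσ : ∀ i, (Set.range fun g => σ g i).Infinite) (hfin : ∀ i, (orbitSet D σ i).Finite)
    {K : Type*} [MeasurableSpace K] [StandardBorelSpace K] (κ : Measure K)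
    [IsProbabilityMeasure κ] [NullSingletonClass κ]
    {M : Type*} [MeasurableSpace M] [StandardBorelSpace M] [MulAction G M]
    [MeasurableConstSMul G M] (m : Measure M) [IsProbabilityMeasure m] [ErgodicSMul G M m]
    {c : G → Shift σ K × M → Circle} (hc : IsCocycle G ((Shift.measure σ κ).prod m) c)
    (htriv : ∀ d ∈ D, ∀ᵐ z ∂(Shift.measure σ κ).prod m, c d z = 1) :
    ∃ (f : Shift σ K × (Shift σ K × M) → Circle) (θ : G → Shift σ K × M → Circle),
      Measurable f ∧ (∀ g, Measurable (θ g)) ∧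
      ∀ g, ∀ᵐ z ∂(Shift.measure σ κ).prod ((Shift.measure σ κ).prod m),
        θ g z.2 = f (g • z) * c g (z.1, z.2.2) * (f z)⁻¹ := by
  have hK : ¬ Countable K := fun h => by
    have := (countable_univ (α := K)).measure_zero κ
    simp at this
  let ι : K ≃ᵐ ℝ := PolishSpace.measurableEquivOfNotCountable hK not_countable
  let β : Measure ℝ := κ.map ι
  have hβp : IsProbabilityMeasure β := Measure.isProbabilityMeasure_map ι.measurable.aemeasurable
  have hβn : NullSingletonClass β := ⟨fun t => by
    rw [ι.map_apply]
    convert measure_singleton (μ := κ) (ι.symm t) using 2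
    ext k
    simp [MeasurableEquiv.eq_symm_apply]⟩
  have hβκ : β.map ι.symm = κ := by
    rw [Measure.map_map ι.symm.measurable ι.measurable]
    simp
  let σ' := rankPerm D σ
  let W := Shift σ' ℝ
  let M' := Shift σ K × M
  let P : Measure W := Shift.measure σ' β
  let m' : Measure M' := (Shift.measure σ κ).prod m
  let e : Shift σ K → I → ℝ := fun x i => ι (x i)
  have he : ∀ i, Measurable fun x => e x i := fun i =>
    ι.measurable.comp (Shift.measurable_apply σ i)
  -- The auxiliary copy `y.1` ranks each `D`-orbit, and the other copy is read through the labels.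
  -- For fixed `y` this is a relabelling of independent variables, so the law is the right one, and
  -- `D` acts trivially on the labels.
  let u : M' → W → Shift σ K := fun y w i => ι.symm (w (rankIndex hfin (e y.1) i))
  have hu : Measurable (Function.uncurry u) := by
    refine Shift.measurable_of_apply _ fun i => ι.symm.measurable.comp ?_
    exact measurable_apply_rankIndex hfin (Z := M' × W) (e := fun z => e z.1.1)
      (w := fun z => z.2) (fun i => (he i).comp (measurable_fst.comp measurable_fst))
      (fun q => (Shift.measurable_apply σ' q).comp measurable_snd) i
  have hump : ∀ y, P.map (u y) = Shift.measure σ κ := by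
    intro y
    have h1 : P.map (fun w i => w (rankIndex hfin (e y.1) i)) = Measure.infinitePi fun _ : I => β :=
      infinitePi_map_comp_of_bijective β (rankIndex_bijective hfin (e y.1))
    have h2 : (Measure.infinitePi fun _ : I => β).map (fun w i => ι.symm (w i)) =
        Shift.measure σ κ := by
      refine (Measure.infinitePi_map_pi (fun _ : I => β) (f := fun _ t => ι.symm t)
        fun _ => ι.symm.measurable).trans ?_
      simp only [hβκ]
      rfl
    rw [← h2, ← h1, Measure.map_map]
    · rfl
    · exact measurable_pi_lambda _ fun i => ι.symm.measurable.comp (measurable_pi_apply i)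
    · exact measurable_pi_lambda _ fun i => Shift.measurable_apply σ' _
  let j : W × M' → Shift σ K × M' := fun z => (u z.2 z.1, z.2)
  have hj : MeasurePreserving j (P.prod m') ((Shift.measure σ κ).prod m') :=
    (Measure.measurePreserving_swap (μ := m') (ν := Shift.measure σ κ)).comp
      (((MeasurePreserving.id m').skew_product hu (ae_of_all _ hump)).comp
        Measure.measurePreserving_swap)
  have hjinj : Function.Injective j := by
    rintro ⟨w, y⟩ ⟨w', y'⟩ h
    obtain rfl : y = y' := congrArg Prod.snd h
    refine Prod.ext (funext fun q => ?_) rfl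
    obtain ⟨i, rfl⟩ := (rankIndex_bijective hfin (e y.1)).2 q
    exact ι.symm.injective (congrFun (congrArg Prod.fst h) i)
  have hjeq : ∀ g : G, ∀ᵐ z ∂P.prod m', j (g • z) = g • j z := by
    intro g
    have h1 : ∀ᵐ y ∂m', Function.Injective y.1 :=
      Measure.quasiMeasurePreserving_fst.ae (infinitePi_ae_injective κ)
    filter_upwards [Measure.quasiMeasurePreserving_snd.ae h1] with z hz
    refine Prod.ext (funext fun i => ?_) rfl
    have h2 : rankPerm D σ g (rankIndex hfin (e z.2.1) ((σ g)⁻¹ i)) =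
        rankIndex hfin (e (g • z.2.1)) i := by
      rw [rankPerm_rankIndex hfin (e' := e (g • z.2.1)) (e := e (z.2.1))
        (fun a b hab => hz (ι.injective hab)) g]
      · simp
      · intro i
        change ι (z.2.1 ((σ g)⁻¹ (σ g i))) = ι (z.2.1 i)
        simp
    change ι.symm (z.1 ((rankPerm D σ g)⁻¹ (rankIndex hfin (e (g • z.2.1)) i))) =
      ι.symm (z.1 (rankIndex hfin (e z.2.1) ((σ g)⁻¹ i)))
    rw [← h2]
    exact congrArg (fun q => ι.symm (z.1 q)) ((rankPerm D σ g).symm_apply_apply _)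
  have herg : ErgodicSMul G M' m' := ergodicSMul_shift_prod σ hσ κ m
  let π : Shift σ K × M' → Shift σ K × M := fun z => (z.1, z.2.2)
  have hπ : MeasurePreserving π ((Shift.measure σ κ).prod m') ((Shift.measure σ κ).prod m) :=
    (MeasurePreserving.id _).prod measurePreserving_snd
  let c' : G → W × M' → Circle := fun g z => c g (π (j z))
  have hc' : IsCocycle G (P.prod m') c' := by
    refine ⟨fun g => (hc.measurable g).comp (hπ.comp hj).measurable, fun a b => ?_⟩
    filter_upwards [(hπ.comp hj).quasiMeasurePreserving.ae (hc.map_mul a b), hjeq b] with z h1 h2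
    change c (a * b) (π (j z)) = c a (π (j (b • z))) * c b (π (j z))
    rw [h2]
    exact h1
  have hne : Nonempty (RankIndex D σ) := ⟨rankIndex hfin (fun _ => 0) (Classical.arbitrary I)⟩
  obtain ⟨f', θ, hf', hθ, hfθ⟩ := exists_untwisting_real D hrigid (rankPermQuotient D σ)
    (infinite_range_rankPermQuotient hσ hfin) σ' (rankPermQuotient_mk D σ) β m' hc'
    (fun d hd => (hπ.comp hj).quasiMeasurePreserving.ae (htriv d hd))
  -- Injectivity of `j` allows the untwisting function to be carried to the target of `j`.
  obtain ⟨f, hf, hff'⟩ := (hj.measurable.measurableEmbedding hjinj).exists_measurable_extend hf'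
    fun _ => ⟨1⟩
  refine ⟨f, θ, hf, hθ, fun g => ?_⟩
  rw [← hj.map_eq]
  refine (ae_map_iff (p := fun z => θ g z.2 = f (g • z) * c g (π z) * (f z)⁻¹) hj.aemeasurable
    (measurableSet_eq_fun ((hθ g).comp measurable_snd) (((hf.comp (measurable_const_smul g)).mul
      ((hc.measurable g).comp hπ.measurable)).mul hf.inv))).2 ?_
  filter_upwards [hfθ g, hjeq g] with z h1 h2
  rw [← h2]
  change θ g z.2 = (f ∘ j) (g • z) * c' g z * ((f ∘ j) z)⁻¹
  rw [hff']
  exact h1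

end Untwisting

/-! ### Removing the auxiliary copy. -/

section Separation

open Filter Set

theorem measurePreserving_swap_left {α β γ : Type*} [MeasurableSpace α] [MeasurableSpace β]
    [MeasurableSpace γ] (μ : Measure α) (ν : Measure β) (m : Measure γ) [SFinite μ] [SFinite ν]
    [SFinite m] :
    MeasurePreserving (fun z : α × (β × γ) => (z.2.1, (z.1, z.2.2))) (μ.prod (ν.prod m))
      (ν.prod (μ.prod m)) :=
  (measurePreserving_prodAssoc ν μ m).comp
    (((Measure.measurePreserving_swap (μ := μ) (ν := ν)).prod (MeasurePreserving.id m)).comp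
      ((measurePreserving_prodAssoc μ ν m).symm _))

/-- Cocycles of the product of a generalized Bernoulli action with finite `D`-orbits and an ergodic
action, trivial on `D`, are cohomologous to functions of the second variable. -/
theorem exists_untwisting {G : Type*} [Group G] [Countable G] (D : Subgroup G) [D.Normal]
    (hrigid : HasSuperrigidMalleableActions (G ⧸ D) Circle)
    {I : Type} [LinearOrder I] [Countable I] [Nonempty I] (σ : G →* Equiv.Perm I)
    (hσ : ∀ i, (Set.range fun g => σ g i).Infinite) (hfin : ∀ i, (orbitSet D σ i).Finite)
    {K : Type*} [MeasurableSpace K] [StandardBorelSpace K] (κ : Measure K)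
    [IsProbabilityMeasure κ] [NullSingletonClass κ]
    {M : Type*} [MeasurableSpace M] [StandardBorelSpace M] [MulAction G M]
    [MeasurableConstSMul G M] (m : Measure M) [IsProbabilityMeasure m] [ErgodicSMul G M m]
    {c : G → Shift σ K × M → Circle} (hc : IsCocycle G ((Shift.measure σ κ).prod m) c)
    (htriv : ∀ d ∈ D, ∀ᵐ z ∂(Shift.measure σ κ).prod m, c d z = 1) :
    ∃ (f : Shift σ K × M → Circle) (θ : G → M → Circle),
      Measurable f ∧ (∀ g, Measurable (θ g)) ∧
      ∀ g, ∀ᵐ z ∂(Shift.measure σ κ).prod m, θ g z.2 = f (g • z) * c g z * (f z)⁻¹ := by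
  obtain ⟨F, Θ, hF, hΘ, hFΘ⟩ := exists_untwisting_doubled D hrigid σ hσ hfin κ m hc htriv
  let X := Shift σ K
  let P : Measure X := Shift.measure σ κ
  -- The cross-ratio of `F` in its two shift variables. Under the group `F` acquires a factor
  -- depending on its second shift variable and `M` and one depending on its first and `M`; both
  -- cancel, so `r` is invariant and hence constant.
  let r : X × (X × (X × (X × M))) → Circle := fun z =>
    F z.2.2 * (F (z.1, z.2.2.2))⁻¹ * (F (z.2.2.1, (z.2.1, z.2.2.2.2)))⁻¹ *
      F (z.1, (z.2.1, z.2.2.2.2))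
  have p1 : MeasurePreserving (fun z : X × (X × (X × (X × M))) => z.2.2)
      (P.prod (P.prod (P.prod (P.prod m)))) (P.prod (P.prod m)) :=
    measurePreserving_snd.comp measurePreserving_snd
  have p2 : MeasurePreserving (fun z : X × (X × (X × (X × M))) => (z.1, z.2.2.2))
      (P.prod (P.prod (P.prod (P.prod m)))) (P.prod (P.prod m)) :=
    (MeasurePreserving.id P).prod (measurePreserving_snd.comp measurePreserving_snd)
  have p4 : MeasurePreserving (fun z : X × (X × (X × (X × M))) => (z.1, (z.2.1, z.2.2.2.2)))
      (P.prod (P.prod (P.prod (P.prod m)))) (P.prod (P.prod m)) :=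
    (MeasurePreserving.id P).prod
      ((MeasurePreserving.id P).prod (measurePreserving_snd.comp measurePreserving_snd))
  have p3 : MeasurePreserving (fun z : X × (X × (X × (X × M))) => (z.2.2.1, (z.2.1, z.2.2.2.2)))
      (P.prod (P.prod (P.prod (P.prod m)))) (P.prod (P.prod m)) :=
    (measurePreserving_swap_left P P m).comp (((MeasurePreserving.id P).prod
      ((MeasurePreserving.id P).prod measurePreserving_snd)).comp measurePreserving_snd)
  have hr : Measurable r := ((((hF.comp p1.measurable).mul (hF.comp p2.measurable).inv).mul
    (hF.comp p3.measurable).inv).mul (hF.comp p4.measurable))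
  have hinv : ∀ g : G, ∀ᵐ z ∂P.prod (P.prod (P.prod (P.prod m))), r (g • z) = r z := by
    intro g
    have hFg : ∀ᵐ z ∂P.prod (P.prod m), F (g • z) = Θ g z.2 * F z * (c g (z.1, z.2.2))⁻¹ := by
      filter_upwards [hFΘ g] with z hz
      rw [hz, inv_mul_cancel_right, mul_inv_cancel_right]
    filter_upwards [p1.quasiMeasurePreserving.ae hFg, p2.quasiMeasurePreserving.ae hFg,
      p3.quasiMeasurePreserving.ae hFg, p4.quasiMeasurePreserving.ae hFg] with z h1 h2 h3 h4
    change F (g • z.2.2) * (F (g • (z.1, z.2.2.2)))⁻¹ * (F (g • (z.2.2.1, (z.2.1, z.2.2.2.2))))⁻¹ *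
      F (g • (z.1, (z.2.1, z.2.2.2.2))) = _
    rw [h1, h2, h3, h4]
    simp only [r, mul_inv, inv_inv]
    apply Circle.ext
    push_cast
    field_simp
  have e1 : ErgodicSMul G (X × M) (P.prod m) := ergodicSMul_shift_prod σ hσ κ m
  have e2 : ErgodicSMul G (X × (X × M)) (P.prod (P.prod m)) := ergodicSMul_shift_prod σ hσ κ _
  have e3 : ErgodicSMul G (X × (X × (X × M))) (P.prod (P.prod (P.prod m))) :=
    ergodicSMul_shift_prod σ hσ κ _
  have e4 : ErgodicSMul G (X × (X × (X × (X × M)))) (P.prod (P.prod (P.prod (P.prod m)))) :=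
    ergodicSMul_shift_prod σ hσ κ _
  obtain ⟨l, hl⟩ := exists_ae_eq_const_of_invariant G _ hr hinv
  obtain ⟨x', hx'⟩ := (Measure.ae_ae_of_ae_prod hl).exists
  obtain ⟨x'', hx''⟩ := (Measure.ae_ae_of_ae_prod hx').exists
  -- With the first two of the four points frozen, the cross-ratio equation writes `F` as a product
  -- of functions of separate shift variables.
  let f : X × M → Circle := fun z => l * F (z.1, (x'', z.2)) * (F (x', (x'', z.2)))⁻¹
  let h : X × M → Circle := fun z => F (x', z)
  have hf : Measurable f := by fun_prop
  have hh : Measurable h := by fun_prop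
  have hFf : ∀ᵐ z ∂P.prod (P.prod m), F z = f (z.1, z.2.2) * h z.2 := by
    filter_upwards [hx''] with z hz
    have hz' : F z * (F (x', z.2))⁻¹ * (F (z.1, (x'', z.2.2)))⁻¹ * F (x', (x'', z.2.2)) = l := hz
    change F z = l * F (z.1, (x'', z.2.2)) * (F (x', (x'', z.2.2)))⁻¹ * F (x', z.2)
    rw [← hz']
    apply Circle.ext
    push_cast
    field_simp
  have hfh : ∀ g : G, ∀ᵐ z ∂P.prod (P.prod m), Θ g z.2 * (h (g • z.2))⁻¹ * h z.2 =
      f (g • (z.1, z.2.2)) * c g (z.1, z.2.2) * (f (z.1, z.2.2))⁻¹ := by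
    intro g
    filter_upwards [hFΘ g, hFf,
      (measurePreserving_smul g (P.prod (P.prod m))).quasiMeasurePreserving.ae hFf] with z h1 h2 h3
    change F (g • z) = f (g • (z.1, z.2.2)) * h (g • z.2) at h3
    rw [h1, h3, h2]
    apply Circle.ext
    push_cast
    field_simp
  -- The right side of `hfh` does not involve the auxiliary copy, so on the left this copy may be
  -- frozen at a generic point, which may depend on `g`.
  have hex : ∀ g : G, ∃ e : X, ∀ᵐ z ∂P.prod m, Θ g (e, z.2) * (h (g • (e, z.2)))⁻¹ * h (e, z.2) =
      f (g • z) * c g z * (f z)⁻¹ := fun g =>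
    (Measure.ae_ae_of_ae_prod
      ((measurePreserving_swap_left P P m).quasiMeasurePreserving.ae (hfh g))).exists
  choose e he using hex
  refine ⟨f, fun g y => Θ g (e g, y) * (h (g • (e g, y)))⁻¹ * h (e g, y), hf, fun g => ?_, he⟩
  have hey : Measurable fun y : M => (e g, y) := measurable_prodMk_left
  exact (((hΘ g).comp hey).mul (hh.comp ((measurable_const_smul g).comp hey)).inv).mul (hh.comp hey)

end Separation

/-! ### Measurable characters of the dual group. -/

section Characters

open Filter Set

variable {A : Type*} [CommGroup A] [TopologicalSpace A]

theorem continuous_circle_coe : Continuous fun z : Circle => (z : ℂ) := by fun_prop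

theorem continuous_eval_dual (a : A) : Continuous fun k : PontryaginDual A => k a :=
  continuous_eval_const (F := A →ₜ* Circle) a

theorem measurable_eval_dual (a : A) : Measurable fun k : PontryaginDual A => k a :=
  (continuous_eval_dual a).measurable

variable [DiscreteTopology A]

/-- Evaluation at `a`, as a continuous function on the dual group. -/
noncomputable def evalC (a : A) : C(PontryaginDual A, ℂ) where
  toFun k := (k a : ℂ)
  continuous_toFun := continuous_circle_coe.comp (continuous_eval_dual a)

/-- Stone–Weierstrass: evaluations separate points, and they are closed under products and
conjugation, so their span is already a star subalgebra. -/
theorem span_evalC_dense :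
    (Submodule.span ℂ (range (evalC (A := A)))).topologicalClosure = ⊤ := by
  let S : StarSubalgebra ℂ C(PontryaginDual A, ℂ) :=
    { toSubalgebra := Algebra.adjoin ℂ (range (evalC (A := A)))
      star_mem' := by
        change Algebra.adjoin ℂ (range (evalC (A := A))) ≤ star (Algebra.adjoin ℂ (range (evalC (A := A))))
        refine Algebra.adjoin_le ?_
        rintro - ⟨a, rfl⟩
        have h : evalC a⁻¹ = star (evalC a) := by
          ext k
          change ((k a⁻¹ : Circle) : ℂ) = star ((k a : Circle) : ℂ)
          rw [map_inv, Circle.coe_inv_eq_conj]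
          rfl
        change star (evalC a) ∈ Algebra.adjoin ℂ (range (evalC (A := A)))
        rw [← h]
        exact Algebra.subset_adjoin ⟨a⁻¹, rfl⟩ }
  have hS : S.topologicalClosure = ⊤ := by
    refine ContinuousMap.starSubalgebra_topologicalClosure_eq_top_of_separatesPoints S ?_
    intro k l hkl
    obtain ⟨a, ha⟩ : ∃ a, k a ≠ l a := by
      by_contra! h
      exact hkl (ContinuousMonoidHom.ext h)
    exact ⟨_, ⟨evalC a, Algebra.subset_adjoin (R := ℂ) (Set.mem_range_self a), rfl⟩, fun h => ha (Circle.ext h)⟩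
  have hspan : Subalgebra.toSubmodule S.toSubalgebra =
      Submodule.span ℂ (range (evalC (A := A))) := by
    refine Algebra.adjoin_eq_span_of_subset ℂ ?_
    refine Set.Subset.trans ?_ Submodule.subset_span
    intro x hx
    refine Submonoid.closure_induction (fun _ => id) ⟨1, ?_⟩ ?_ hx
    · ext k
      change ((k 1 : Circle) : ℂ) = 1
      simp
    · rintro - - - - ⟨a, rfl⟩ ⟨b, rfl⟩
      refine ⟨a * b, ?_⟩
      ext k
      change ((k (a * b) : Circle) : ℂ) = (k a : Circle) * (k b : Circle)
      simp
  rw [← hspan]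
  exact congr_arg (Subalgebra.toSubmodule <| StarSubalgebra.toSubalgebra ·) hS

variable (κ : Measure (PontryaginDual A)) [IsProbabilityMeasure κ]

/-- If all these integrals vanished, `χ` would be orthogonal to every continuous function, by
`span_evalC_dense`. But `χ` has modulus one and is approximated in `L¹` by continuous functions. -/
theorem exists_integral_ne_zero [κ.WeaklyRegular] {χ : PontryaginDual A → Circle}
    (hχ : Measurable χ) : ∃ a : A, ∫ k, (((χ k)⁻¹ * k a : Circle) : ℂ) ∂κ ≠ 0 := by
  by_contra! hzero
  have hχ' : Measurable fun k => ((χ k : Circle) : ℂ) := continuous_circle_coe.measurable.comp hχ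
  have hχi : Measurable fun k => (((χ k)⁻¹ : Circle) : ℂ) :=
    continuous_circle_coe.measurable.comp hχ.inv
  have hint : ∀ φ : C(PontryaginDual A, ℂ),
      Integrable (fun k => (((χ k)⁻¹ : Circle) : ℂ) * φ k) κ := by
    intro φ
    refine Integrable.of_bound (hχi.mul φ.continuous.measurable).aestronglyMeasurable ‖φ‖
      (ae_of_all _ fun k => ?_)
    rw [norm_mul, Circle.norm_coe, one_mul]
    exact φ.norm_coe_le_norm k
  let L : C(PontryaginDual A, ℂ) →L[ℂ] ℂ := LinearMap.mkContinuous
    { toFun := fun φ => ∫ k, (((χ k)⁻¹ : Circle) : ℂ) * φ k ∂κ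
      map_add' := fun φ ψ => by
        rw [← integral_add (hint φ) (hint ψ)]
        simp [mul_add]
      map_smul' := fun z φ => by
        rw [RingHom.id_apply, smul_eq_mul, ← integral_const_mul]
        congr 1
        funext k
        simp
        ring } 1 (fun φ => by
      rw [one_mul]
      refine (norm_integral_le_of_norm_le_const (C := ‖φ‖) (ae_of_all _ fun k => ?_)).trans ?_
      · rw [norm_mul, Circle.norm_coe, one_mul]
        exact φ.norm_coe_le_norm k
      · simp)
  have hL : ∀ φ, L φ = 0 := by
    have h1 : (Submodule.span ℂ (range (evalC (A := A)))).topologicalClosure ≤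
        LinearMap.ker (L : C(PontryaginDual A, ℂ) →ₗ[ℂ] ℂ) := by
      refine Submodule.topologicalClosure_minimal _ (Submodule.span_le.2 ?_) L.isClosed_ker
      rintro _ ⟨a, rfl⟩
      change ∫ k, (((χ k)⁻¹ : Circle) : ℂ) * (k a : Circle) ∂κ = 0
      rw [← hzero a]
      congr 1
    intro φ
    rw [span_evalC_dense] at h1
    exact h1 (Submodule.mem_top (x := φ))
  have hχint : Integrable (fun k => ((χ k : Circle) : ℂ)) κ :=
    Integrable.of_bound hχ'.aestronglyMeasurable 1 (ae_of_all _ fun k => (Circle.norm_coe _).le)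
  obtain ⟨g, hg, hgi⟩ := hχint.exists_boundedContinuous_integral_sub_le (ε := 1 / 2) (by norm_num)
  have h1 : ∫ k, (((χ k)⁻¹ : Circle) : ℂ) * (χ k - g k) ∂κ = 1 := by
    have h2 : ∀ k, (((χ k)⁻¹ : Circle) : ℂ) * (χ k - g k) =
        1 - (((χ k)⁻¹ : Circle) : ℂ) * g.toContinuousMap k := by
      intro k
      rw [mul_sub, ← Circle.coe_mul, inv_mul_cancel, Circle.coe_one]
      rfl
    simp_rw [h2]
    rw [integral_sub (integrable_const _) (hint _)]
    have := hL g.toContinuousMap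
    change ∫ k, (((χ k)⁻¹ : Circle) : ℂ) * g.toContinuousMap k ∂κ = 0 at this
    rw [this]
    simp
  have h3 : ‖∫ k, (((χ k)⁻¹ : Circle) : ℂ) * (χ k - g k) ∂κ‖ ≤ 1 / 2 := by
    refine (norm_integral_le_integral_norm _).trans (le_trans (le_of_eq ?_) hg)
    congr 1
    funext k
    rw [norm_mul, Circle.norm_coe, one_mul]
  rw [h1] at h3
  norm_num at h3

/-- A measurable character of the dual group is the evaluation at a point. -/
theorem exists_eq_eval_of_measurable [κ.WeaklyRegular] [κ.IsMulLeftInvariant]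
    {χ : PontryaginDual A → Circle}
    (hχ : Measurable χ) (hmul : ∀ k l, χ (k * l) = χ k * χ l) : ∃ a : A, ∀ k, χ k = k a := by
  obtain ⟨a, ha⟩ := exists_integral_ne_zero κ hχ
  refine ⟨a, fun l => ?_⟩
  -- Translation by `l` multiplies the nonzero integral by `(χ l)⁻¹ * l a` and, by invariance of
  -- `κ`, does not change it.
  have h1 : ∫ k, (((χ k)⁻¹ * k a : Circle) : ℂ) ∂κ =
      (((χ l)⁻¹ * l a : Circle) : ℂ) * ∫ k, (((χ k)⁻¹ * k a : Circle) : ℂ) ∂κ := by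
    rw [← integral_const_mul]
    conv_lhs => rw [← integral_mul_left_eq_self _ l]
    congr 1
    funext k
    rw [hmul, ← Circle.coe_mul]
    congr 1
    change (χ l * χ k)⁻¹ * (l a * k a) = _
    rw [mul_inv]
    exact mul_mul_mul_comm _ _ _ _
  have h2 : (((χ l)⁻¹ * l a : Circle) : ℂ) = 1 := by
    have := mul_right_cancel₀ ha ((one_mul _).trans h1)
    exact this.symm
  have h3 : (χ l)⁻¹ * l a = 1 := Circle.ext (h2.trans Circle.coe_one.symm)
  exact (inv_mul_eq_one.1 h3)

end Characters

/-! ### Haar measure on the dual of a torsion-free group. -/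

section DualGroup

open Filter Set

/-- The normalized Haar measure of a compact group. -/
noncomputable abbrev probHaar (K : Type*) [CommGroup K] [TopologicalSpace K]
    [IsTopologicalGroup K] [CompactSpace K] [MeasurableSpace K] [BorelSpace K] : Measure K :=
  Measure.haarMeasure (⊤ : TopologicalSpace.PositiveCompacts K)

instance (K : Type*) [CommGroup K] [TopologicalSpace K]
    [IsTopologicalGroup K] [CompactSpace K] [MeasurableSpace K] [BorelSpace K] :
    IsProbabilityMeasure (probHaar K) :=
  ⟨by rw [← TopologicalSpace.PositiveCompacts.coe_top]; exact Measure.haarMeasure_self⟩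

/-- The inclusion of the rational circle group into the circle group. -/
theorem exists_addCircle_rat_hom :
    ∃ j : AddCircle (1 : ℚ) →+ AddCircle (1 : ℝ), Function.Injective j := by
  let φ : ℚ →+ AddCircle (1 : ℝ) :=
    (QuotientAddGroup.mk' (AddSubgroup.zmultiples (1 : ℝ))).comp (Rat.castHom ℝ).toAddMonoidHom
  have hker : φ.ker = AddSubgroup.zmultiples (1 : ℚ) := by
    ext q
    rw [AddMonoidHom.mem_ker]
    change ((q : ℝ) : AddCircle (1 : ℝ)) = 0 ↔ _
    rw [AddCircle.coe_eq_zero_iff, AddSubgroup.mem_zmultiples_iff]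
    refine exists_congr fun n => ?_
    simp only [zsmul_eq_mul, mul_one]
    exact_mod_cast Iff.rfl
  refine ⟨QuotientAddGroup.lift _ φ hker.ge, ?_⟩
  rw [← AddMonoidHom.ker_eq_bot_iff, eq_bot_iff]
  intro x hx
  obtain ⟨q, rfl⟩ := QuotientAddGroup.mk_surjective x
  have : q ∈ φ.ker := hx
  rw [hker] at this
  exact (QuotientAddGroup.eq_zero_iff q).2 this

variable {A : Type*} [CommGroup A] [TopologicalSpace A] [DiscreteTopology A]

/-- Characters separate the points of a discrete abelian group. -/
theorem exists_dual_apply_ne_one {a : A} (ha : a ≠ 1) : ∃ k : PontryaginDual A, k a ≠ 1 := by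
  obtain ⟨j, hj⟩ := exists_addCircle_rat_hom
  obtain ⟨c, hc⟩ := CharacterModule.exists_character_apply_ne_zero_of_ne_zero
    (A := Additive A) (a := Additive.ofMul a) ha
  let χ : A →* Circle :=
    { toFun := fun b => AddCircle.toCircle (j (c (Additive.ofMul b)))
      map_one' := by simp
      map_mul' := fun b b' => by simp [AddCircle.toCircle_add] }
  refine ⟨(⟨χ, continuous_of_discreteTopology⟩ : A →ₜ* Circle), ?_⟩
  change AddCircle.toCircle (j (c (Additive.ofMul a))) ≠ 1
  rw [← AddCircle.toCircle_zero (T := 1), (AddCircle.injective_toCircle one_ne_zero).ne_iff]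
  rw [← map_zero j, hj.ne_iff]
  exact hc

instance : PolishSpace Circle := by
  have : CompleteSpace Circle := complete_of_compact
  infer_instance

variable [Countable A]

instance : PolishSpace (PontryaginDual A) := by
  have h : Topology.IsClosedEmbedding fun (k : PontryaginDual A) (a : A) => k a :=
    Continuous.isClosedEmbedding (continuous_pi fun a => continuous_eval_dual a)
      fun k l hkl => PontryaginDual.ext (congrFun hkl)
  exact h.polishSpace

instance : SecondCountableTopology (PontryaginDual A) := PolishSpace.toSecondCountableTopology

instance : StandardBorelSpace (PontryaginDual A) := inferInstance

omit [Countable A] in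
/-- In the dual of a torsion-free group, the characters trivial at a given nontrivial element form
a null set. -/
theorem ae_dual_apply_ne_one [IsMulTorsionFree A] {a : A} (ha : a ≠ 1) :
    ∀ᵐ k ∂probHaar (PontryaginDual A), k a ≠ 1 := by
  let N : Set (PontryaginDual A) := {k | k a = 1}
  have hN : MeasurableSet N := measurable_eval_dual a (measurableSet_singleton 1)
  -- A finite image would be a finite group, and every character would then kill the power of `a` by
  -- its order, although that power is not `1`.
  have hinf : (range fun k : PontryaginDual A => k a).Infinite := by
    intro hfin
    let R : Subgroup Circle := MonoidHom.range
      (⟨⟨fun k : PontryaginDual A => k a, rfl⟩, fun _ _ => rfl⟩ : PontryaginDual A →* Circle)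
    have hR : Finite R := hfin
    have hpow : a ^ Nat.card R ≠ 1 := by
      intro h
      exact ha (IsMulTorsionFree.pow_left_injective Nat.card_pos.ne' (h.trans (one_pow _).symm))
    obtain ⟨k, hk⟩ := exists_dual_apply_ne_one hpow
    refine hk ?_
    rw [map_pow]
    have := pow_card_eq_one' (x := (⟨k a, k, rfl⟩ : R))
    exact congrArg Subtype.val this
  have hinf' : Infinite (range fun k : PontryaginDual A => k a) := hinf.to_subtype
  choose k hk using fun r : range fun k : PontryaginDual A => k a => r.2
  rw [ae_iff]
  simp only [not_not]
  change probHaar (PontryaginDual A) N = 0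
  by_contra hne
  -- Distinct values at `a` give disjoint translates of `N`. There are infinitely many of them, all
  -- of the same measure, so this measure is zero.
  obtain ⟨r, s, hrs, l, hl1, hl2⟩ := exists_nonempty_inter_of_measure_univ_lt_tsum_measure
    (probHaar (PontryaginDual A)) (s := fun r => (fun l => (k r)⁻¹ * l) ⁻¹' N)
    (fun r => (measurable_const_mul _ hN).nullMeasurableSet) (by
      simp only [measure_preimage_mul]
      rw [ENNReal.tsum_const_eq_top_of_ne_zero hne]
      simp)
  refine hrs (Subtype.ext ?_)
  have h1 : (k r a)⁻¹ * l a = 1 := hl1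
  have h2 : (k s a)⁻¹ * l a = 1 := hl2
  rw [inv_mul_eq_one] at h1 h2
  rw [← hk r, ← hk s]
  exact h1.trans h2.symm

instance [IsMulTorsionFree A] [Nontrivial A] : NullSingletonClass (probHaar (PontryaginDual A)) where
  measure_singleton k := by
    obtain ⟨a, ha⟩ := exists_ne (1 : A)
    have h1 : probHaar (PontryaginDual A) {1} = 0 := by
      refine measure_mono_null ?_ (ae_iff.1 (ae_dual_apply_ne_one ha))
      rintro _ rfl
      simp
    rw [← h1, ← measure_preimage_mul (probHaar (PontryaginDual A)) k⁻¹ {1}]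
    congr 1
    ext l
    simp [eq_comm]

end DualGroup

/-! ### Splitting the coordinates according to the size of their `D`-orbits. -/

section Restriction

open Filter Set

/-- Gluing two families of coordinates. -/
noncomputable def glue {I K : Type*} (F : Set I) (z : ((Fᶜ : Set I) → K) × (F → K)) : I → K :=
  open Classical in fun i => if h : i ∈ F then z.2 ⟨i, h⟩ else z.1 ⟨i, h⟩

theorem glue_apply_of_mem {I K : Type*} {F : Set I} (z : ((Fᶜ : Set I) → K) × (F → K)) {i : I}
    (h : i ∈ F) : glue F z i = z.2 ⟨i, h⟩ := dif_pos h

theorem glue_apply_of_notMem {I K : Type*} {F : Set I} (z : ((Fᶜ : Set I) → K) × (F → K)) {i : I}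
    (h : i ∉ F) : glue F z i = z.1 ⟨i, h⟩ := dif_neg h

theorem measurePreserving_glue {I K : Type*} [MeasurableSpace K] (F : Set I) (κ : Measure K)
    [IsProbabilityMeasure κ] :
    MeasurePreserving (glue F)
      ((Measure.infinitePi fun _ : (Fᶜ : Set I) => κ).prod (Measure.infinitePi fun _ : F => κ))
      (Measure.infinitePi fun _ : I => κ) := by
  classical
  have hm : Measurable (glue F (K := K)) := by
    refine measurable_pi_lambda _ fun i => ?_
    by_cases h : i ∈ F
    · simp only [glue_apply_of_mem _ h]
      exact (measurable_pi_apply _).comp measurable_snd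
    · simp only [glue_apply_of_notMem _ h]
      exact (measurable_pi_apply _).comp measurable_fst
  refine ⟨hm, Measure.eq_infinitePi _ fun s t ht => ?_⟩
  rw [Measure.map_apply hm (.pi s.countable_toSet fun _ _ => ht _)]
  have h1 : glue F ⁻¹' (Set.pi s t) =
      (Set.pi (s.subtype (· ∈ Fᶜ) : Set (Fᶜ : Set I)) fun i => t i) ×ˢ
        (Set.pi (s.subtype (· ∈ F) : Set F) fun i => t i) := by
    ext z
    simp only [mem_preimage, Set.mem_pi, mem_prod, Finset.mem_coe, Finset.mem_subtype]
    constructor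
    · intro h
      refine ⟨fun i hi => ?_, fun i hi => ?_⟩
      · have := h i hi
        rwa [glue_apply_of_notMem _ i.2] at this
      · have := h i hi
        rwa [glue_apply_of_mem _ i.2] at this
    · rintro ⟨h2, h3⟩ i hi
      by_cases h : i ∈ F
      · rw [glue_apply_of_mem _ h]
        exact h3 ⟨i, h⟩ hi
      · rw [glue_apply_of_notMem _ h]
        exact h2 ⟨i, h⟩ hi
  rw [h1, Measure.prod_prod,
    Measure.infinitePi_pi _ (t := fun i : (Fᶜ : Set I) => t i) fun i _ => ht i,
    Measure.infinitePi_pi _ (t := fun i : F => t i) fun i _ => ht i]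
  rw [Finset.prod_subtype_eq_prod_filter (f := fun i => κ (t i)),
    Finset.prod_subtype_eq_prod_filter (f := fun i => κ (t i)), mul_comm]
  exact Finset.prod_filter_mul_prod_filter_not s (· ∈ F) _

variable {L : Type*} [Group L] (D : Subgroup L) (σ : L →* Equiv.Perm ℕ)

/-- The set of points with finite `D`-orbit. -/
def finiteOrbits : Set ℕ := {n | (orbitSet D σ n).Finite}

variable {D σ}

theorem smul_mem_finiteOrbits [D.Normal] (g : L) (n : ℕ) :
    σ g n ∈ finiteOrbits D σ ↔ n ∈ finiteOrbits D σ := by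
  change (orbitSet D σ (σ g n)).Finite ↔ (orbitSet D σ n).Finite
  rw [orbitSet_smul]
  exact finite_image_iff (σ g).injective.injOn

/-- The restriction of an action to an invariant set. -/
def restrictPerm {L I : Type*} [Group L] (σ : L →* Equiv.Perm I) (F : Set I)
    (hF : ∀ g i, σ g i ∈ F ↔ i ∈ F) : L →* Equiv.Perm F where
  toFun g := (σ g).subtypePerm fun i => hF g i
  map_one' := by ext; simp
  map_mul' a b := by ext; simp; rfl

variable (D σ)

/-- The action on the points with finite `D`-orbit. -/
abbrev finPerm [D.Normal] : L →* Equiv.Perm (finiteOrbits D σ) :=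
  restrictPerm σ _ smul_mem_finiteOrbits

theorem orbitSet_finPerm [D.Normal] (i : finiteOrbits D σ) :
    (orbitSet D (finPerm D σ) i).Finite := by
  refine Set.Finite.of_finite_image (f := Subtype.val) (Set.Finite.subset i.2 ?_)
    Subtype.val_injective.injOn
  rintro _ ⟨_, ⟨d, rfl⟩, rfl⟩
  exact ⟨d, rfl⟩

theorem infinite_range_finPerm [D.Normal] (hσ : ∀ n, (range fun g => σ g n).Infinite)
    (i : finiteOrbits D σ) : (range fun g => finPerm D σ g i).Infinite := by
  intro h
  refine hσ i ((h.image Subtype.val).subset ?_)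
  rintro _ ⟨g, rfl⟩
  exact ⟨_, ⟨g, rfl⟩, rfl⟩

/-- The action of `D` on the points with infinite `D`-orbit. -/
abbrev infPerm [D.Normal] : D →* Equiv.Perm ((finiteOrbits D σ)ᶜ : Set ℕ) :=
  restrictPerm (σ.comp D.subtype) _ fun d i =>
    not_congr (smul_mem_finiteOrbits (D := D) (σ := σ) (d : L) i)

theorem infinite_range_infPerm [D.Normal] (i : ((finiteOrbits D σ)ᶜ : Set ℕ)) :
    (range fun d => infPerm D σ d i).Infinite := by
  intro h
  refine i.2 ((h.image Subtype.val).subset ?_)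
  rintro _ ⟨d, rfl⟩
  exact ⟨_, ⟨d, rfl⟩, rfl⟩

variable {K : Type*}

/-- Forgetting the coordinates with infinite `D`-orbit. -/
def restrictFin [D.Normal] (x : Shift σ K) : Shift (finPerm D σ) K := fun i => x i

theorem measurePreserving_restrictFin [D.Normal] [MeasurableSpace K] (κ : Measure K)
    [IsProbabilityMeasure κ] :
    MeasurePreserving (restrictFin D σ) (Shift.measure σ κ) (Shift.measure (finPerm D σ) κ) :=
  ⟨Shift.measurable_of_apply _ fun i => Shift.measurable_apply σ i,
    Measure.infinitePi_map_restrict' (fun _ : ℕ => κ) (I := finiteOrbits D σ)⟩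

/-- A function invariant under `D` depends only on the coordinates with finite `D`-orbit. -/
theorem exists_eq_restrictFin_of_invariant [Countable L] [D.Normal] [MeasurableSpace K]
    (κ : Measure K) [IsProbabilityMeasure κ]
    {M T J : Type*} [MeasurableSpace M] [MulAction L M] [MeasurableConstSMul L M] (m : Measure M)
    [IsProbabilityMeasure m] [SMulInvariantMeasure L M m] [Countable J]
    [MeasurableSpace T] [StandardBorelSpace T] {φ : J → Shift σ K × M → T}
    (hφ : ∀ j, Measurable (φ j))
    (hinv : ∀ j, ∀ d ∈ D, ∀ᵐ z ∂(Shift.measure σ κ).prod m, φ j (d • z) = φ j z) :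
    ∃ φ' : J → Shift (finPerm D σ) K × M → T, (∀ j, Measurable (φ' j)) ∧
      ∀ j, ∀ᵐ z ∂(Shift.measure σ κ).prod m, φ j z = φ' j (restrictFin D σ z.1, z.2) := by
  -- As a `D`-space the shift is a product: the coordinates with infinite `D`-orbit form a shift to
  -- which `ae_eq_section_of_invariant` applies, and all the rest counts as the second variable.
  let τ : D →* Equiv.Perm (finiteOrbits D σ) := (finPerm D σ).comp D.subtype
  let X := Shift (infPerm D σ) K
  let V := Shift τ K
  let P : Measure X := Shift.measure (infPerm D σ) κ
  let R : Measure V := Shift.measure τ κ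
  let gl : X × V → Shift σ K := glue (finiteOrbits D σ)
  have hgl : MeasurePreserving gl (P.prod R) (Shift.measure σ κ) := measurePreserving_glue _ κ
  let J' : X × (V × M) → Shift σ K × M := fun z => (gl (z.1, z.2.1), z.2.2)
  have hJ : MeasurePreserving J' (P.prod (R.prod m)) ((Shift.measure σ κ).prod m) :=
    (hgl.prod (MeasurePreserving.id m)).comp ((measurePreserving_prodAssoc P R m).symm _)
  have hJeq : ∀ (d : D) z, J' (d • z) = (d : L) • J' z := by
    intro d z
    refine Prod.ext (funext fun i => ?_) rfl
    by_cases h : i ∈ finiteOrbits D σ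
    · have h' : (σ d)⁻¹ i ∈ finiteOrbits D σ := by
        rw [← map_inv]
        exact (smul_mem_finiteOrbits _ _).2 h
      refine (glue_apply_of_mem _ h).trans (Eq.trans ?_ (glue_apply_of_mem _ h').symm)
      rfl
    · have h' : (σ d)⁻¹ i ∉ finiteOrbits D σ := by
        rw [← map_inv]
        exact fun h1 => h ((smul_mem_finiteOrbits _ _).1 h1)
      refine (glue_apply_of_notMem _ h).trans (Eq.trans ?_ (glue_apply_of_notMem _ h').symm)
      rfl
  have hJres : ∀ x v y, (restrictFin D σ (J' (x, (v, y))).1, (J' (x, (v, y))).2) =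
      ((v, y) : Shift (finPerm D σ) K × M) := by
    intro x v y
    refine Prod.ext (funext fun i => ?_) rfl
    exact glue_apply_of_mem _ i.2
  have hsec : ∀ j, ∀ᵐ x ∂P, ∀ᵐ z ∂P.prod (R.prod m), φ j (J' z) = φ j (J' (x, z.2)) := by
    intro j
    refine ae_eq_section_of_invariant (infPerm D σ) (infinite_range_infPerm D σ) κ (R.prod m)
      (φ := fun z => φ j (J' z)) ((hφ j).comp hJ.measurable) fun d => ?_
    filter_upwards [hJ.quasiMeasurePreserving.ae (hinv j d d.2)] with z hz
    rw [hJeq d z]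
    exact hz
  obtain ⟨x, hx⟩ := (ae_all_iff.2 hsec).exists
  have hφ' : ∀ j, Measurable fun z : Shift (finPerm D σ) K × M => φ j (J' (x, z)) := fun j =>
    (hφ j).comp (hJ.measurable.comp measurable_prodMk_left)
  refine ⟨fun j z => φ j (J' (x, z)), hφ', fun j => ?_⟩
  rw [← hJ.map_eq]
  refine (ae_map_iff (p := fun z => φ j z = φ j (J' (x, (restrictFin D σ z.1, z.2))))
    hJ.aemeasurable (measurableSet_eq_fun (hφ j) ((hφ' j).comp
      (((measurePreserving_restrictFin D σ κ).measurable.comp measurable_fst).prodMk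
        measurable_snd)))).2 ?_
  filter_upwards [hx j] with z hz
  exact hz.trans (congrArg (fun q => φ j (J' (x, q))) (hJres z.1 z.2.1 z.2.2).symm)

end Restriction

/-! ### Rotations and the quotient by them. -/

section Rotation

open Filter Set

variable {L I : Type*} [Group L] {σ : L →* Equiv.Perm I} {K : Type*} [CommGroup K]

/-- The rotation action of `K` on the space of a generalized Bernoulli shift. -/
def rotate (k : K) (x : Shift σ K) : Shift σ K := fun i => k * x i

theorem rotate_mul (k l : K) (x : Shift σ K) : rotate (k * l) x = rotate k (rotate l x) :=
  funext fun i => mul_assoc k l (x i)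

variable [MeasurableSpace K]

theorem measurable_rotate [MeasurableMul₂ K] :
    Measurable fun q : K × Shift σ K => rotate q.1 q.2 :=
  Shift.measurable_of_apply _ fun i =>
    measurable_fst.mul ((Shift.measurable_apply σ i).comp measurable_snd)

theorem measurePreserving_rotate [MeasurableMul K] (κ : Measure K) [IsProbabilityMeasure κ]
    [κ.IsMulLeftInvariant] (k : K) :
    MeasurePreserving (rotate k) (Shift.measure σ κ) (Shift.measure σ κ) := by
  refine ⟨Shift.measurable_of_apply _ fun i => (Shift.measurable_apply σ i).const_mul k, ?_⟩
  refine (Measure.infinitePi_map_pi (fun _ : I => κ) (f := fun _ t => k * t)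
    fun _ => measurable_const_mul k).trans ?_
  simp only [map_mul_left_eq_self]
  rfl

end Rotation

section Quotient

open Filter Set

variable {Γ : Type*} [Group Γ] (σ₀ : Γ →* Equiv.Perm ℕ) (K : Type*) [CommGroup K]

theorem BernoulliQuotient.mk_surjective : Function.Surjective (BernoulliQuotient.mk σ₀ K) :=
  Quotient.mk_surjective

theorem BernoulliQuotient.mk_eq_mk_iff (x y : ℕ → K) :
    BernoulliQuotient.mk σ₀ K x = BernoulliQuotient.mk σ₀ K y ↔ ∃ k : K, (fun i => k * y i) = x := by
  refine Quotient.eq.trans ?_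
  exact Iff.rfl

theorem BernoulliQuotient.mk_rotate (k : K) (x : Shift σ₀ K) :
    BernoulliQuotient.mk σ₀ K (rotate k x) = BernoulliQuotient.mk σ₀ K x :=
  (BernoulliQuotient.mk_eq_mk_iff σ₀ K _ _).2 ⟨k, rfl⟩

variable {K} [MeasurableSpace K]

theorem BernoulliQuotient.measurable_mk :
    Measurable fun x : Shift σ₀ K => BernoulliQuotient.mk σ₀ K x := fun _ h => h

theorem BernoulliQuotient.measurable_of_mk {Z : Type*} [MeasurableSpace Z]
    {f : BernoulliQuotient σ₀ K → Z}
    (hf : Measurable fun x : Shift σ₀ K => f (BernoulliQuotient.mk σ₀ K x)) : Measurable f :=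
  fun _ h => hf h

instance : MeasurableConstSMul Γ (BernoulliQuotient σ₀ K) where
  measurable_const_smul g := BernoulliQuotient.measurable_of_mk σ₀
    ((BernoulliQuotient.measurable_mk σ₀).comp (measurable_const_smul g))

variable [TopologicalSpace K] [IsTopologicalGroup K] [CompactSpace K] [BorelSpace K]

theorem BernoulliQuotient.measurePreserving_mk :
    MeasurePreserving (fun x : Shift σ₀ K => BernoulliQuotient.mk σ₀ K x)
      (Shift.measure σ₀ (probHaar K)) (BernoulliQuotient.measure σ₀ K) :=
  ⟨BernoulliQuotient.measurable_mk σ₀, rfl⟩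

instance : IsProbabilityMeasure (BernoulliQuotient.measure σ₀ K) :=
  Measure.isProbabilityMeasure_map (BernoulliQuotient.measurable_mk σ₀).aemeasurable

instance : SMulInvariantMeasure Γ (BernoulliQuotient σ₀ K) (BernoulliQuotient.measure σ₀ K) where
  measure_preimage_smul g s hs := by
    have h := BernoulliQuotient.measurePreserving_mk σ₀ (K := K)
    rw [← h.measure_preimage hs.nullMeasurableSet,
      ← h.measure_preimage (measurable_const_smul g hs).nullMeasurableSet]
    exact measure_preimage_smul_of_nullMeasurableSet (μ := Shift.measure σ₀ (probHaar K))
      (h.measurable hs).nullMeasurableSet g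

variable {Y : Type*} [MeasurableSpace Y] (ν : Measure Y) [IsProbabilityMeasure ν]

/-- The quotient map on the first factor. -/
def mkProd (z : Shift σ₀ K × Y) : BernoulliQuotient σ₀ K × Y := (BernoulliQuotient.mk σ₀ K z.1, z.2)

theorem measurePreserving_mkProd :
    MeasurePreserving (mkProd σ₀) ((Shift.measure σ₀ (probHaar K)).prod ν)
      ((BernoulliQuotient.measure σ₀ K).prod ν) :=
  (BernoulliQuotient.measurePreserving_mk σ₀).prod (MeasurePreserving.id ν)

end Quotient

section Subgroups

theorem ErgodicSMul.of_subgroup {L Y : Type*} [Group L] [MulAction L Y] [MeasurableSpace Y]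
    {ν : Measure Y} [SMulInvariantMeasure L Y ν] (D : Subgroup L) [h : ErgodicSMul D Y ν] :
    ErgodicSMul L Y ν where
  aeconst_of_forall_preimage_smul_ae_eq hs hinv :=
    h.aeconst_of_forall_preimage_smul_ae_eq hs fun d => hinv d

end Subgroups

/-! ### The twist of a cocycle. -/

section Twist

open Filter Set

variable {L : Type*} [Group L] (D : Subgroup L) [D.Normal] (σ : L →* Equiv.Perm ℕ)
  {A : Type*} [CommGroup A] [TopologicalSpace A] [DiscreteTopology A]
  {Y : Type*} [MeasurableSpace Y] [MulAction L Y] (ν : Measure Y)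

/-- The cocycle `c` is cohomologous to a function of the second variable by a function on
`K ^ F × Y` on which `K` acts through the character `a`, where `K` is the dual of `A` and `F` is
the set of points with finite `D`-orbit. -/
def IsTwist (c : L → BernoulliQuotient σ (PontryaginDual A) × Y → Circle) (a : A) : Prop :=
  ∃ (f : Shift (finPerm D σ) (PontryaginDual A) × Y → Circle) (θ : L → Y → Circle),
    Measurable f ∧ (∀ g, Measurable (θ g)) ∧
    (∀ g, ∀ᵐ z ∂(Shift.measure σ (probHaar (PontryaginDual A))).prod ν,
      θ g z.2 = f (g • (restrictFin D σ z.1, z.2)) * c g (mkProd σ z) *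
        (f (restrictFin D σ z.1, z.2))⁻¹) ∧
    ∀ k, ∀ᵐ z ∂(Shift.measure (finPerm D σ) (probHaar (PontryaginDual A))).prod ν,
      f (rotate k z.1, z.2) = k a * f z

theorem measurable_coe_circle_iff {Z : Type*} [MeasurableSpace Z] {f : Z → Circle} :
    (Measurable fun z => (f z : ℂ)) ↔ Measurable f :=
  (continuous_circle_coe.isClosedEmbedding Circle.coe_injective).measurableEmbedding.measurable_comp_iff

theorem measurable_integral_coe_circle {Z W : Type*} [MeasurableSpace Z] [MeasurableSpace W]
    (m : Measure W) [SFinite m] {F : Z × W → Circle} (hF : Measurable F) :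
    Measurable fun k => ∫ z, (F (k, z) : ℂ) ∂m :=
  (StronglyMeasurable.integral_prod_right (f := fun k z => (F (k, z) : ℂ))
    (measurable_coe_circle_iff.2 hF).stronglyMeasurable).measurable

omit [MulAction L Y] in
/-- A function on `K ^ I × Y` on which `K` acts by scalars is multiplied by a character. -/
theorem exists_character_of_rotate [Countable A] {I : Type*} [Countable I] (τ : L →* Equiv.Perm I)
    [IsProbabilityMeasure ν] {f : Shift τ (PontryaginDual A) × Y → Circle} (hf : Measurable f)
    (h : ∀ k, ∃ t : Circle, ∀ᵐ z ∂(Shift.measure τ (probHaar (PontryaginDual A))).prod ν,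
      f (rotate k z.1, z.2) = t * f z) :
    ∃ a : A, ∀ k, ∀ᵐ z ∂(Shift.measure τ (probHaar (PontryaginDual A))).prod ν,
      f (rotate k z.1, z.2) = k a * f z := by
  choose χ hχ using h
  let P := (Shift.measure τ (probHaar (PontryaginDual A))).prod ν
  have hrot : ∀ k, MeasurePreserving
      (fun z : Shift τ (PontryaginDual A) × Y => (rotate k z.1, z.2)) P P := fun k =>
    (measurePreserving_rotate _ k).prod (MeasurePreserving.id ν)
  have hχm : Measurable χ := by
    rw [← measurable_coe_circle_iff]
    -- The scalars were only chosen; writing them as integrals with a parameter shows that they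
    -- depend measurably on `k`.
    have h1 : ∀ k, (χ k : ℂ) = ∫ z, ((f (rotate k z.1, z.2) * (f z)⁻¹ : Circle) : ℂ) ∂P := by
      intro k
      have : ∀ᵐ z ∂P, ((f (rotate k z.1, z.2) * (f z)⁻¹ : Circle) : ℂ) = χ k := by
        filter_upwards [hχ k] with z hz
        rw [hz, mul_inv_cancel_right]
      rw [integral_congr_ae this]
      simp
    simp_rw [h1]
    exact measurable_integral_coe_circle P ((hf.comp ((measurable_rotate.comp
      (measurable_fst.prodMk measurable_snd.fst)).prodMk measurable_snd.snd)).mul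
        (hf.comp measurable_snd).inv)
  have hmul : ∀ k l, χ (k * l) = χ k * χ l := by
    intro k l
    obtain ⟨z, h1, h2, h3⟩ := ((hχ (k * l)).and ((hχ l).and
      ((hrot l).quasiMeasurePreserving.ae (hχ k)))).exists
    rw [rotate_mul, h3, h2, ← mul_assoc] at h1
    exact (mul_right_cancel h1).symm
  obtain ⟨a, ha⟩ := exists_eq_eval_of_measurable (probHaar (PontryaginDual A)) hχm hmul
  refine ⟨a, fun k => ?_⟩
  rw [← ha k]
  exact hχ k

variable {D σ ν}

/-- After restriction to the coordinates with finite `D`-orbit, `exists_untwisting` provides `f`.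
The cocycle is unchanged by rotations, so `f` and its rotation by `k` untwist it to the same `θ`;
their quotient is invariant, hence constant by ergodicity, and the constants form a character. -/
theorem exists_isTwist [Countable L] [Countable A] [IsMulTorsionFree A] [StandardBorelSpace Y]
    (hrigid : HasSuperrigidMalleableActions (L ⧸ D) Circle) (hσ : IsSuitable D σ)
    [MeasurableConstSMul L Y] [IsProbabilityMeasure ν] [ErgodicSMul L Y ν]
    {c : L → BernoulliQuotient σ (PontryaginDual A) × Y → Circle}
    (hc : IsCocycle L ((BernoulliQuotient.measure σ (PontryaginDual A)).prod ν) c)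
    (htriv : ∀ d ∈ D, ∀ᵐ z ∂(BernoulliQuotient.measure σ (PontryaginDual A)).prod ν, c d z = 1) :
    ∃ a : A, IsTwist D σ ν c a := by
  let K := PontryaginDual A
  -- For trivial `A` the dual is a single point, so its Haar measure has an atom and the untwisting
  -- theorem does not apply; but then the cocycle already is a function of `Y`.
  rcases subsingleton_or_nontrivial A with hA | hA
  · have hK : ∀ k l : K, k = l := fun k l => PontryaginDual.ext fun a => by
      rw [Subsingleton.elim a 1, map_one, map_one]
    refine ⟨1, fun _ => 1, fun g y => c g (mkProd σ ((fun _ => 1 : Shift σ K), y)),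
      measurable_const, fun g => ?_, fun g => ae_of_all _ fun z => ?_, fun k =>
      ae_of_all _ fun z => by simp⟩
    · exact (hc.measurable g).comp (((measurePreserving_mkProd σ ν).measurable).comp
        measurable_prodMk_left)
    · simp only [one_mul, inv_one, mul_one]
      congr 3
      exact funext fun i => hK _ _
  let P := (Shift.measure σ (probHaar K)).prod ν
  let PF := (Shift.measure (finPerm D σ) (probHaar K)).prod ν
  let C : L → Shift σ K × Y → Circle := fun g z => c g (mkProd σ z)
  have hmk := measurePreserving_mkProd σ ν (K := K)
  have hC : ∀ g, Measurable (C g) := fun g => (hc.measurable g).comp hmk.measurable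
  have hCinv : ∀ g, ∀ d ∈ D, ∀ᵐ z ∂P, C g (d • z) = C g z := fun g d hd =>
    hmk.quasiMeasurePreserving.ae (hc.of_trivial_on_normal htriv g hd).1
  obtain ⟨C', hC', hCC'⟩ := exists_eq_restrictFin_of_invariant D σ (probHaar K) ν hC hCinv
  let r : Shift σ K × Y → Shift (finPerm D σ) K × Y := fun z => (restrictFin D σ z.1, z.2)
  have hr : MeasurePreserving r P PF :=
    (measurePreserving_restrictFin D σ (probHaar K)).prod (MeasurePreserving.id ν)
  have hCC'' : ∀ g, ∀ᵐ z ∂P, C g z = C' g (r z) := hCC'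
  have hcoc : IsCocycle L PF C' := by
    refine ⟨hC', fun g h => ?_⟩
    rw [← hr.map_eq]
    refine (ae_map_iff (p := fun z => C' (g * h) z = C' g (h • z) * C' h z) hr.aemeasurable
      (measurableSet_eq_fun (hC' _) (((hC' g).comp (measurable_const_smul h)).mul (hC' h)))).2 ?_
    filter_upwards [hCC'' (g * h), hCC'' h, (measurePreserving_smul h P).quasiMeasurePreserving.ae
      (hCC'' g), hmk.quasiMeasurePreserving.ae (hc.map_mul g h)] with z h1 h2 h3 h4
    rw [← h1, ← h2]
    refine Eq.trans ?_ (congrArg (· * C h z) h3)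
    exact h4
  have htriv' : ∀ d ∈ D, ∀ᵐ z ∂PF, C' d z = 1 := by
    intro d hd
    rw [← hr.map_eq]
    refine (ae_map_iff (p := fun z => C' d z = 1) hr.aemeasurable
      (measurableSet_eq_fun (hC' _) measurable_const)).2 ?_
    filter_upwards [hCC'' d, hmk.quasiMeasurePreserving.ae (htriv d hd)] with z h1 h2
    rw [← h1]
    exact h2
  have hne : Nonempty (finiteOrbits D σ) := by
    obtain ⟨n, hn⟩ := hσ.2
    exact ⟨⟨n, hn⟩⟩
  obtain ⟨f, θ, hf, hθ, hfθ⟩ := exists_untwisting D hrigid (finPerm D σ)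
    (infinite_range_finPerm D σ hσ.1) (orbitSet_finPerm D σ) (probHaar K) ν hcoc htriv'
  have hrotR : ∀ k, MeasurePreserving
      (fun z : Shift (finPerm D σ) K × Y => (rotate k z.1, z.2)) PF PF := fun k =>
    (measurePreserving_rotate _ k).prod (MeasurePreserving.id ν)
  have hC'rot : ∀ k g, ∀ᵐ z ∂PF, C' g (rotate k z.1, z.2) = C' g z := by
    intro k g
    have hrotP : MeasurePreserving (fun z : Shift σ K × Y => (rotate k z.1, z.2)) P P :=
      (measurePreserving_rotate _ k).prod (MeasurePreserving.id ν)
    rw [← hr.map_eq]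
    refine (ae_map_iff (p := fun z => C' g (rotate k z.1, z.2) = C' g z) hr.aemeasurable
      (measurableSet_eq_fun ((hC' g).comp (hrotR k).measurable) (hC' g))).2 ?_
    filter_upwards [hCC'' g, hrotP.quasiMeasurePreserving.ae (hCC'' g)] with z h1 h2
    rw [← h1]
    refine h2.symm.trans ?_
    change c g (BernoulliQuotient.mk σ K (rotate k z.1), z.2) = c g (mkProd σ z)
    rw [BernoulliQuotient.mk_rotate]
    rfl
  have hergR : ErgodicSMul L (Shift (finPerm D σ) K × Y) PF :=
    ergodicSMul_shift_prod _ (infinite_range_finPerm D σ hσ.1) (probHaar K) ν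
  have hconst : ∀ k, ∃ t : Circle, ∀ᵐ z ∂PF, f (rotate k z.1, z.2) = t * f z := by
    intro k
    have hinv : ∀ g : L, ∀ᵐ z ∂PF, f (rotate k (g • z).1, (g • z).2) * (f (g • z))⁻¹ =
        f (rotate k z.1, z.2) * (f z)⁻¹ := by
      intro g
      filter_upwards [hfθ g, (hrotR k).quasiMeasurePreserving.ae (hfθ g), hC'rot k g]
        with z h1 h2 h3
      have h2' : θ g z.2 = f (rotate k (g • z).1, (g • z).2) * C' g (rotate k z.1, z.2) *
        (f (rotate k z.1, z.2))⁻¹ := h2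
      rw [h3, h1] at h2'
      rw [← mul_inv_eq_iff_eq_mul] at h2'
      rw [mul_inv_eq_iff_eq_mul, mul_assoc, mul_comm _ (f (g • z))]
      rw [inv_inv] at h2'
      have h5 : f (rotate k (g • z).1, (g • z).2) * C' g z =
          f (g • z) * C' g z * (f z)⁻¹ * f (rotate k z.1, z.2) := h2'.symm
      refine mul_right_cancel (b := C' g z) (h5.trans ?_)
      simp only [mul_comm, mul_left_comm, mul_assoc]
    obtain ⟨t, ht⟩ := exists_ae_eq_const_of_invariant L PF
      (φ := fun z => f (rotate k z.1, z.2) * (f z)⁻¹)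
      ((hf.comp (hrotR k).measurable).mul hf.inv) hinv
    refine ⟨t, ?_⟩
    filter_upwards [ht] with z hz
    exact mul_inv_eq_iff_eq_mul.1 hz
  obtain ⟨a, ha⟩ := exists_character_of_rotate ν (finPerm D σ) hf hconst
  refine ⟨a, f, θ, hf, hθ, fun g => ?_, ha⟩
  filter_upwards [hr.quasiMeasurePreserving.ae (hfθ g), hCC'' g] with z h1 h2
  refine h1.trans ?_
  rw [← h2]

end Twist

section Phase

/-- The phase of a complex number, with value `1` at `0`. -/
noncomputable def phase (z : ℂ) : Circle := Circle.exp z.arg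

theorem norm_mul_phase (z : ℂ) : (‖z‖ : ℂ) * (phase z : ℂ) = z := by
  rw [phase, Circle.coe_exp]
  exact Complex.norm_mul_exp_arg_mul_I z

theorem phase_zero : phase 0 = 1 := by simp [phase]

theorem phase_mul (u : Circle) {z : ℂ} (hz : z ≠ 0) : phase (u * z) = u * phase z := by
  refine Circle.ext ?_
  have h1 := norm_mul_phase (u * z)
  rw [norm_mul, Circle.norm_coe, one_mul] at h1
  have h2 : (‖z‖ : ℂ) ≠ 0 := by simpa using hz
  refine mul_left_cancel₀ h2 (h1.trans ?_)
  conv_lhs => rw [← norm_mul_phase z]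
  push_cast
  ring

theorem measurable_phase : Measurable phase :=
  Circle.exp.continuous.measurable.comp Complex.measurable_arg

end Phase

/-! ### Cocycles some power of which is a coboundary. -/

section Product

open Filter Set
open scoped Pointwise

variable {V Y : Type*} [MeasurableSpace V] [MeasurableSpace Y]

/-- A function on a product of modulus one has a nonzero integral over a section of some set of a
generating π-system. -/
theorem exists_setIntegral_section_ne_zero (ρ : Measure V) [IsProbabilityMeasure ρ]
    (ν : Measure Y) [IsProbabilityMeasure ν] {f : V × Y → Circle} (hf : Measurable f)
    {𝒮 : Set (Set V)} (hpi : IsPiSystem 𝒮) (huniv : univ ∈ 𝒮)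
    (hgen : MeasurableSpace.generateFrom 𝒮 = ‹MeasurableSpace V›) :
    ∃ S ∈ 𝒮, ¬ ∀ᵐ y ∂ν, ∫ v in S, (f (v, y) : ℂ) ∂ρ = 0 := by
  by_contra! hcon
  let F : V × Y → ℂ := fun z => f z
  have hF : Integrable F (ρ.prod ν) :=
    Integrable.of_bound (measurable_coe_circle_iff.2 hf).aestronglyMeasurable 1
      (ae_of_all _ fun z => (Circle.norm_coe _).le)
  have hrect : ∀ S ∈ 𝒮, ∀ B : Set Y, MeasurableSet B → ∫ z in S ×ˢ B, F z ∂ρ.prod ν = 0 := by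
    intro S hS B hB
    have h1 : ∫ z in S ×ˢ B, F z ∂ρ.prod ν = ∫ z in B ×ˢ S, F z.swap ∂ν.prod ρ := by
      rw [setIntegral_prod_swap]
    rw [h1, setIntegral_prod]
    · refine setIntegral_eq_zero_of_ae_eq_zero ?_
      filter_upwards [hcon S hS] with y hy _ using hy
    · exact ((hF.swap).integrableOn)
  have hall : ∀ E : Set (V × Y), MeasurableSet E → ∫ z in E, F z ∂ρ.prod ν = 0 := by
    have hg : Prod.instMeasurableSpace = MeasurableSpace.generateFrom
        (Set.image2 (fun x1 x2 => x1 ×ˢ x2) 𝒮 {B : Set Y | MeasurableSet B}) :=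
      (generateFrom_eq_prod hgen MeasurableSpace.generateFrom_measurableSet
        ⟨fun _ => univ, fun _ => huniv, iUnion_const _⟩ isCountablySpanning_measurableSet).symm
    intro E hE
    refine MeasurableSpace.induction_on_inter (C := fun E _ => ∫ z in E, F z ∂ρ.prod ν = 0) hg
      (hpi.prod MeasurableSpace.isPiSystem_measurableSet) (by simp) ?_ ?_ ?_ E hE
    · rintro _ ⟨S, hS, B, hB, rfl⟩
      exact hrect S hS B hB
    · intro t ht h
      rw [setIntegral_compl ht hF, h, ← setIntegral_univ, ← univ_prod_univ,
        hrect univ huniv univ MeasurableSet.univ, sub_zero]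
    · intro t hd ht h
      rw [integral_iUnion ht hd hF.integrableOn]
      simp [h]
  obtain ⟨z, hz⟩ := (Integrable.ae_eq_zero_of_forall_setIntegral_eq_zero hF
    fun E hE _ => hall E hE).exists
  exact Circle.coe_ne_zero _ hz

/-- If `f` transforms under a group by a cocycle of the second variable only, then some power of
this cocycle is a coboundary, provided that enough sets have finite orbits. -/
theorem exists_pow_coboundary {D : Type*} [Group D] [Countable D] [MulAction D V] [MulAction D Y]
    [MeasurableConstSMul D V] [MeasurableConstSMul D Y]
    (ρ : Measure V) [IsProbabilityMeasure ρ] [SMulInvariantMeasure D V ρ]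
    (ν : Measure Y) [IsProbabilityMeasure ν] [ErgodicSMul D Y ν]
    {f : V × Y → Circle} (hf : Measurable f) {θ : D → Y → Circle}
    (hfθ : ∀ d : D, ∀ᵐ z ∂ρ.prod ν, f (d • z) = θ d z.2 * f z)
    (hgen : MeasurableSpace.generateFrom
      {S : Set V | MeasurableSet S ∧ (MulAction.orbit D S).Finite} = ‹MeasurableSpace V›) :
    ∃ n ≠ 0, ∃ Ψ : Y → Circle, Measurable Ψ ∧
      ∀ d : D, ∀ᵐ y ∂ν, Ψ (d • y) = θ d y ^ n * Ψ y := by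
  classical
  have hpi : IsPiSystem {S : Set V | MeasurableSet S ∧ (MulAction.orbit D S).Finite} := by
    rintro S ⟨hS, hS'⟩ T ⟨hT, hT'⟩ -
    refine ⟨hS.inter hT, (hS'.image2 (· ∩ ·) hT').subset ?_⟩
    rintro _ ⟨d, rfl⟩
    exact ⟨d • S, ⟨d, rfl⟩, d • T, ⟨d, rfl⟩, smul_set_inter.symm⟩
  obtain ⟨S, ⟨hS, hSfin⟩, hSne⟩ := exists_setIntegral_section_ne_zero ρ ν hf hpi
    ⟨MeasurableSet.univ, (finite_singleton univ).subset (by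
      rintro _ ⟨d, rfl⟩
      exact smul_set_univ)⟩ hgen
  have : Fintype (MulAction.orbit D S) := hSfin.fintype
  -- Up to the common factor `θ d`, the group permutes the finitely many functions `ψ T`, where `T`
  -- runs through the orbit of `S`.
  let ψ : Set V → Y → ℂ := fun T y => ∫ v in T, (f (v, y) : ℂ) ∂ρ
  have hψm : ∀ T, Measurable (ψ T) := fun T =>
    measurable_integral_coe_circle (ρ.restrict T) (hf.comp measurable_swap)
  have hψd : ∀ (d : D) (T : Set V), ∀ᵐ y ∂ν, ψ (d • T) (d • y) = θ d y * ψ T y := by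
    intro d T
    filter_upwards [ae_ae_of_ae_prod_swap (hfθ d)] with y hy
    have h1 := (measurePreserving_smul d ρ).setIntegral_preimage_emb
      (measurableEmbedding_const_smul d) (fun v => (f (v, d • y) : ℂ)) (d • T)
    have h2 : (fun v : V => d • v) ⁻¹' (d • T) = T := by
      ext v
      simp
    rw [h2] at h1
    change ∫ v in d • T, (f (v, d • y) : ℂ) ∂ρ = _
    rw [← h1, ← integral_const_mul]
    refine integral_congr_ae (ae_restrict_of_ae ?_)
    filter_upwards [hy] with v hv
    rw [← Circle.coe_mul]
    exact congrArg _ hv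
  have hψall : ∀ d : D, ∀ᵐ y ∂ν, ∀ T : MulAction.orbit D S,
      ψ (d • T : MulAction.orbit D S) (d • y) = θ d y * ψ T y := fun d =>
    ae_all_iff.2 fun T => hψd d T
  -- The number of nonvanishing `ψ T` is invariant, hence constant, and it is the exponent: in the
  -- product of the phases each nonvanishing `ψ T` contributes one factor `θ d`, and a vanishing one
  -- contributes none.
  let N : Y → ℕ := fun y => ∑ T : MulAction.orbit D S, if ψ T y = 0 then 0 else 1
  have hN : Measurable N := Finset.measurable_sum _ fun T _ =>
    Measurable.ite (hψm T (measurableSet_singleton 0)) measurable_const measurable_const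
  have hNinv : ∀ d : D, ∀ᵐ y ∂ν, N (d • y) = N y := by
    intro d
    filter_upwards [hψall d] with y hy
    change ∑ T : MulAction.orbit D S, _ = ∑ T : MulAction.orbit D S, _
    rw [← Equiv.sum_comp (MulAction.toPerm d)]
    refine Finset.sum_congr rfl fun T _ => ?_
    simp only [MulAction.toPerm_apply, hy T, mul_eq_zero, Circle.coe_ne_zero, false_or]
  obtain ⟨n, hn⟩ := exists_ae_eq_const_of_invariant D ν hN hNinv
  have hn0 : n ≠ 0 := by
    rintro rfl
    refine hSne ?_
    filter_upwards [hn] with y hy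
    have := Finset.sum_eq_zero_iff.1 hy ⟨S, MulAction.mem_orbit_self S⟩ (Finset.mem_univ _)
    by_contra hne
    change ¬ ψ S y = 0 at hne
    simp [hne] at this
  refine ⟨n, hn0, fun y => ∏ T : MulAction.orbit D S, phase (ψ T y),
    Finset.measurable_prod _ fun T _ => measurable_phase.comp (hψm T), fun d => ?_⟩
  filter_upwards [hψall d, hn] with y hy hny
  rw [← Equiv.prod_comp (MulAction.toPerm d), ← hny, ← Finset.prod_pow_eq_pow_sum,
    ← Finset.prod_mul_distrib]
  refine Finset.prod_congr rfl fun T _ => ?_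
  rw [MulAction.toPerm_apply, hy T]
  split_ifs with h
  · rw [h, mul_zero, phase_zero, pow_zero, one_mul]
  · rw [phase_mul _ h, pow_one]

end Product

section FiniteOrbits

open Filter Set
open scoped Pointwise

/-- Cylinders over one coordinate generate, and `D` moves such a cylinder only among the cylinders
over the finite `D`-orbit of its coordinate. This is what `exists_pow_coboundary` requires of the
fibre. -/
theorem generateFrom_finite_orbit {L I K : Type*} [Group L] (D : Subgroup L)
    (τ : L →* Equiv.Perm I) (hτ : ∀ i, (orbitSet D τ i).Finite) [MeasurableSpace K] :
    MeasurableSpace.generateFrom {S : Set (Shift τ K) | MeasurableSet S ∧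
      (MulAction.orbit D S).Finite} = (inferInstance : MeasurableSpace (Shift τ K)) := by
  refine le_antisymm (MeasurableSpace.generateFrom_le fun S hS => hS.1) ?_
  have h : (inferInstance : MeasurableSpace (Shift τ K)) = MeasurableSpace.generateFrom
    {B | ∃ (i : I) (C : Set K), MeasurableSet C ∧ Function.eval i ⁻¹' C = B} :=
    MeasurableSpace.pi_eq_generateFrom_projections (α := fun _ : I => K)
  rw [h]
  refine MeasurableSpace.generateFrom_mono ?_
  rintro _ ⟨i, C, hC, rfl⟩
  refine ⟨Shift.measurable_apply τ i hC,
    ((hτ i).image fun j => {x : Shift τ K | x j ∈ C}).subset ?_⟩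
  rintro _ ⟨d, rfl⟩
  refine ⟨τ d i, ⟨d, rfl⟩, ?_⟩
  ext x
  change x (τ d i) ∈ C ↔ x ∈ (d : L) • {x : Shift τ K | x i ∈ C}
  rw [mem_smul_set_iff_inv_smul_mem]
  change _ ↔ x ((τ (d : L)⁻¹)⁻¹ i) ∈ C
  rw [← map_inv, inv_inv]

end FiniteOrbits

/-! ### Multiplicativity of twists, and when they are trivial. -/

section Twist

open Filter Set

variable {L : Type*} [Group L] {D : Subgroup L} [D.Normal] {σ : L →* Equiv.Perm ℕ}
  {A : Type*} [CommGroup A] [TopologicalSpace A] [DiscreteTopology A]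
  {Y : Type*} [MeasurableSpace Y] [MulAction L Y] {ν : Measure Y}

theorem IsTwist.mul {c c' : L → BernoulliQuotient σ (PontryaginDual A) × Y → Circle} {a a' : A}
    (h : IsTwist D σ ν c a) (h' : IsTwist D σ ν c' a') :
    IsTwist D σ ν (fun g z => c g z * c' g z) (a * a') := by
  obtain ⟨f, θ, hf, hθ, hfθ, hk⟩ := h
  obtain ⟨f', θ', hf', hθ', hfθ', hk'⟩ := h'
  refine ⟨fun z => f z * f' z, fun g y => θ g y * θ' g y, hf.mul hf', fun g => (hθ g).mul (hθ' g),
    fun g => ?_, fun k => ?_⟩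
  · filter_upwards [hfθ g, hfθ' g] with z h1 h2
    rw [h1, h2, mul_inv]
    simp only [mul_comm, mul_left_comm, mul_assoc]
  · filter_upwards [hk k, hk' k] with z h1 h2
    rw [h1, h2, map_mul]
    exact mul_mul_mul_comm _ _ _ _

theorem IsTwist.inv {c : L → BernoulliQuotient σ (PontryaginDual A) × Y → Circle} {a : A}
    (h : IsTwist D σ ν c a) : IsTwist D σ ν (fun g z => (c g z)⁻¹) a⁻¹ := by
  obtain ⟨f, θ, hf, hθ, hfθ, hk⟩ := h
  refine ⟨fun z => (f z)⁻¹, fun g y => (θ g y)⁻¹, hf.inv, fun g => (hθ g).inv,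
    fun g => ?_, fun k => ?_⟩
  · filter_upwards [hfθ g] with z h1
    rw [h1, mul_inv, mul_inv]
  · filter_upwards [hk k] with z h1
    rw [h1, map_inv, mul_inv]

/-- A function on `K ^ I × Y` which is equivariant up to functions of the second variable does not
transform under `K` by a nontrivial character. -/
theorem eq_one_of_rotate [Countable L] [Countable A] [MeasurableConstSMul L Y]
    [IsProbabilityMeasure ν] [ErgodicSMul L Y ν] {I : Type*} [Countable I] (τ : L →* Equiv.Perm I)
    (hτ : ∀ i, (range fun g => τ g i).Infinite)
    {u : Shift τ (PontryaginDual A) × Y → Circle} (hu : Measurable u) {θ : L → Y → Circle}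
    (hθ : ∀ g : L, ∀ᵐ z ∂(Shift.measure τ (probHaar (PontryaginDual A))).prod ν,
      u (g • z) = θ g z.2 * u z)
    {a : A} (ha : ∀ k, ∀ᵐ z ∂(Shift.measure τ (probHaar (PontryaginDual A))).prod ν,
      u (rotate k z.1, z.2) = k a * u z) : a = 1 := by
  let X := Shift τ (PontryaginDual A)
  let P : Measure X := Shift.measure τ (probHaar (PontryaginDual A))
  -- Over a common point of `Y` the factors `θ` cancel, so `φ` is invariant and hence constant;
  -- rotating only the first copy by `k` multiplies it by `k a`.
  let φ : X × (X × Y) → Circle := fun z => u (z.1, z.2.2) * (u z.2)⁻¹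
  have q1 : MeasurePreserving (fun z : X × (X × Y) => (z.1, z.2.2)) (P.prod (P.prod ν))
      (P.prod ν) := (MeasurePreserving.id P).prod measurePreserving_snd
  have q2 : MeasurePreserving (fun z : X × (X × Y) => z.2) (P.prod (P.prod ν)) (P.prod ν) :=
    measurePreserving_snd
  have hφ : Measurable φ := (hu.comp q1.measurable).mul (hu.comp q2.measurable).inv
  have hinv : ∀ g : L, ∀ᵐ z ∂P.prod (P.prod ν), φ (g • z) = φ z := by
    intro g
    filter_upwards [q1.quasiMeasurePreserving.ae (hθ g), q2.quasiMeasurePreserving.ae (hθ g)]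
      with z h1 h2
    change u (g • (z.1, z.2.2)) * (u (g • z.2))⁻¹ = u (z.1, z.2.2) * (u z.2)⁻¹
    rw [h1, h2, mul_inv, mul_mul_mul_comm, mul_inv_cancel, one_mul]
  have e1 : ErgodicSMul L (X × Y) (P.prod ν) := ergodicSMul_shift_prod τ hτ _ ν
  have e2 : ErgodicSMul L (X × (X × Y)) (P.prod (P.prod ν)) := ergodicSMul_shift_prod τ hτ _ _
  obtain ⟨t, ht⟩ := exists_ae_eq_const_of_invariant L _ hφ hinv
  by_contra hne
  obtain ⟨k, hk⟩ := exists_dual_apply_ne_one hne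
  refine hk ?_
  have hrot : MeasurePreserving (fun z : X × (X × Y) => (rotate k z.1, z.2)) (P.prod (P.prod ν))
      (P.prod (P.prod ν)) :=
    (measurePreserving_rotate _ k).prod (MeasurePreserving.id _)
  obtain ⟨z, h1, h2, h3⟩ := (ht.and ((hrot.quasiMeasurePreserving.ae ht).and
    (q1.quasiMeasurePreserving.ae (ha k)))).exists
  have h4 : u (rotate k z.1, z.2.2) * (u z.2)⁻¹ = t := h2
  have h5 : u (rotate k z.1, z.2.2) = k a * u (z.1, z.2.2) := h3
  rw [h5, mul_assoc] at h4
  have h6 : u (z.1, z.2.2) * (u z.2)⁻¹ = t := h1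
  rw [h6] at h4
  exact mul_eq_right.1 h4

/-- Some power of `c` is cohomologous to a character of the group. -/
def IsPowerTrivial {Z : Type*} [MeasurableSpace Z] [SMul L Z] (m : Measure Z)
    (c : L → Z → Circle) : Prop :=
  ∃ n ≠ 0, ∃ (s : Z → Circle) (η : L → Circle), Measurable s ∧
    ∀ g : L, ∀ᵐ z ∂m, c g z ^ n = η g * s (g • z) * (s z)⁻¹

/-- The function `f ^ n * s` on the whole of `K ^ ℕ × Y` changes under the group by functions of `Y`
only. Rotations multiply it by `a ^ n`, because `s` lives on the quotient. So `eq_one_of_rotate`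
yields `a ^ n = 1`, and `A` is torsion-free. -/
theorem IsTwist.eq_one_of_isPowerTrivial [Countable L] [Countable A] [IsMulTorsionFree A]
    [MeasurableConstSMul L Y] [IsProbabilityMeasure ν] [ErgodicSMul L Y ν]
    (hσ : ∀ n, (range fun g => σ g n).Infinite)
    {c : L → BernoulliQuotient σ (PontryaginDual A) × Y → Circle} {a : A}
    (h : IsTwist D σ ν c a)
    (hc : IsPowerTrivial ((BernoulliQuotient.measure σ (PontryaginDual A)).prod ν) c) : a = 1 := by
  obtain ⟨f, θ, hf, hθ, hfθ, hk⟩ := h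
  obtain ⟨n, hn, s, η, hs, hsη⟩ := hc
  have hmk := measurePreserving_mkProd σ ν (K := PontryaginDual A)
  let r : Shift σ (PontryaginDual A) × Y → Shift (finPerm D σ) (PontryaginDual A) × Y :=
    fun z => (restrictFin D σ z.1, z.2)
  have hr : MeasurePreserving r ((Shift.measure σ (probHaar (PontryaginDual A))).prod ν)
      ((Shift.measure (finPerm D σ) (probHaar (PontryaginDual A))).prod ν) :=
    (measurePreserving_restrictFin D σ _).prod (MeasurePreserving.id ν)
  have hpow : a ^ n = 1 := by
    refine eq_one_of_rotate (ν := ν) σ hσ (u := fun z => f (r z) ^ n * s (mkProd σ z))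
      (((hf.comp hr.measurable).pow_const n).mul (hs.comp hmk.measurable))
      (θ := fun g y => θ g y ^ n * (η g)⁻¹) (fun g => ?_) (fun k => ?_)
    · filter_upwards [hfθ g, hmk.quasiMeasurePreserving.ae (hsη g)] with z h1 h2
      have h2' : c g (mkProd σ z) ^ n = η g * s (mkProd σ (g • z)) * (s (mkProd σ z))⁻¹ := h2
      have h1' : θ g z.2 = f (r (g • z)) * c g (mkProd σ z) * (f (r z))⁻¹ := h1
      rw [h1', mul_pow, mul_pow, h2', inv_pow]
      apply Circle.ext
      push_cast
      field_simp
    · filter_upwards [hr.quasiMeasurePreserving.ae (hk k)] with z h1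
      have h1' : f (r (rotate k z.1, z.2)) = k a * f (r z) := h1
      have h2 : mkProd σ (rotate k z.1, z.2) = mkProd σ z :=
        Prod.ext (BernoulliQuotient.mk_rotate σ _ k z.1) rfl
      rw [h1', h2, map_pow, mul_pow, mul_assoc]
  exact IsMulTorsionFree.pow_left_injective hn (hpow.trans (one_pow n).symm)

end Twist

/-! ### Descending rotation-invariant functions to the quotient. -/

section Descent

open Filter Set

variable {L : Type*} [Group L] (σ : L →* Equiv.Perm ℕ)
  {K : Type*} [CommGroup K] [TopologicalSpace K] [IsTopologicalGroup K] [CompactSpace K]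
  [MeasurableSpace K] [BorelSpace K] [SecondCountableTopology K]
  {Y : Type*} [MeasurableSpace Y] {ν : Measure Y} [IsProbabilityMeasure ν]

/-- The representative of a rotation orbit with first coordinate `1`. -/
def BernoulliQuotient.normalize : BernoulliQuotient σ K → Shift σ K :=
  Quotient.lift (fun (x : ℕ → K) i => (x 0)⁻¹ * x i) (by
    rintro _ y ⟨k, rfl⟩
    funext i
    change (k * y 0)⁻¹ * (k * y i) = _
    rw [mul_inv_rev, mul_assoc, inv_mul_cancel_left])

omit [TopologicalSpace K] [IsTopologicalGroup K] [CompactSpace K] [MeasurableSpace K] [BorelSpace K]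
  [SecondCountableTopology K] in
theorem BernoulliQuotient.normalize_mk (x : Shift σ K) :
    BernoulliQuotient.normalize σ (BernoulliQuotient.mk σ K x) = rotate (x 0)⁻¹ x := rfl

omit [CompactSpace K] in
theorem BernoulliQuotient.measurable_normalize :
    Measurable (BernoulliQuotient.normalize σ (K := K)) := by
  refine BernoulliQuotient.measurable_of_mk σ ?_
  simp only [BernoulliQuotient.normalize_mk]
  exact measurable_rotate.comp ((Shift.measurable_apply σ 0).inv.prodMk measurable_id)

/-- Functions invariant under rotations descend to the quotient. -/
theorem exists_mkProd_eq_of_rotate_invariant {φ : Shift σ K × Y → Circle} (hφ : Measurable φ)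
    (hinv : ∀ k, ∀ᵐ z ∂(Shift.measure σ (probHaar K)).prod ν, φ (rotate k z.1, z.2) = φ z) :
    ∃ φ' : BernoulliQuotient σ K × Y → Circle, Measurable φ' ∧
      ∀ᵐ z ∂(Shift.measure σ (probHaar K)).prod ν, φ' (mkProd σ z) = φ z := by
  let P := (Shift.measure σ (probHaar K)).prod ν
  let κ := probHaar K
  have hm : Measurable fun w : K × (Shift σ K × Y) => φ (rotate w.1 w.2.1, w.2.2) :=
    hφ.comp ((measurable_rotate.comp (measurable_fst.prodMk measurable_snd.fst)).prodMk
      measurable_snd.snd)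
  have h1 : ∀ᵐ w ∂κ.prod P, φ (rotate w.1 w.2.1, w.2.2) = φ w.2 :=
    (Measure.ae_prod_iff_ae_ae (measurableSet_eq_fun hm (hφ.comp measurable_snd))).2
      (ae_of_all _ hinv)
  -- The normalized representatives may form a null set, so `φ` cannot simply be evaluated on them.
  -- They are rotated by a random `l` first: by invariance of Haar measure `l * (x 0)⁻¹` is as
  -- generic as `l`, and Fubini provides one good `l`.
  have hskew : MeasurePreserving (fun w : (Shift σ K × Y) × K => (w.1, w.2 * (w.1.1 0)⁻¹))
      (P.prod κ) (P.prod κ) := by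
    refine (MeasurePreserving.id P).skew_product (g := fun z k => k * (z.1 0)⁻¹) ?_
      (ae_of_all _ fun z => map_mul_right_eq_self κ _)
    exact measurable_snd.mul ((Shift.measurable_apply σ 0).comp measurable_fst.fst).inv
  have h2 : ∀ᵐ w ∂P.prod κ, φ (rotate (w.2 * (w.1.1 0)⁻¹) w.1.1, w.1.2) = φ w.1 :=
    (Measure.measurePreserving_swap.comp hskew).quasiMeasurePreserving.ae h1
  obtain ⟨l, hl⟩ := (ae_ae_of_ae_prod_swap h2).exists
  refine ⟨fun q => φ (rotate l (BernoulliQuotient.normalize σ q.1), q.2),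
    hφ.comp (Measurable.prodMk ?_ measurable_snd), ?_⟩
  · exact measurable_rotate.comp (measurable_const.prodMk
      ((BernoulliQuotient.measurable_normalize σ).comp measurable_fst))
  · filter_upwards [hl] with z hz
    rw [← hz]
    change φ (rotate l (BernoulliQuotient.normalize σ (BernoulliQuotient.mk σ K z.1)), z.2) = _
    rw [BernoulliQuotient.normalize_mk, ← rotate_mul]

end Descent

/-! ### Realizing every twist, and the power-triviality of untwisted cocycles. -/

section Realization

open Filter Set

variable {A : Type*} [CommGroup A] [TopologicalSpace A] [DiscreteTopology A]

theorem ae_dual_apply_coe_ne [IsMulTorsionFree A] {a : A} (ha : a ≠ 1) (w : ℂ) :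
    ∀ᵐ k ∂probHaar (PontryaginDual A), (k a : ℂ) ≠ w := by
  by_cases h : ∃ l : PontryaginDual A, (l a : ℂ) = w
  · obtain ⟨l, rfl⟩ := h
    filter_upwards [(measurePreserving_mul_left (probHaar
      (PontryaginDual A)) l⁻¹).quasiMeasurePreserving.ae (ae_dual_apply_ne_one ha)] with k hk h
    refine hk ?_
    change (l a)⁻¹ * k a = 1
    rw [Circle.ext h, inv_mul_cancel]
  · exact ae_of_all _ fun k hk => h ⟨k, hk⟩

/-- When the coordinates other than `i` are fixed, the sum vanishes for at most one value of `x i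
a`, and every single value has probability zero. -/
theorem ae_sum_dual_ne_zero [Countable A] [IsMulTorsionFree A] {a : A} (ha : a ≠ 1) {I : Type*}
    (O : Finset I) {i : I} (hi : i ∈ O) :
    ∀ᵐ x ∂Measure.infinitePi fun _ : I => probHaar (PontryaginDual A),
      ∑ j ∈ O, (x j a : ℂ) ≠ 0 := by
  classical
  have hg := measurePreserving_glue {i} (probHaar (PontryaginDual A))
  have hm : Measurable fun x : I → PontryaginDual A => ∑ j ∈ O, (x j a : ℂ) :=
    Finset.measurable_sum _ fun j _ => measurable_coe_circle_iff.2
      ((measurable_eval_dual a).comp (measurable_pi_apply j))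
  rw [← hg.map_eq]
  refine (ae_map_iff (p := fun x : I → PontryaginDual A => ∑ j ∈ O, (x j a : ℂ) ≠ 0)
    hg.aemeasurable (hm (measurableSet_singleton 0)).compl).2 ?_
  refine (Measure.ae_prod_iff_ae_ae (p := fun z : ((({i} : Set I)ᶜ : Set I) → PontryaginDual A) ×
    (({i} : Set I) → PontryaginDual A) => ∑ j ∈ O, (glue {i} z j a : ℂ) ≠ 0)
    ((hm.comp hg.measurable) (measurableSet_singleton 0)).compl).2 (ae_of_all _ fun x => ?_)
  have hev := measurePreserving_eval_infinitePi
    (fun _ : ({i} : Set I) => probHaar (PontryaginDual A)) ⟨i, rfl⟩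
  filter_upwards [hev.quasiMeasurePreserving.ae (ae_dual_apply_coe_ne ha
    (-∑ j ∈ O.erase i, (glue {i} (x, fun _ => 1) j a : ℂ)))] with y hy h0
  refine hy (eq_neg_of_add_eq_zero_left ?_)
  rw [← h0, ← Finset.add_sum_erase O _ hi]
  congr 1
  · rw [glue_apply_of_mem (x, y) rfl]
  · refine Finset.sum_congr rfl fun j hj => ?_
    have hji : j ∉ ({i} : Set I) := (Finset.mem_erase.1 hj).1
    rw [glue_apply_of_notMem _ hji, glue_apply_of_notMem _ hji]

variable {L : Type*} [Group L] {D : Subgroup L} [D.Normal] {σ : L →* Equiv.Perm ℕ}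
  {Y : Type*} [MeasurableSpace Y] [MulAction L Y] {ν : Measure Y}

/-- Every element of `A` is the twist of some cocycle trivial on `D`. -/
theorem exists_cocycle_isTwist [Countable A] [IsMulTorsionFree A] (hσ : IsSuitable D σ)
    [MeasurableConstSMul L Y] [IsProbabilityMeasure ν] [SMulInvariantMeasure L Y ν] (a : A) :
    ∃ c : L → BernoulliQuotient σ (PontryaginDual A) × Y → Circle,
      IsCocycle L ((BernoulliQuotient.measure σ (PontryaginDual A)).prod ν) c ∧
      (∀ d ∈ D, ∀ᵐ z ∂(BernoulliQuotient.measure σ (PontryaginDual A)).prod ν, c d z = 1) ∧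
      IsTwist D σ ν c a := by
  classical
  rcases eq_or_ne a 1 with rfl | ha
  · refine ⟨fun _ _ => 1, ⟨fun _ => measurable_const, fun g h => ae_of_all _ fun z => by simp⟩,
      fun d _ => ae_of_all _ fun z => rfl, fun _ => 1, fun _ _ => 1, measurable_const,
      fun _ => measurable_const, fun g => ae_of_all _ fun z => by simp,
      fun k => ae_of_all _ fun z => by simp⟩
  let K := PontryaginDual A
  let P := (Shift.measure σ (probHaar K)).prod ν
  let V := Shift (finPerm D σ) K
  let ρ : Measure V := Shift.measure (finPerm D σ) (probHaar K)
  obtain ⟨n, hn⟩ := hσ.2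
  let i₀ : finiteOrbits D σ := ⟨n, hn⟩
  let O : Finset (finiteOrbits D σ) := (orbitSet_finPerm D σ i₀).toFinset
  have hO : ∀ i, i ∈ O ↔ i ∈ orbitSet D (finPerm D σ) i₀ := fun i => Set.Finite.mem_toFinset _
  -- Summation over a whole `D`-orbit makes `S` invariant under `D`, so the coboundary of its phase
  -- is trivial on `D`. The factor `k a` acquired under rotation cancels in the coboundary, which
  -- therefore descends although the phase need not.
  let S : V → ℂ := fun v => ∑ i ∈ O, (v i a : ℂ)
  have hS : Measurable S := Finset.measurable_sum _ fun j _ => measurable_coe_circle_iff.2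
    ((measurable_eval_dual a).comp (Shift.measurable_apply _ j))
  have hSrot : ∀ k v, S (rotate k v) = k a * S v := by
    intro k v
    change ∑ i ∈ O, ((k a * v i a : Circle) : ℂ) = k a * ∑ i ∈ O, (v i a : ℂ)
    simp [Finset.mul_sum]
  have hSd : ∀ d ∈ D, ∀ v, S (d • v) = S v := by
    intro d hd v
    refine Finset.sum_equiv ((finPerm D σ d)⁻¹ : Equiv.Perm _) (fun i => ?_) fun i _ => rfl
    rw [hO, hO]
    have h1 : (finPerm D σ d)⁻¹ i ∈ orbitSet D (finPerm D σ) i :=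
      ⟨⟨d⁻¹, D.inv_mem hd⟩, by simp⟩
    have h2 := orbitSet_eq_of_mem h1
    constructor
    · intro h
      rw [← orbitSet_eq_of_mem h]
      exact h1
    · intro h
      rw [← orbitSet_eq_of_mem h, h2]
      exact mem_orbitSet_self _ _ _
  have hSne : ∀ᵐ v ∂ρ, S v ≠ 0 :=
    ae_sum_dual_ne_zero ha O ((hO i₀).2 (mem_orbitSet_self _ _ _))
  let b : V → Circle := fun v => phase (S v)
  have hb : Measurable b := measurable_phase.comp hS
  let r : Shift σ K × Y → V := fun z => restrictFin D σ z.1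
  have hr : MeasurePreserving r P ρ := (measurePreserving_restrictFin D σ _).comp
    measurePreserving_fst
  let φ : L → Shift σ K × Y → Circle := fun g z => b (r z) * (b (r (g • z)))⁻¹
  have hφ : ∀ g, Measurable (φ g) := fun g => (hb.comp hr.measurable).mul
    (hb.comp (hr.measurable.comp (measurable_const_smul g))).inv
  have hφrot : ∀ g k, ∀ᵐ z ∂P, φ g (rotate k z.1, z.2) = φ g z := by
    intro g k
    have h1 : ∀ᵐ z ∂P, S (r z) ≠ 0 := hr.quasiMeasurePreserving.ae hSne
    filter_upwards [h1, (measurePreserving_smul g P).quasiMeasurePreserving.ae h1] with z h2 h3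
    change phase (S (rotate k (r z))) * (phase (S (rotate k (r (g • z)))))⁻¹ =
      phase (S (r z)) * (phase (S (r (g • z))))⁻¹
    rw [hSrot, hSrot, phase_mul _ h2, phase_mul _ h3, mul_inv, mul_mul_mul_comm, mul_inv_cancel,
      one_mul]
  have hex : ∀ g, ∃ c : BernoulliQuotient σ K × Y → Circle, Measurable c ∧
      ∀ᵐ z ∂P, c (mkProd σ z) = φ g z := fun g =>
    exists_mkProd_eq_of_rotate_invariant σ (hφ g) (hφrot g)
  choose c hc hcφ using hex
  have hmk := measurePreserving_mkProd σ ν (K := K)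
  refine ⟨c, ⟨hc, fun g h => ?_⟩, fun d hd => ?_, fun z => b z.1, fun _ _ => 1,
    hb.comp measurable_fst, fun _ => measurable_const, fun g => ?_, fun k => ?_⟩
  · rw [← hmk.map_eq]
    refine (ae_map_iff (p := fun z => c (g * h) z = c g (h • z) * c h z) hmk.aemeasurable
      (measurableSet_eq_fun (hc _) (((hc g).comp (measurable_const_smul h)).mul (hc h)))).2 ?_
    filter_upwards [hcφ (g * h), hcφ h, (measurePreserving_smul h P).quasiMeasurePreserving.ae
      (hcφ g)] with z h1 h2 h3
    have h3' : c g (h • mkProd σ z) = φ g (h • z) := h3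
    rw [h1, h2, h3']
    change b (r z) * (b (r ((g * h) • z)))⁻¹ =
      b (r (h • z)) * (b (r (g • h • z)))⁻¹ * (b (r z) * (b (r (h • z)))⁻¹)
    rw [mul_smul]
    apply Circle.ext
    push_cast
    field_simp
  · rw [← hmk.map_eq]
    refine (ae_map_iff (p := fun z => c d z = 1) hmk.aemeasurable
      (measurableSet_eq_fun (hc _) measurable_const)).2 ?_
    filter_upwards [hcφ d] with z h1
    rw [h1]
    change phase (S (r z)) * (phase (S (d • r z)))⁻¹ = 1
    rw [hSd d hd, mul_inv_cancel]
  · filter_upwards [hcφ g] with z h1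
    rw [h1]
    change 1 = b (r (g • z)) * (b (r z) * (b (r (g • z)))⁻¹) * (b (r z))⁻¹
    apply Circle.ext
    push_cast
    field_simp
  · filter_upwards [(measurePreserving_fst (μ := ρ) (ν := ν)).quasiMeasurePreserving.ae hSne]
      with z hz
    change phase (S (rotate k z.1)) = k a * phase (S z.1)
    rw [hSrot, phase_mul _ hz]

/-- On `D`, where `c` is trivial, `f` changes by `θ` alone, so `exists_pow_coboundary` makes a power
of `θ` on `D` a coboundary of some `Ψ`. The correspondingly corrected power of `θ` is trivial on the
normal subgroup `D`, hence `D`-invariant, hence constant for each group element. Because the twist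
is `1`, the transfer function `Ψ / f ^ n` is invariant under rotations and descends. -/
theorem IsTwist.isPowerTrivial [Countable L] [Countable A] [MeasurableConstSMul L Y]
    [IsProbabilityMeasure ν] [SMulInvariantMeasure L Y ν] [ErgodicSMul D Y ν]
    {c : L → BernoulliQuotient σ (PontryaginDual A) × Y → Circle}
    (hc : IsCocycle L ((BernoulliQuotient.measure σ (PontryaginDual A)).prod ν) c)
    (htriv : ∀ d ∈ D, ∀ᵐ z ∂(BernoulliQuotient.measure σ (PontryaginDual A)).prod ν, c d z = 1)
    (h : IsTwist D σ ν c 1) :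
    IsPowerTrivial ((BernoulliQuotient.measure σ (PontryaginDual A)).prod ν) c := by
  obtain ⟨f, θ, hf, hθ, hfθ, hk⟩ := h
  let K := PontryaginDual A
  let P := (Shift.measure σ (probHaar K)).prod ν
  let ρ := Shift.measure (finPerm D σ) (probHaar K)
  have hmk := measurePreserving_mkProd σ ν (K := K)
  let r : Shift σ K × Y → Shift (finPerm D σ) K × Y := fun z => (restrictFin D σ z.1, z.2)
  have hr : MeasurePreserving r P (ρ.prod ν) :=
    (measurePreserving_restrictFin D σ _).prod (MeasurePreserving.id ν)
  have hsnd : ∀ {p : Y → Prop}, (∀ᵐ z ∂P, p z.2) → ∀ᵐ y ∂ν, p y := by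
    intro p hp
    filter_upwards [ae_ae_of_ae_prod_swap hp] with y hy
    exact hy.exists.choose_spec
  have hθc : IsCocycle L ν θ := by
    refine ⟨hθ, fun g h => hsnd ?_⟩
    filter_upwards [hfθ (g * h), hfθ h, (measurePreserving_smul h P).quasiMeasurePreserving.ae
      (hfθ g), hmk.quasiMeasurePreserving.ae (hc.map_mul g h)] with z h1 h2 h3 h4
    have h3' : θ g (h • z.2) = f (g • h • r z) * c g (h • mkProd σ z) * (f (h • r z))⁻¹ := h3
    have h1' : θ (g * h) z.2 = f ((g * h) • r z) * c (g * h) (mkProd σ z) * (f (r z))⁻¹ := h1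
    have h2' : θ h z.2 = f (h • r z) * c h (mkProd σ z) * (f (r z))⁻¹ := h2
    rw [h1', h2', h3', h4, mul_smul]
    apply Circle.ext
    push_cast
    field_simp
  have hfD : ∀ d : D, ∀ᵐ z ∂ρ.prod ν, f (d • z) = θ d z.2 * f z := by
    intro d
    rw [← hr.map_eq]
    refine (ae_map_iff (p := fun z => f ((d : L) • z) = θ d z.2 * f z) hr.aemeasurable
      (measurableSet_eq_fun (hf.comp (measurable_const_smul (d : L)))
        (((hθ d).comp measurable_snd).mul hf))).2 ?_
    filter_upwards [hfθ d, hmk.quasiMeasurePreserving.ae (htriv d d.2)] with z h1 h2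
    have h1' : θ d z.2 = f ((d : L) • r z) * c d (mkProd σ z) * (f (r z))⁻¹ := h1
    change f ((d : L) • r z) = θ d z.2 * f (r z)
    rw [h1', h2, mul_one, inv_mul_cancel_right]
  obtain ⟨n, hn, Ψ, hΨ, hΨθ⟩ := exists_pow_coboundary (D := D) ρ ν hf
    (θ := fun d => θ d) hfD (generateFrom_finite_orbit D (finPerm D σ) (orbitSet_finPerm D σ))
  let θ' : L → Y → Circle := fun g y => θ g y ^ n * (Ψ (g • y))⁻¹ * Ψ y
  have hθ' : IsCocycle L ν θ' := by
    refine ⟨fun g => (((hθ g).pow_const n).mul (hΨ.comp (measurable_const_smul g)).inv).mul hΨ,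
      fun g h => ?_⟩
    filter_upwards [hθc.map_mul g h] with y hy
    change θ (g * h) y ^ n * (Ψ ((g * h) • y))⁻¹ * Ψ y = θ g (h • y) ^ n * (Ψ (g • h • y))⁻¹ *
      Ψ (h • y) * (θ h y ^ n * (Ψ (h • y))⁻¹ * Ψ y)
    rw [hy, mul_smul, mul_pow]
    apply Circle.ext
    push_cast
    field_simp
  have hθ'D : ∀ d ∈ D, ∀ᵐ y ∂ν, θ' d y = 1 := by
    intro d hd
    filter_upwards [hΨθ ⟨d, hd⟩] with y hy
    have hy' : Ψ (d • y) = θ d y ^ n * Ψ y := hy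
    change θ d y ^ n * (Ψ (d • y))⁻¹ * Ψ y = 1
    rw [hy']
    apply Circle.ext
    push_cast
    field_simp
  have hη : ∀ g, ∃ t : Circle, ∀ᵐ y ∂ν, θ' g y = t := fun g =>
    exists_ae_eq_const_of_invariant D ν (hθ'.measurable g) fun d =>
      (hθ'.of_trivial_on_normal hθ'D g d.2).1
  choose η hη using hη
  let s₀ : Shift σ K × Y → Circle := fun z => Ψ z.2 * (f (r z) ^ n)⁻¹
  have hs₀ : Measurable s₀ :=
    (hΨ.comp measurable_snd).mul ((hf.comp hr.measurable).pow_const n).inv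
  obtain ⟨s, hs, hss⟩ := exists_mkProd_eq_of_rotate_invariant σ hs₀ fun k => by
    filter_upwards [hr.quasiMeasurePreserving.ae (hk k)] with z hz
    have hz' : f (r (rotate k z.1, z.2)) = k 1 * f (r z) := hz
    change Ψ z.2 * (f (r (rotate k z.1, z.2)) ^ n)⁻¹ = Ψ z.2 * (f (r z) ^ n)⁻¹
    rw [hz', map_one, one_mul]
  refine ⟨n, hn, s, η, hs, fun g => ?_⟩
  rw [← hmk.map_eq]
  refine (ae_map_iff (p := fun z => c g z ^ n = η g * s (g • z) * (s z)⁻¹) hmk.aemeasurable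
    (measurableSet_eq_fun ((hc.measurable g).pow_const n)
      ((measurable_const.mul (hs.comp (measurable_const_smul g))).mul hs.inv))).2 ?_
  filter_upwards [hss, (measurePreserving_smul g P).quasiMeasurePreserving.ae hss, hfθ g,
    Measure.quasiMeasurePreserving_snd.ae (hη g)] with z h1 h2 h3 h4
  have h2' : s (g • mkProd σ z) = Ψ (g • z.2) * (f (g • r z) ^ n)⁻¹ := h2
  have h3' : θ g z.2 = f (g • r z) * c g (mkProd σ z) * (f (r z))⁻¹ := h3
  rw [h1, h2', ← h4]
  change _ = θ g z.2 ^ n * (Ψ (g • z.2))⁻¹ * Ψ z.2 * _ * (Ψ z.2 * (f (r z) ^ n)⁻¹)⁻¹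
  rw [h3', mul_pow, mul_pow, inv_pow]
  apply Circle.ext
  push_cast
  field_simp

end Realization

/-! ### Transport of cocycles along equivariant maps. -/

section Pullback

variable {L : Type*} [Group L] {Z Z' : Type*} [MeasurableSpace Z] [MeasurableSpace Z']
  [MulAction L Z] [MulAction L Z'] {m : Measure Z} {m' : Measure Z'}

theorem exists_equivariant_inverse [MeasurableConstSMul L Z] [SMulInvariantMeasure L Z m]
    {T : Z → Z'} (hT : IsIsoModNull m m' T)
    (hequiv : ∀ g : L, ∀ᵐ z ∂m, T (g • z) = g • T z) :
    ∃ S : Z' → Z, MeasurePreserving S m' m ∧ (∀ᵐ z ∂m, S (T z) = z) ∧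
      (∀ᵐ z ∂m', T (S z) = z) ∧ ∀ g : L, ∀ᵐ z ∂m', S (g • z) = g • S z := by
  obtain ⟨-, S, hS, hST, hTS⟩ := hT
  refine ⟨S, hS, hST, hTS, fun g => ?_⟩
  filter_upwards [hTS, hS.quasiMeasurePreserving.ae (hequiv g),
    ((measurePreserving_smul g m).comp hS).quasiMeasurePreserving.ae hST] with z h1 h2 h3
  have h3' : S (T (g • S z)) = g • S z := h3
  rw [h2, h1] at h3'
  exact h3'

theorem IsCocycle.comp {T : Type*} [Group T] [MeasurableSpace T] {c : L → Z' → T}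
    (hc : IsCocycle L m' c) {π : Z → Z'} (hπ : MeasurePreserving π m m')
    (hequiv : ∀ g : L, ∀ᵐ z ∂m, π (g • z) = g • π z) :
    IsCocycle L m fun g z => c g (π z) := by
  refine ⟨fun g => (hc.measurable g).comp hπ.measurable, fun g h => ?_⟩
  filter_upwards [hπ.quasiMeasurePreserving.ae (hc.map_mul g h), hequiv h] with z h1 h2
  rw [h2]
  exact h1

theorem IsCocycle.mul {c c' : L → Z → Circle} (hc : IsCocycle L m c) (hc' : IsCocycle L m c') :
    IsCocycle L m fun g z => c g z * c' g z := by
  refine ⟨fun g => (hc.measurable g).mul (hc'.measurable g), fun g h => ?_⟩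
  filter_upwards [hc.map_mul g h, hc'.map_mul g h] with z h1 h2
  rw [h1, h2]
  exact mul_mul_mul_comm _ _ _ _

theorem IsCocycle.inv {c : L → Z → Circle} (hc : IsCocycle L m c) :
    IsCocycle L m fun g z => (c g z)⁻¹ := by
  refine ⟨fun g => (hc.measurable g).inv, fun g h => ?_⟩
  filter_upwards [hc.map_mul g h] with z h1
  rw [h1, mul_inv]

theorem IsPowerTrivial.comp {c' : L → Z' → Circle} (hc' : IsPowerTrivial m' c') {c : L → Z → Circle}
    {π : Z → Z'} (hπ : MeasurePreserving π m m')
    (hequiv : ∀ g : L, ∀ᵐ z ∂m, π (g • z) = g • π z)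
    (hcc' : ∀ g, ∀ᵐ z ∂m, c g z = c' g (π z)) : IsPowerTrivial m c := by
  obtain ⟨n, hn, s, η, hs, h⟩ := hc'
  refine ⟨n, hn, fun z => s (π z), η, hs.comp hπ.measurable, fun g => ?_⟩
  filter_upwards [hcc' g, hπ.quasiMeasurePreserving.ae (h g), hequiv g] with z h1 h2 h3
  rw [h1, h3]
  exact h2

end Pullback

/-! ### Recovering the group from the conjugacy class. -/

section Isomorphism

/-- A relation between two groups that is compatible with the operations, total and single-valued in
both directions is the graph of an isomorphism. -/
theorem nonempty_mulEquiv_of_relation {A B : Type*} [Group A] [Group B] (r : A → B → Prop)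
    (hmul : ∀ a a' b b', r a b → r a' b' → r (a * a') (b * b'))
    (hinv : ∀ a b, r a b → r a⁻¹ b⁻¹) (hleft : ∀ a, ∃ b, r a b) (hright : ∀ b, ∃ a, r a b)
    (hone : ∀ a, r a 1 → a = 1) (hone' : ∀ b, r 1 b → b = 1) : Nonempty (A ≃* B) := by
  choose φ hφ using hleft
  have huniq : ∀ a b b', r a b → r a b' → b = b' := by
    intro a b b' h h'
    have := hmul _ _ _ _ h (hinv _ _ h')
    rw [mul_inv_cancel] at this
    exact mul_inv_eq_one.1 (hone' _ this)
  let Φ : A →* B := MonoidHom.mk' φ fun a a' =>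
    huniq _ _ _ (hφ _) (hmul _ _ _ _ (hφ a) (hφ a'))
  refine ⟨MulEquiv.ofBijective Φ ⟨(injective_iff_map_eq_one Φ).2 fun a ha => ?_, fun b => ?_⟩⟩
  · refine hone a ?_
    rw [← ha]
    exact hφ a
  · obtain ⟨a, ha⟩ := hright b
    exact ⟨a, huniq _ _ _ (hφ a) ha⟩

variable {L : Type*} [Group L] [Countable L] {D : Subgroup L} [D.Normal] {σ : L →* Equiv.Perm ℕ}
  {Y : Type*} [MeasurableSpace Y] [StandardBorelSpace Y] [MulAction L Y] {ν : Measure Y}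

/-- Elements of `A₀` and `A₁` are related when they are twists of cocycles trivial on `D` that
correspond under the conjugacy. The relation is total on both sides since every element is a twist
and every such cocycle has a twist. It is single-valued since a trivial twist on one side makes the
cocycle power-trivial, which passes through the conjugacy and forces a trivial twist on the other
side. -/
theorem nonempty_mulEquiv_of_conjugate
    (hrigid : HasSuperrigidMalleableActions (L ⧸ D) Circle) (hσ : IsSuitable D σ)
    [MeasurableConstSMul L Y] [IsProbabilityMeasure ν] [SMulInvariantMeasure L Y ν]
    [ErgodicSMul D Y ν]
    (A₀ A₁ : Type*) [CommGroup A₀] [Countable A₀] [IsMulTorsionFree A₀]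
    [TopologicalSpace A₀] [DiscreteTopology A₀]
    [CommGroup A₁] [Countable A₁] [IsMulTorsionFree A₁]
    [TopologicalSpace A₁] [DiscreteTopology A₁]
    (h : Conjugate L ((BernoulliQuotient.measure σ (PontryaginDual A₀)).prod ν)
      ((BernoulliQuotient.measure σ (PontryaginDual A₁)).prod ν)) : Nonempty (A₀ ≃* A₁) := by
  obtain ⟨T, hT, hTeq⟩ := h
  obtain ⟨S, hS, hST, hTS, hSeq⟩ := exists_equivariant_inverse hT hTeq
  have hTm := hT.measurePreserving
  have herg : ErgodicSMul L Y ν := ErgodicSMul.of_subgroup D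
  let m₀ := (BernoulliQuotient.measure σ (PontryaginDual A₀)).prod ν
  let m₁ := (BernoulliQuotient.measure σ (PontryaginDual A₁)).prod ν
  refine nonempty_mulEquiv_of_relation (fun a₀ a₁ =>
    ∃ (c₀ : L → BernoulliQuotient σ (PontryaginDual A₀) × Y → Circle)
      (c₁ : L → BernoulliQuotient σ (PontryaginDual A₁) × Y → Circle),
      (IsCocycle L m₀ c₀ ∧ ∀ d ∈ D, ∀ᵐ z ∂m₀, c₀ d z = 1) ∧
      (IsCocycle L m₁ c₁ ∧ ∀ d ∈ D, ∀ᵐ z ∂m₁, c₁ d z = 1) ∧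
      (∀ g, ∀ᵐ z ∂m₀, c₀ g z = c₁ g (T z)) ∧ IsTwist D σ ν c₀ a₀ ∧ IsTwist D σ ν c₁ a₁)
    ?_ ?_ ?_ ?_ ?_ ?_
  · rintro a a' b b' ⟨c₀, c₁, h₀, h₁, hc, ht₀, ht₁⟩ ⟨c₀', c₁', h₀', h₁', hc', ht₀', ht₁'⟩
    refine ⟨_, _, ⟨h₀.1.mul h₀'.1, fun d hd => ?_⟩, ⟨h₁.1.mul h₁'.1, fun d hd => ?_⟩,
      fun g => ?_, ht₀.mul ht₀', ht₁.mul ht₁'⟩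
    · filter_upwards [h₀.2 d hd, h₀'.2 d hd] with z h1 h2
      rw [h1, h2, one_mul]
    · filter_upwards [h₁.2 d hd, h₁'.2 d hd] with z h1 h2
      rw [h1, h2, one_mul]
    · filter_upwards [hc g, hc' g] with z h1 h2
      rw [h1, h2]
  · rintro a b ⟨c₀, c₁, h₀, h₁, hc, ht₀, ht₁⟩
    refine ⟨_, _, ⟨h₀.1.inv, fun d hd => ?_⟩, ⟨h₁.1.inv, fun d hd => ?_⟩,
      fun g => ?_, ht₀.inv, ht₁.inv⟩
    · filter_upwards [h₀.2 d hd] with z h1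
      rw [h1, inv_one]
    · filter_upwards [h₁.2 d hd] with z h1
      rw [h1, inv_one]
    · filter_upwards [hc g] with z h1
      rw [h1]
  · intro a
    obtain ⟨c₀, h₀, h₀', ht₀⟩ := exists_cocycle_isTwist (ν := ν) hσ a
    have h₁ := h₀.comp hS hSeq
    have h₁' : ∀ d ∈ D, ∀ᵐ z ∂m₁, c₀ d (S z) = 1 := fun d hd =>
      hS.quasiMeasurePreserving.ae (h₀' d hd)
    obtain ⟨b, hb⟩ := exists_isTwist hrigid hσ h₁ h₁'
    refine ⟨b, c₀, _, ⟨h₀, h₀'⟩, ⟨h₁, h₁'⟩, fun g => ?_, ht₀, hb⟩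
    filter_upwards [hST] with z hz
    rw [hz]
  · intro b
    obtain ⟨c₁, h₁, h₁', ht₁⟩ := exists_cocycle_isTwist (ν := ν) hσ b
    have h₀ := h₁.comp hTm hTeq
    have h₀' : ∀ d ∈ D, ∀ᵐ z ∂m₀, c₁ d (T z) = 1 := fun d hd =>
      hTm.quasiMeasurePreserving.ae (h₁' d hd)
    obtain ⟨a, ha⟩ := exists_isTwist hrigid hσ h₀ h₀'
    exact ⟨a, _, c₁, ⟨h₀, h₀'⟩, ⟨h₁, h₁'⟩, fun g => ae_of_all _ fun z => rfl, ha, ht₁⟩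
  · rintro a ⟨c₀, c₁, h₀, h₁, hc, ht₀, ht₁⟩
    exact ht₀.eq_one_of_isPowerTrivial hσ.1
      ((ht₁.isPowerTrivial h₁.1 h₁.2).comp hTm hTeq hc)
  · rintro b ⟨c₀, c₁, h₀, h₁, hc, ht₀, ht₁⟩
    refine ht₁.eq_one_of_isPowerTrivial hσ.1
      ((ht₀.isPowerTrivial h₀.1 h₀.2).comp hS hSeq fun g => ?_)
    filter_upwards [hS.quasiMeasurePreserving.ae (hc g), hTS] with z h1 h2
    have h1' : c₀ g (S z) = c₁ g (T (S z)) := h1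
    rw [h1', h2]

end Isomorphism

/-! ### Borel structure and functoriality of the quotient, and freeness and ergodicity of the
product. -/

section QuotientSpace

open Filter Set

variable {Γ : Type*} [Group Γ] (σ₀ : Γ →* Equiv.Perm ℕ)

section

variable (K : Type*) [CommGroup K]

theorem BernoulliQuotient.mk_normalize (q : BernoulliQuotient σ₀ K) :
    BernoulliQuotient.mk σ₀ K (BernoulliQuotient.normalize σ₀ q) = q := by
  obtain ⟨x, rfl⟩ := BernoulliQuotient.mk_surjective σ₀ K q
  exact BernoulliQuotient.mk_rotate σ₀ K (x 0)⁻¹ x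

theorem BernoulliQuotient.range_normalize :
    range (BernoulliQuotient.normalize σ₀ (K := K)) = {x : Shift σ₀ K | x 0 = 1} := by
  ext x
  constructor
  · rintro ⟨q, rfl⟩
    obtain ⟨x, rfl⟩ := BernoulliQuotient.mk_surjective σ₀ K q
    exact inv_mul_cancel (x 0)
  · intro hx
    refine ⟨BernoulliQuotient.mk σ₀ K x, ?_⟩
    refine (BernoulliQuotient.normalize_mk σ₀ x).trans (funext fun i => ?_)
    change (x 0)⁻¹ * x i = x i
    rw [show x 0 = 1 from hx, inv_one, one_mul]

variable [TopologicalSpace K] [IsTopologicalGroup K]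
  [MeasurableSpace K] [BorelSpace K] [SecondCountableTopology K] [T1Space K]

/-- The sequences with first coordinate `1` form a Borel set meeting every rotation orbit exactly
once; this identifies the orbit space with a Borel subset of a standard Borel space. -/
theorem BernoulliQuotient.measurableEmbedding_normalize :
    MeasurableEmbedding (BernoulliQuotient.normalize σ₀ (K := K)) where
  injective := Function.LeftInverse.injective (BernoulliQuotient.mk_normalize σ₀ K)
  measurable := BernoulliQuotient.measurable_normalize σ₀
  measurableSet_image' {s} hs := by
    have h : BernoulliQuotient.normalize σ₀ '' s = {x : Shift σ₀ K | x 0 = 1} ∩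
        (fun x : Shift σ₀ K => BernoulliQuotient.mk σ₀ K x) ⁻¹' s := by
      rw [← BernoulliQuotient.range_normalize]
      ext x
      constructor
      · rintro ⟨q, hq, rfl⟩
        refine ⟨⟨q, rfl⟩, ?_⟩
        change BernoulliQuotient.mk σ₀ K _ ∈ s
        rwa [BernoulliQuotient.mk_normalize]
      · rintro ⟨⟨q, rfl⟩, hq⟩
        change BernoulliQuotient.mk σ₀ K _ ∈ s at hq
        rw [BernoulliQuotient.mk_normalize] at hq
        exact ⟨q, hq, rfl⟩
    rw [h]
    exact (Shift.measurable_apply σ₀ 0 (measurableSet_singleton 1)).inter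
      (BernoulliQuotient.measurable_mk σ₀ hs)

theorem standardBorelSpace_of_measurableEquiv {α β : Type*} [MeasurableSpace α] [MeasurableSpace β]
    [StandardBorelSpace β] (e : α ≃ᵐ β) : StandardBorelSpace α := by
  let _ := upgradeStandardBorel β
  let _ : TopologicalSpace α := TopologicalSpace.induced e inferInstance
  have h : Topology.IsClosedEmbedding e :=
    (e.toEquiv.toHomeomorphOfIsInducing ⟨rfl⟩).isClosedEmbedding
  have : PolishSpace α := h.polishSpace
  have : BorelSpace α := ⟨by
    refine e.measurableEmbedding.comap_eq.symm.trans ?_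
    exact (congrArg (MeasurableSpace.comap e) (eq_borel_upgradeStandardBorel β)).trans
      borel_comap.symm⟩
  infer_instance

instance [StandardBorelSpace K] : StandardBorelSpace (BernoulliQuotient σ₀ K) := by
  have hm : MeasurableSet (range (BernoulliQuotient.normalize σ₀ (K := K))) :=
    (BernoulliQuotient.measurableEmbedding_normalize σ₀ K).measurableSet_range
  have := hm.standardBorel
  exact standardBorelSpace_of_measurableEquiv
    (BernoulliQuotient.measurableEmbedding_normalize σ₀ K).equivRange

end

section

variable {K K' : Type*} [CommGroup K] [CommGroup K']

/-- The map of rotation orbits induced by a homomorphism. -/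
def BernoulliQuotient.map (φ : K →* K') : BernoulliQuotient σ₀ K → BernoulliQuotient σ₀ K' :=
  Quotient.map (fun (x : ℕ → K) i => φ (x i)) (by
    rintro _ y ⟨a, rfl⟩
    exact ⟨φ a, funext fun i => (map_mul φ a (y i)).symm⟩)

theorem BernoulliQuotient.map_smul (φ : K →* K') (g : Γ) (q : BernoulliQuotient σ₀ K) :
    BernoulliQuotient.map σ₀ φ (g • q) = g • BernoulliQuotient.map σ₀ φ q := by
  obtain ⟨x, rfl⟩ := BernoulliQuotient.mk_surjective σ₀ K q
  rfl

variable [TopologicalSpace K] [IsTopologicalGroup K] [CompactSpace K] [MeasurableSpace K]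
  [BorelSpace K] [TopologicalSpace K'] [IsTopologicalGroup K'] [CompactSpace K']
  [MeasurableSpace K'] [BorelSpace K']

theorem BernoulliQuotient.measurePreserving_map {φ : K →* K'} (hφ : Continuous φ)
    (hs : Function.Surjective φ) :
    MeasurePreserving (BernoulliQuotient.map σ₀ φ) (BernoulliQuotient.measure σ₀ K)
      (BernoulliQuotient.measure σ₀ K') := by
  have hK : MeasurePreserving φ (probHaar K) (probHaar K') :=
    φ.measurePreserving hφ hs (by simp)
  have hx : MeasurePreserving (fun (x : Shift σ₀ K) => (fun i => φ (x i) : Shift σ₀ K'))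
      (Shift.measure σ₀ (probHaar K)) (Shift.measure σ₀ (probHaar K')) := by
    refine ⟨Shift.measurable_of_apply _ fun i => hK.measurable.comp (Shift.measurable_apply σ₀ i),
      ?_⟩
    refine (Measure.infinitePi_map_pi (fun _ : ℕ => probHaar K) (f := fun _ t => φ t)
      fun _ => hK.measurable).trans ?_
    simp only [hK.map_eq]
    rfl
  have hm := BernoulliQuotient.measurePreserving_mk σ₀ (K := K)
  have hm' := BernoulliQuotient.measurePreserving_mk σ₀ (K := K')
  have hmeas : Measurable (BernoulliQuotient.map σ₀ φ) :=
    BernoulliQuotient.measurable_of_mk σ₀ (hm'.comp hx).measurable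
  refine ⟨hmeas, ?_⟩
  rw [← hm.map_eq, Measure.map_map hmeas hm.measurable]
  exact (hm'.comp hx).map_eq

end

/-- An isomorphism of the groups dualizes to a topological isomorphism of the duals, which preserves
Haar measure; applied in every coordinate it commutes with permutations and respects rotation
orbits. -/
theorem conjugate_of_mulEquiv {A₀ A₁ : Type*} [CommGroup A₀] [TopologicalSpace A₀]
    [DiscreteTopology A₀] [CommGroup A₁] [TopologicalSpace A₁] [DiscreteTopology A₁]
    {Y : Type*} [MeasurableSpace Y] [MulAction Γ Y] (ν : Measure Y) [IsProbabilityMeasure ν]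
    (e : A₀ ≃* A₁) :
    Conjugate Γ ((BernoulliQuotient.measure σ₀ (PontryaginDual A₀)).prod ν)
      ((BernoulliQuotient.measure σ₀ (PontryaginDual A₁)).prod ν) := by
  let φ : PontryaginDual A₀ →ₜ* PontryaginDual A₁ :=
    PontryaginDual.map ⟨e.symm.toMonoidHom, continuous_of_discreteTopology⟩
  let ψ : PontryaginDual A₁ →ₜ* PontryaginDual A₀ :=
    PontryaginDual.map ⟨e.toMonoidHom, continuous_of_discreteTopology⟩
  have h1 : ∀ k, ψ (φ k) = k := fun k => PontryaginDual.ext fun a =>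
    congrArg k (e.symm_apply_apply a)
  have h2 : ∀ k, φ (ψ k) = k := fun k => PontryaginDual.ext fun a =>
    congrArg k (e.apply_symm_apply a)
  have hφ := BernoulliQuotient.measurePreserving_map σ₀ (φ := φ.toMonoidHom) φ.continuous_toFun
    fun k => ⟨ψ k, h2 k⟩
  have hψ := BernoulliQuotient.measurePreserving_map σ₀ (φ := ψ.toMonoidHom) ψ.continuous_toFun
    fun k => ⟨φ k, h1 k⟩
  refine ⟨Prod.map (BernoulliQuotient.map σ₀ φ.toMonoidHom) id,
    ⟨hφ.prod (MeasurePreserving.id ν), Prod.map (BernoulliQuotient.map σ₀ ψ.toMonoidHom) id,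
      hψ.prod (MeasurePreserving.id ν), ae_of_all _ ?_, ae_of_all _ ?_⟩,
    fun g => ae_of_all _ fun z => Prod.ext (BernoulliQuotient.map_smul σ₀ _ g z.1) rfl⟩
  · rintro ⟨q, y⟩
    obtain ⟨x, rfl⟩ := BernoulliQuotient.mk_surjective σ₀ _ q
    exact Prod.ext (congrArg (BernoulliQuotient.mk σ₀ _) (funext fun i => h1 (x i))) rfl
  · rintro ⟨q, y⟩
    obtain ⟨x, rfl⟩ := BernoulliQuotient.mk_surjective σ₀ _ q
    exact Prod.ext (congrArg (BernoulliQuotient.mk σ₀ _) (funext fun i => h2 (x i))) rfl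

variable {σ₀}

theorem IsAEFree.prod {X Y : Type*} [MeasurableSpace X] [MeasurableSpace Y] [SMul Γ X] [SMul Γ Y]
    {ν : Measure Y} [IsProbabilityMeasure ν] (h : IsAEFree Γ ν) (μ : Measure X) [SFinite μ] :
    IsAEFree Γ (μ.prod ν) := by
  intro g hg
  filter_upwards [Measure.quasiMeasurePreserving_snd.ae (h g hg)] with z hz heq
  exact hz (congrArg Prod.snd heq)

theorem ergodicSMul_bernoulliQuotient_prod (hσ : ∀ n, (range fun g => σ₀ g n).Infinite)
    (K : Type*) [CommGroup K] [TopologicalSpace K] [IsTopologicalGroup K] [CompactSpace K]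
    [MeasurableSpace K] [BorelSpace K]
    {Y : Type*} [MeasurableSpace Y] [MulAction Γ Y] [MeasurableConstSMul Γ Y] (ν : Measure Y)
    [IsProbabilityMeasure ν] [ErgodicSMul Γ Y ν] :
    ErgodicSMul Γ (BernoulliQuotient σ₀ K × Y) ((BernoulliQuotient.measure σ₀ K).prod ν) := by
  have := ergodicSMul_shift_prod σ₀ hσ (probHaar K) ν
  exact ErgodicSMul.of_factor (measurePreserving_mkProd σ₀ ν) fun g => ae_of_all _ fun z => rfl

end QuotientSpace

end PMP

theorem corollary4p11
    {Γ : Type*} [Group Γ] [Countable Γ]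
    (Λ : Subgroup Γ) (Δ : Subgroup Λ) [Δ.Normal]
    (hrigid : PMP.HasSuperrigidMalleableActions (Λ ⧸ Δ) Circle)
    (σ₀ : Γ →* Equiv.Perm ℕ) (hσ₀ : PMP.IsSuitable Δ (σ₀.comp Λ.subtype))
    {Y : Type*} [MeasurableSpace Y] [StandardBorelSpace Y]
    (ν : Measure Y) [IsProbabilityMeasure ν]
    [MulAction Γ Y] [MeasurableConstSMul Γ Y] [SMulInvariantMeasure Γ Y ν]
    (hfree : PMP.IsAEFree Γ ν) (hwm : PMP.IsWeaklyMixing Γ ν) (herg : ErgodicSMul Δ Y ν) :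
    (∀ (A : Type*) [CommGroup A] [Countable A] [IsMulTorsionFree A]
        [TopologicalSpace A] [DiscreteTopology A],
      StandardBorelSpace (PMP.BernoulliQuotient σ₀ (PontryaginDual A) × Y) ∧
      IsProbabilityMeasure ((PMP.BernoulliQuotient.measure σ₀ (PontryaginDual A)).prod ν) ∧
      MeasurableConstSMul Γ (PMP.BernoulliQuotient σ₀ (PontryaginDual A) × Y) ∧
      SMulInvariantMeasure Γ (PMP.BernoulliQuotient σ₀ (PontryaginDual A) × Y)
        ((PMP.BernoulliQuotient.measure σ₀ (PontryaginDual A)).prod ν) ∧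
      PMP.IsAEFree Γ ((PMP.BernoulliQuotient.measure σ₀ (PontryaginDual A)).prod ν) ∧
      ErgodicSMul Γ (PMP.BernoulliQuotient σ₀ (PontryaginDual A) × Y)
        ((PMP.BernoulliQuotient.measure σ₀ (PontryaginDual A)).prod ν)) ∧
    (∀ (A₀ A₁ : Type*) [CommGroup A₀] [Countable A₀] [IsMulTorsionFree A₀]
        [TopologicalSpace A₀] [DiscreteTopology A₀]
        [CommGroup A₁] [Countable A₁] [IsMulTorsionFree A₁]
        [TopologicalSpace A₁] [DiscreteTopology A₁],
      Nonempty (A₀ ≃* A₁) ↔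
        PMP.Conjugate Γ
          ((PMP.BernoulliQuotient.measure σ₀ (PontryaginDual A₀)).prod ν)
          ((PMP.BernoulliQuotient.measure σ₀ (PontryaginDual A₁)).prod ν)) := by
  have hergΛ : ErgodicSMul Λ Y ν := PMP.ErgodicSMul.of_subgroup Δ
  have hergΓ : ErgodicSMul Γ Y ν := PMP.ErgodicSMul.of_subgroup Λ
  have hΓ : ∀ n, (Set.range fun g : Γ => σ₀ g n).Infinite := fun n =>
    (hσ₀.1 n).mono (by
      rintro _ ⟨g, rfl⟩
      exact ⟨(g : Γ), rfl⟩)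
  refine ⟨fun A _ _ _ _ _ => ⟨inferInstance, inferInstance, inferInstance, inferInstance,
    hfree.prod _, PMP.ergodicSMul_bernoulliQuotient_prod hΓ _ ν⟩, fun A₀ A₁ _ _ _ _ _ _ _ _ _ _ =>
    ⟨fun ⟨e⟩ => PMP.conjugate_of_mulEquiv σ₀ ν e, fun ⟨T, hT, hTeq⟩ => ?_⟩⟩
  -- The orbit space for the restricted action is the same by definition, so a conjugacy over `Γ` is
  -- also one over `Λ`.
  exact PMP.nonempty_mulEquiv_of_conjugate (L := Λ) (σ := σ₀.comp Λ.subtype) hrigid hσ₀ A₀ A₁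
    ⟨T, hT, fun g => hTeq g⟩
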